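/- Let $(X,dx)$ and $(Y,dy)$ be $\sigma$-finite measure spaces and let $\mathcal H,\mathcal G$ be separable complex Hilbert spaces. For a compact operator $A$ between Hilbert spaces let $s_1(A)\ge s_2(A)\ge\dots\ge 0$ be its singular values, i.e. the square roots of the eigenvalues of $A^*A$, counted with multiplicity (and continued by zeros if necessary). For $0<p<\infty$, the Schatten class $\mathcal S_p$ consists of the compact $A$ with $\|A\|_{\mathcal S_p}=\big(\sum_{n\ge1}s_n(A)^p\big)^{1/p}<\infty$, and the weak Schatten class $\mathcal S_{p,\mathrm w}$ of the compact $A$ with $\|A\|_{p,\mathrm w}=\big(\sup_{n\ge 1} n\,s_n(A)^p\big)^{1/p}<\infty$. An operator-valued function $f$ is called measurable if $x\mapsto f(x)h$ is measurable for every vector $h$. Let $L^p(X,\mathcal S_p(\mathcal H))$ be the set of measurable $f:X\to\mathcal S_p(\mathcal H)$ (defined almost everywhere) with $\|f\|^p_{L^p(X,\mathcal S_p(\mathcal H))}=\int_X\|f(x)\|_{\mathcal S_p}^p\,dx<\infty$, and let $L^p_{\mathrm w}(Y,\mathcal B(\mathcal G))$ be the set of measurable functions $g$ from $Y$ to the bounded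 operators on $\mathcal G$ with $\|g\|^p_{L^p_{\mathrm w}(Y,\mathcal B(\mathcal G))}=\sup_{t>0}t^p\,\big|\{y\in Y:\|g(y)\|_{\mathcal B(\mathcal G)}>t\}\big|<\infty$. Theorem. Let $\Phi:L^2(X,\mathcal H)\to L^2(Y,\mathcal G)$ be a unitary operator which is also bounded from $L^1(X,\mathcal H)$ to $L^\infty(Y,\mathcal G)$, that is, there is a bounded operator from $L^1(X,\mathcal H)$ to $L^\infty(Y,\mathcal G)$ that agrees with $\Phi$ on $L^1\cap L^2$; denote its norm by $\|\Phi\|_{L^1\to L^\infty}$. Let $p>2$, $f\in L^p(X,\mathcal S_p(\mathcal H))$ and $g\in L^p_{\mathrm w}(Y,\mathcal B(\mathcal G))$. Then the operator $f\Phi^*g:\psi\mapsto f\,\Phi^*(g\psi)$, with its natural domain $\{\psi\in L^2(Y,\mathcal G): g\psi\in L^2(Y,\mathcal G),\ f\Phi^*(g\psi)\in L^2(X,\mathcal H)\}$, is densely defined and extends to a bounded operator from $L^2(Y,\mathcal G)$ to $L^2(X,\mathcal H)$, again denoted by $f\Phi^*g$. This operator lies in $\mathcal S_{p,\mathrm w}$,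 and $$\|f\Phi^*g\|_{p,\mathrm w}^p=\sup_{n\ge1} n\,s_n(f\Phi^*g)^p\le\frac{2(p-2)}{p+2}\Big(\frac{p}{p-2}\Big)^p\,\|\Phi\|_{L^1\to L^\infty}^2\,\|f\|^p_{L^p(X,\mathcal S_p(\mathcal H))}\,\|g\|^p_{L^p_{\mathrm w}(Y,\mathcal B(\mathcal G))}.$$ -/

import Mathlib

open MeasureTheory
open scoped ENNReal

noncomputable section

namespace Cwikel

section SingularValues

variable {E F : Type*}
  [NormedAddCommGroup E] [InnerProductSpace ℂ E] [CompleteSpace E]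
  [NormedAddCommGroup F] [InnerProductSpace ℂ F] [CompleteSpace F]

/-- The span of the eigenvectors of `A* A` belonging to the eigenvalues `s ^ 2` with `s > t`.
For compact `A` and `t ≥ 0` its dimension is the number of singular values of `A` (square roots
of the eigenvalues of `A* A`, counted with multiplicity) that are greater than `t`. -/
def eigenspacesAbove (A : E →L[ℂ] F) (t : ℝ) : Submodule ℂ E :=
  ⨆ (s : ℝ) (_ : t < s), Module.End.eigenspace
    ((ContinuousLinearMap.adjoint A ∘L A : E →L[ℂ] E) : Module.End ℂ E) ((s ^ 2 : ℝ) : ℂ)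

/-- The singular values of `A`, i.e. the square roots of the eigenvalues of `A* A`, in
nonincreasing order, counted with multiplicity, and continued by zero if there are only finitely
many positive ones. The numbering starts at zero: `singularValue A n` is the `(n + 1)`-st largest
one, that is, the least `t ≥ 0` such that at most `n` singular values exceed `t`.
Only used for compact operators. -/
def singularValue (A : E →L[ℂ] F) (n : ℕ) : ℝ :=
  sInf {t : ℝ | 0 ≤ t ∧ Module.rank ℂ (eigenspacesAbove A t) ≤ (n : Cardinal)}

/-- The Schatten norm `(∑ₙ sₙ(A) ^ p) ^ (1 / p)` of a compact operator. -/
def eSchattenNorm (p : ℝ) (A : E →L[ℂ] F) : ℝ≥0∞ :=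
  (∑' n : ℕ, ENNReal.ofReal (singularValue A n) ^ p) ^ (1 / p)

/-- The von Neumann-Schatten class `S_p`: compact operators with `p`-summable singular values. -/
def MemSchatten (p : ℝ) (A : E →L[ℂ] F) : Prop :=
  IsCompactOperator A ∧ eSchattenNorm p A < ∞

/-- The weak Schatten quasi-norm `(sup_{n ≥ 1} n s_n(A) ^ p) ^ (1 / p)` of a compact operator. -/
def eWeakSchattenNorm (p : ℝ) (A : E →L[ℂ] F) : ℝ≥0∞ :=
  (⨆ n : ℕ, ((n + 1 : ℕ) : ℝ≥0∞) * ENNReal.ofReal (singularValue A n) ^ p) ^ (1 / p)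

/-- The weak Schatten class `S_{p,w}`. -/
def MemWeakSchatten (p : ℝ) (A : E →L[ℂ] F) : Prop :=
  IsCompactOperator A ∧ eWeakSchattenNorm p A < ∞

end SingularValues

section OperatorValued

variable {X : Type*} [MeasurableSpace X]
  {H : Type*} [NormedAddCommGroup H] [InnerProductSpace ℂ H] [CompleteSpace H]

/-- Measurability of an operator-valued function: `x ↦ f x h` is measurable (up to null sets)
for every vector `h`. -/
def OpMeasurable (f : X → H →L[ℂ] H) (μ : Measure X) : Prop :=
  ∀ h : H, AEStronglyMeasurable (fun x => f x h) μ

/-- The norm of `L^p(X, S_p(H))`: `(∫ ‖f(x)‖_{S_p} ^ p dx) ^ (1 / p)`. -/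
def eLpSchattenNorm (p : ℝ) (f : X → H →L[ℂ] H) (μ : Measure X) : ℝ≥0∞ :=
  (∫⁻ x, eSchattenNorm p (f x) ^ p ∂μ) ^ (1 / p)

/-- Membership in `L^p(X, S_p(H))`. -/
structure MemLpSchatten (p : ℝ) (f : X → H →L[ℂ] H) (μ : Measure X) : Prop where
  measurable : OpMeasurable f μ
  memSchatten : ∀ᵐ x ∂μ, MemSchatten p (f x)
  norm_lt_top : eLpSchattenNorm p f μ < ∞

/-- The quasi-norm of `L^p_w(X, B(H))`: `(sup_{t > 0} t ^ p |{‖f‖ > t}|) ^ (1 / p)`. -/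
def eWeakLpNorm (p : ℝ) (f : X → H →L[ℂ] H) (μ : Measure X) : ℝ≥0∞ :=
  (⨆ (t : ℝ) (_ : 0 < t), ENNReal.ofReal t ^ p * μ {x | t < ‖f x‖}) ^ (1 / p)

/-- Membership in `L^p_w(X, B(H))`. -/
structure MemWeakLp (p : ℝ) (f : X → H →L[ℂ] H) (μ : Measure X) : Prop where
  measurable : OpMeasurable f μ
  norm_lt_top : eWeakLpNorm p f μ < ∞

/-- Multiplication by the operator-valued function `f`, as an (in general unbounded) operator on
`L²(X, H)` with its maximal domain `{φ | f φ ∈ L²(X, H)}`. -/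
def mulOp (f : X → H →L[ℂ] H) (μ : Measure X) : Lp H 2 μ →ₗ.[ℂ] Lp H 2 μ where
  domain :=
    { carrier := {φ | MemLp (fun x => f x (φ x)) 2 μ}
      zero_mem' := by
        have h : (fun x => f x ((0 : Lp H 2 μ) x)) =ᵐ[μ] fun _ => (0 : H) := by
          filter_upwards [Lp.coeFn_zero H 2 μ] with x hx
          rw [hx]
          exact map_zero (f x)
        exact (memLp_congr_ae h).2 MemLp.zero'
      add_mem' := by
        intro a b ha hb
        have h : (fun x => f x ((a + b : Lp H 2 μ) x)) =ᵐ[μ]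
            (fun x => f x (a x)) + fun x => f x (b x) := by
          filter_upwards [Lp.coeFn_add a b] with x hx
          rw [hx]
          exact map_add (f x) _ _
        exact (memLp_congr_ae h).2 (MemLp.add ha hb)
      smul_mem' := by
        intro c a ha
        have h : (fun x => f x ((c • a : Lp H 2 μ) x)) =ᵐ[μ] c • fun x => f x (a x) := by
          filter_upwards [Lp.coeFn_smul c a] with x hx
          rw [hx]
          exact map_smul (f x) _ _
        exact (memLp_congr_ae h).2 (MemLp.const_smul ha c) }
  toFun :=
    { toFun := fun φ => MemLp.toLp (fun x => f x ((φ : Lp H 2 μ) x)) φ.2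
      map_add' := by
        intro a b
        rw [← MemLp.toLp_add, MemLp.toLp_eq_toLp_iff]
        filter_upwards [Lp.coeFn_add (a : Lp H 2 μ) b] with x hx
        exact (congrArg (f x) hx).trans (map_add (f x) _ _)
      map_smul' := by
        intro c a
        rw [RingHom.id_apply, ← MemLp.toLp_const_smul, MemLp.toLp_eq_toLp_iff]
        filter_upwards [Lp.coeFn_smul c (a : Lp H 2 μ)] with x hx
        exact (congrArg (f x) hx).trans (map_smul (f x) _ _) }

end OperatorValued

/-- The composition `S ∘ T` of partially defined operators with its natural domain
`{x ∈ dom T | T x ∈ dom S}`. -/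
def pmapComp {E F G : Type*} [AddCommGroup E] [Module ℂ E] [AddCommGroup F] [Module ℂ F]
    [AddCommGroup G] [Module ℂ G] (S : F →ₗ.[ℂ] G) (T : E →ₗ.[ℂ] F) : E →ₗ.[ℂ] G :=
  S.comp (T.domRestrict ((S.domain.comap T.toFun).map T.domain.subtype)) (by
    rintro ⟨x, hx⟩
    obtain ⟨⟨y, hy, rfl⟩, hx2⟩ := hx
    exact hy)

section Sandwich

variable {X Y : Type*} [MeasurableSpace X] [MeasurableSpace Y]
  {H : Type*} [NormedAddCommGroup H] [InnerProductSpace ℂ H] [CompleteSpace H]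
  {G : Type*} [NormedAddCommGroup G] [InnerProductSpace ℂ G] [CompleteSpace G]

/-- The operator `f Φ* g` from `L²(Y, G)` to `L²(X, H)`, `ψ ↦ f Φ* (g ψ)`, with its natural domain
`{ψ | g ψ ∈ L²(Y, G) and f Φ* (g ψ) ∈ L²(X, H)}`. -/
def sandwich (μ : Measure X) (ν : Measure Y) (f : X → H →L[ℂ] H)
    (Φ : Lp H 2 μ →L[ℂ] Lp G 2 ν) (g : Y → G →L[ℂ] G) : Lp G 2 ν →ₗ.[ℂ] Lp H 2 μ :=
  pmapComp (mulOp f μ)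
    ((ContinuousLinearMap.adjoint Φ : Lp G 2 ν →ₗ[ℂ] Lp H 2 μ).compPMap (mulOp g ν))

end Sandwich

end Cwikel

end

noncomputable section

namespace Cwikel

/-! ### Singular values and the eigenvectors of `A* A` -/

section SingularValues

variable {E F : Type*}
  [NormedAddCommGroup E] [InnerProductSpace ℂ E] [CompleteSpace E]
  [NormedAddCommGroup F] [InnerProductSpace ℂ F] [CompleteSpace F]

open ContinuousLinearMap Module.End

/-! Everything is read off from the adjoint `A* = g* Φ f*`. The core is a count: if `A*` is bounded
below by `r > 0` on an `N`-dimensional space, then `N r ^ p ≤ C`, where `C` is the right-hand side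
of the theorem. The case `N = 1` on simple functions gives boundedness. The full count gives
compactness (`isCompactOperator_of_finrank_mul_rpow_le`) and the bound on singular values
(`mul_singularValue_rpow_le`). By density it suffices to count families of simple functions.

For such families `f*` is approximated by simple functions as well, and a singular value
decomposition on each fibre writes `f* η = ∑ α, (J η) α • s α • χ α`. Here `J` is a contraction, and
the `χ α` are orthogonal, of norm at most one, each living on a piece of measure `q α`. Put `θ α = Φ
(χ α)`. Unitarity keeps the `θ α` orthogonal, and the `L¹ → L^∞` bound gives `‖θ α y‖ ^ 2 ≤ ‖Φ₁‖ ^ 2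
* q α`.

Now let `γ = ‖g‖ / t` and split `σ = s α * γ y` as `min σ σ⁻¹` plus a remainder. The first piece
gives an operator of norm at most `t`, although `γ` varies with `y`. Indeed `min b a` is the
integral of the indicator of `(0, a]` over `(0, b]`, so Cauchy-Schwarz bounds the pointwise square
by a quadratic form whose kernel depends only on the `s α` (`norm_sum_min_inv_smul_sq_le`). After
integration in `y`, orthogonality leaves only the diagonal (`lintegral_sum_min_smul_sq_le`). The
remainder vanishes for `σ ≤ 1` and gives a Hilbert-Schmidt operator, whose norm the layer-cake
formula and the weak `L^p` bound control (`lintegral_sq_sub_min_le`). On an orthonormal system of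
`N` vectors the Hilbert-Schmidt part has squared norm at least `N (r - t) ^ 2`, and optimizing in
`t` gives the constant (`discrete_cwikel`).

What remains is `∑ α, q α * s α ^ p`. Up to the approximation error it is at most the `p`-th power
of the norm of `f`, because for `p ≥ 2` the Schatten norm dominates `∑ j, ‖A* a j‖ ^ p` over any
finite orthonormal system (`sum_norm_adjoint_rpow_le`). -/

theorem isSymmetric_adjoint_comp_self (A : E →L[ℂ] F) :
    (((adjoint A ∘L A : E →L[ℂ] E) : Module.End ℂ E) : E →ₗ[ℂ] E).IsSymmetric := by
  intro x y
  simp [adjoint_inner_left, adjoint_inner_right]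

theorem singularValue_nonneg (A : E →L[ℂ] F) (n : ℕ) : 0 ≤ singularValue A n :=
  Real.sInf_nonneg fun _ ht => ht.1

theorem lt_rank_of_lt_singularValue {A : E →L[ℂ] F} {n : ℕ} {t : ℝ} (ht : 0 ≤ t)
    (h : t < singularValue A n) : (n : Cardinal) < Module.rank ℂ (eigenspacesAbove A t) := by
  by_contra! hle
  exact h.not_ge (csInf_le ⟨0, fun _ hs => hs.1⟩ ⟨ht, hle⟩)

/-- Elements of a supremum of submodules are finite sums. Since `t ≥ 0`, squaring is injective on
the admissible `s`, so different `s` belong to different eigenvalues of a symmetric operator. -/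
theorem exists_orthogonal_decomposition {A : E →L[ℂ] F} {t : ℝ} (ht : 0 ≤ t) {x : E}
    (hx : x ∈ eigenspacesAbove A t) :
    ∃ (S : Finset {s : ℝ // t < s}) (y : {s : ℝ // t < s} → E), x = ∑ s ∈ S, y s ∧
      (∀ s, adjoint A (A (y s)) = ((s : ℝ) ^ 2 : ℂ) • y s) ∧
      ∀ s s', s ≠ s' → inner ℂ (y s) (y s') = 0 := by
  classical
  unfold eigenspacesAbove at hx
  rw [iSup_subtype', Submodule.mem_iSup_iff_exists_dfinsupp'] at hx
  obtain ⟨y, hy⟩ := hx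
  have hy2 : ∀ s, adjoint A (A (y s : E)) = ((s : ℝ) ^ 2 : ℂ) • (y s : E) := fun s => by
    have := mem_eigenspace_iff.1 (y s).2
    simpa using this
  refine ⟨y.support, fun s => y s, ?_, hy2, ?_⟩
  · rw [← hy]; rfl
  · intro s s' hs
    have h := (isSymmetric_adjoint_comp_self A).orthogonalFamily_eigenspaces
      (i := ((s : ℝ) ^ 2 : ℝ)) (j := ((s' : ℝ) ^ 2 : ℝ)) (by
        intro h
        apply hs
        have h1 : (s : ℝ) ^ 2 = (s' : ℝ) ^ 2 := by exact_mod_cast h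
        have h2 : (0 : ℝ) ≤ s := ht.trans s.2.le
        have h3 : (0 : ℝ) ≤ s' := ht.trans s'.2.le
        exact Subtype.ext ((sq_eq_sq₀ h2 h3).1 h1))
    exact h (y s) (y s')

theorem ofReal_norm_sq (z : E) : ((‖z‖ ^ 2 : ℝ) : ℂ) = inner ℂ z z := by
  rw [inner_self_eq_norm_sq_to_K]
  simp

theorem norm_sum_sq_of_orthogonal {ι : Type*} (S : Finset ι) (y : ι → E)
    (h : ∀ s s', s ≠ s' → inner ℂ (y s) (y s') = 0) :
    ‖∑ s ∈ S, y s‖ ^ 2 = ∑ s ∈ S, ‖y s‖ ^ 2 := by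
  have : ((‖∑ s ∈ S, y s‖ ^ 2 : ℝ) : ℂ) = ((∑ s ∈ S, ‖y s‖ ^ 2 : ℝ) : ℂ) := by
    rw [ofReal_norm_sq, sum_inner, Complex.ofReal_sum]
    refine Finset.sum_congr rfl fun s hs => ?_
    rw [inner_sum, Finset.sum_eq_single s, ofReal_norm_sq]
    · intro s' _ h'
      exact h s s' h'.symm
    · exact fun h => (h hs).elim
  exact_mod_cast this

theorem ofReal_norm_sq_apply (A : E →L[ℂ] F) (x : E) :
    ((‖A x‖ ^ 2 : ℝ) : ℂ) = inner ℂ (adjoint A (A x)) x := by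
  rw [adjoint_inner_left, ofReal_norm_sq]

theorem norm_apply_sum_sq {A : E →L[ℂ] F} {ι : Type*} (S : Finset ι) {y : ι → E} {l : ι → ℝ}
    (hy : ∀ s, adjoint A (A (y s)) = ((l s) ^ 2 : ℂ) • y s)
    (ho : ∀ s s', s ≠ s' → inner ℂ (y s) (y s') = 0) :
    ‖A (∑ s ∈ S, y s)‖ ^ 2 = ∑ s ∈ S, (l s) ^ 2 * ‖y s‖ ^ 2 := by
  have h2 : ((‖A (∑ s ∈ S, y s)‖ ^ 2 : ℝ) : ℂ) = ((∑ s ∈ S, (l s) ^ 2 * ‖y s‖ ^ 2 : ℝ) : ℂ) := by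
    rw [ofReal_norm_sq_apply, map_sum, map_sum, sum_inner, Complex.ofReal_sum]
    refine Finset.sum_congr rfl fun s hs => ?_
    rw [hy, inner_smul_left, inner_sum, Finset.sum_eq_single s, ← ofReal_norm_sq]
    · simp
    · intro s' _ h'
      exact ho s s' h'.symm
    · exact fun h => (h hs).elim
  exact_mod_cast h2

/-- On the span of the eigenvectors of `A* A` to eigenvalues above `t ^ 2`, `A` is injective. -/
theorem eq_zero_of_mem_eigenspacesAbove {A : E →L[ℂ] F} {t : ℝ} (ht : 0 ≤ t) {x : E}
    (hx : x ∈ eigenspacesAbove A t) (h0 : A x = 0) : x = 0 := by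
  obtain ⟨S, y, rfl, hy, ho⟩ := exists_orthogonal_decomposition ht hx
  have h2 := (norm_apply_sum_sq S hy ho).symm
  rw [h0, norm_zero, zero_pow two_ne_zero,
    Finset.sum_eq_zero_iff_of_nonneg (fun s _ => by positivity)] at h2
  refine Finset.sum_eq_zero fun s hs => ?_
  have h3 : (s : ℝ) ≠ 0 := (ht.trans_lt s.2).ne'
  simpa [h3] using h2 s hs

/-- Along the orthogonal eigenvectors the two squared norms carry the weights `s ^ 2` and `s ^ 4`,
and `s > t`. Thus the image under `A` of `eigenspacesAbove A t` is a test space for the count. -/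
theorem le_norm_adjoint_apply {A : E →L[ℂ] F} {t : ℝ} (ht : 0 ≤ t) {x : E}
    (hx : x ∈ eigenspacesAbove A t) : t * ‖A x‖ ≤ ‖adjoint A (A x)‖ := by
  obtain ⟨S, y, rfl, hy, ho⟩ := exists_orthogonal_decomposition ht hx
  have h1 := norm_apply_sum_sq S hy ho
  have h2 : ‖adjoint A (A (∑ s ∈ S, y s))‖ ^ 2 = ∑ s ∈ S, ((s : ℝ) ^ 2) ^ 2 * ‖y s‖ ^ 2 := by
    rw [map_sum, map_sum, norm_sum_sq_of_orthogonal]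
    · refine Finset.sum_congr rfl fun s hs => ?_
      rw [hy, norm_smul]
      simp [mul_pow]
    · intro s s' h
      simp [hy, ho s s' h]
  refine (pow_le_pow_iff_left₀ (by positivity) (norm_nonneg _) two_ne_zero).1 ?_
  rw [mul_pow, h1, h2, Finset.mul_sum]
  refine Finset.sum_le_sum fun s _ => ?_
  have h3 : t ^ 2 ≤ (s : ℝ) ^ 2 := pow_le_pow_left₀ ht s.2.le 2
  calc t ^ 2 * ((s : ℝ) ^ 2 * ‖y s‖ ^ 2) ≤ (s : ℝ) ^ 2 * ((s : ℝ) ^ 2 * ‖y s‖ ^ 2) := by gcongr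
    _ = _ := by ring

theorem le_singularValue {A : E →L[ℂ] F} {n : ℕ} {r : ℝ} {h : Fin (n + 1) → E}
    (ho : Orthonormal ℂ h) {s : Fin (n + 1) → ℝ}
    (hs : ∀ i, adjoint A (A (h i)) = ((s i) ^ 2 : ℂ) • h i) (hr : ∀ i, r ≤ s i) :
    r ≤ singularValue A n := by
  -- No eigenvalue of `A* A` exceeds `‖A‖ ^ 2`, so `‖A‖` shows that the infimum is over a nonempty
  -- set.
  refine le_csInf ⟨‖A‖, norm_nonneg _, ?_⟩ ?_
  · have : eigenspacesAbove A ‖A‖ = ⊥ := by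
      rw [eq_bot_iff]
      intro x hx
      by_contra hx0
      obtain ⟨S, y, rfl, hy, ho⟩ := exists_orthogonal_decomposition (norm_nonneg _) hx
      apply hx0
      rw [Submodule.mem_bot]
      refine Finset.sum_eq_zero fun s _ => ?_
      by_contra h0
      have h1 : ‖adjoint A (A (y s))‖ ≤ ‖A‖ * (‖A‖ * ‖y s‖) :=
        (le_opNorm _ _).trans (by
          rw [LinearIsometryEquiv.norm_map]
          gcongr
          exact le_opNorm _ _)
      rw [hy, norm_smul] at h1
      have h2 : 0 < ‖y s‖ := norm_pos_iff.2 h0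
      have h3 : ‖A‖ ^ 2 < (s : ℝ) ^ 2 := pow_lt_pow_left₀ s.2 (norm_nonneg _) (by norm_num)
      have h4 : ‖((s : ℝ) ^ 2 : ℂ)‖ = (s : ℝ) ^ 2 := by simp
      rw [h4] at h1
      nlinarith
    rw [this]
    simp
  · rintro t ⟨ht, hrank⟩
    by_contra! hlt
    have hmem : ∀ i, h i ∈ eigenspacesAbove A t := fun i => by
      refine Submodule.mem_iSup_of_mem (s i) (Submodule.mem_iSup_of_mem (hlt.trans_le (hr i)) ?_)
      rw [mem_eigenspace_iff]
      simpa using hs i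
    have hli : LinearIndependent ℂ (fun i => (⟨h i, hmem i⟩ : eigenspacesAbove A t)) :=
      LinearIndependent.of_comp (eigenspacesAbove A t).subtype (by simpa [Function.comp_def] using ho.linearIndependent)
    have := hli.cardinal_lift_le_rank
    have h2 := this.trans (Cardinal.lift_le.2 hrank)
    simp only [Cardinal.mk_fin, Cardinal.lift_natCast] at h2
    exact absurd (Nat.cast_le.1 h2) (by simp)

end SingularValues

end Cwikel

namespace Cwikel

/-! ### Schatten norms tested on orthonormal systems -/

section Schatten

universe u

variable {E F : Type*}
  [NormedAddCommGroup E] [InnerProductSpace ℂ E] [CompleteSpace E]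
  [NormedAddCommGroup F] [InnerProductSpace ℂ F] [CompleteSpace F]

open ContinuousLinearMap Module.End

/-- The spectral theorem for the compact symmetric operator `A* A`: bases of all eigenspaces, the
kernel included, are collected. The eigenvalue is identified by pairing `A* A b` with the unit
vector `b`. -/
theorem exists_hilbertBasis_eigenvectors {E : Type u} [NormedAddCommGroup E] [InnerProductSpace ℂ E]
    [CompleteSpace E] {A : E →L[ℂ] F} (hA : IsCompactOperator A) :
    ∃ (ι : Type u) (b : HilbertBasis ι ℂ E),
      ∀ i, adjoint A (A (b i)) = (‖A (b i)‖ ^ 2 : ℂ) • b i := by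
  set T : E →L[ℂ] E := adjoint A ∘L A with hT
  have hTc : IsCompactOperator T := hA.clm_comp (adjoint A)
  have hTs : (T : E →ₗ[ℂ] E).IsSymmetric := isSymmetric_adjoint_comp_self A
  have hcomp : ∀ μ : ℂ, CompleteSpace (eigenspace (T : Module.End ℂ E) μ) := fun μ => by
    have : IsClosed (eigenspace (T : Module.End ℂ E) μ : Set E) := by
      have h : (eigenspace (T : Module.End ℂ E) μ : Set E) = {x | T x = μ • x} := by
        ext x
        exact mem_eigenspace_iff
      rw [h]
      exact isClosed_eq T.continuous (continuous_const_smul μ)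
    exact this.completeSpace_coe
  choose w b hb using fun μ : ℂ => exists_hilbertBasis ℂ (eigenspace (T : Module.End ℂ E) μ)
  have ho := hTs.orthogonalFamily_eigenspaces.orthonormal_sigma_orthonormal
    (fun μ => (b μ).orthonormal)
  have hbot := orthogonalComplement_iSup_eigenspaces_eq_bot hTc hTs
  refine ⟨_, HilbertBasis.mkOfOrthogonalEqBot ho ?_, ?_⟩
  · rw [eq_bot_iff, ← hbot]
    intro x hx
    rw [← Submodule.iInf_orthogonal, Submodule.mem_iInf]
    intro μ y hy
    have hs := ((b μ).hasSum_repr ⟨y, hy⟩).mapL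
      (((innerSL ℂ x) ∘L (eigenspace (T : Module.End ℂ E) μ).subtypeL))
    have h0 : ∀ i, ((innerSL ℂ x) ∘L (eigenspace (T : Module.End ℂ E) μ).subtypeL)
        ((b μ).repr ⟨y, hy⟩ i • b μ i) = 0 := fun i => by
      have hi : (b μ i : E) ∈ Set.range fun a : Σ μ, w μ =>
          (eigenspace (T : Module.End ℂ E) a.1).subtypeₗᵢ (b a.1 a.2) := ⟨⟨μ, i⟩, rfl⟩
      have h2 : inner ℂ x ((b μ i : E)) = 0 :=
        Submodule.inner_left_of_mem_orthogonal (Submodule.subset_span hi) hx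
      simp [h2]
    simp only [h0] at hs
    have := hs.unique hasSum_zero
    exact inner_eq_zero_symm.1 this
  · rintro ⟨μ, i⟩
    rw [HilbertBasis.coe_mkOfOrthogonalEqBot]
    have h1 : T (b μ i : E) = μ • (b μ i : E) := mem_eigenspace_iff.1 (b μ i).2
    have h2 : ‖(b μ i : E)‖ = 1 := (b μ).orthonormal.1 i
    change T (b μ i : E) = (‖A (b μ i : E)‖ ^ 2 : ℂ) • (b μ i : E)
    rw [h1]
    congr 1
    have h3 := ofReal_norm_sq_apply A (b μ i : E)
    have h4 : adjoint A (A (b μ i : E)) = μ • (b μ i : E) := h1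
    rw [h4, inner_smul_left, ← ofReal_norm_sq, h2] at h3
    have h5 : (starRingEnd ℂ) μ = ((‖A (b μ i : E)‖ ^ 2 : ℝ) : ℂ) := by simpa using h3.symm
    have := congrArg (starRingEnd ℂ) h5
    simpa using this

theorem sum_norm_apply_rpow_le {A : E →L[ℂ] F} {ι : Type*} {b : ι → E} (hb : Orthonormal ℂ b)
    (hA : ∀ i, adjoint A (A (b i)) = (‖A (b i)‖ ^ 2 : ℂ) • b i) {p : ℝ} (hp : 0 ≤ p)
    (S : Finset ι) :
    ∑ i ∈ S, ENNReal.ofReal (‖A (b i)‖) ^ p ≤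
      ∑' n : ℕ, ENNReal.ofReal (singularValue A n) ^ p := by
  classical
  let e : Fin S.card ≃ S := S.equivFin.symm
  -- The sign turns the increasing sort into a decreasing arrangement, so the first `i + 1` vectors
  -- all have `‖A b‖` at least as large as the `i`-th.
  let r : Fin S.card → ℝ := fun i => -‖A (b (e i))‖
  let σ := Tuple.sort r
  have hmono : Monotone (r ∘ σ) := Tuple.monotone_sort r
  calc ∑ i ∈ S, ENNReal.ofReal (‖A (b i)‖) ^ p
      = ∑ i : S, ENNReal.ofReal (‖A (b i)‖) ^ p := (Finset.sum_coe_sort S _).symm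
    _ = ∑ i : Fin S.card, ENNReal.ofReal (‖A (b (e (σ i)))‖) ^ p :=
        ((σ.trans e).sum_comp (fun i : S => ENNReal.ofReal (‖A (b i)‖) ^ p)).symm
    _ ≤ ∑ i : Fin S.card, ENNReal.ofReal (singularValue A i) ^ p := by
        refine Finset.sum_le_sum fun i _ => ?_
        refine ENNReal.rpow_le_rpow (ENNReal.ofReal_le_ofReal ?_) hp
        let c : Fin ((i : ℕ) + 1) → Fin S.card := Fin.castLE i.2
        have hinj : Function.Injective (fun k => ((e (σ (c k)) : S) : ι)) :=
          Subtype.val_injective.comp (e.injective.comp (σ.injective.comp (Fin.castLE_injective _)))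
        refine le_singularValue (hb.comp _ hinj) (s := fun k => ‖A (b (e (σ (c k))))‖)
          (fun k => hA _) fun k => ?_
        have hk : c k ≤ i := by
          rw [Fin.le_iff_val_le_val]
          exact Nat.lt_succ_iff.1 k.2
        have := hmono hk
        simpa [r] using this
    _ = ∑ i ∈ Finset.range S.card, ENNReal.ofReal (singularValue A i) ^ p :=
        Fin.sum_univ_eq_sum_range (fun n => ENNReal.ofReal (singularValue A n) ^ p) _
    _ ≤ _ := ENNReal.sum_le_tsum _

/-- With left singular vectors `c k`, Parseval gives `‖A* a j‖ ^ 2 = ∑ k, ‖⟨c k, a j⟩‖ ^ 2 * ‖A (b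
k)‖ ^ 2`. By Bessel the weights sum to at most one in `k` and in `j`, so Jensen for the convex
function `x ^ (p / 2)` applies. -/
theorem sum_norm_adjoint_rpow_le {A : E →L[ℂ] F} (hA : IsCompactOperator A) {p : ℝ} (hp : 2 ≤ p)
    {ι : Type*} [Fintype ι] {a : ι → F} (ha : Orthonormal ℂ a) :
    ∑ j, ENNReal.ofReal ‖adjoint A (a j)‖ ^ p ≤
      ∑' n : ℕ, ENNReal.ofReal (singularValue A n) ^ p := by
  obtain ⟨κ, b, hb⟩ := exists_hilbertBasis_eigenvectors hA
  -- `c k j` are the weights with `‖A* a j‖ ^ 2 = ∑ k, ‖A b k‖ ^ 2 * c k j`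
  have hsum : ∀ j, HasSum (fun k => ‖inner ℂ (A (b k)) (a j)‖ ^ 2) (‖adjoint A (a j)‖ ^ 2) :=
    fun j => by
    have h := b.hasSum_inner_mul_inner (adjoint A (a j)) (adjoint A (a j))
    rw [← ofReal_norm_sq] at h
    have h2 : ∀ k, inner ℂ (adjoint A (a j)) (b k) * inner ℂ (b k) (adjoint A (a j)) =
        ((‖inner ℂ (A (b k)) (a j)‖ ^ 2 : ℝ) : ℂ) := fun k => by
      rw [adjoint_inner_left, adjoint_inner_right, ← inner_conj_symm, Complex.conj_mul']
      norm_cast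
    simp only [h2] at h
    exact_mod_cast h
  have horth : ∀ k k', k ≠ k' → inner ℂ (A (b k)) (A (b k')) = 0 := fun k k' h => by
    rw [← adjoint_inner_left, hb, inner_smul_left, b.orthonormal.2 h, mul_zero]
  -- Since `0⁻¹ = 0`, `c k` vanishes on the kernel of `A`; the nonzero `c k` are orthonormal.
  set c : κ → F := fun k => ((‖A (b k)‖⁻¹ : ℝ) : ℂ) • A (b k) with hc
  have hcA : ∀ k, A (b k) = ((‖A (b k)‖ : ℝ) : ℂ) • c k := fun k => by
    by_cases h : A (b k) = 0
    · simp [h]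
    · have : ‖A (b k)‖ ≠ 0 := norm_ne_zero_iff.2 h
      simp [hc, smul_smul, this]
  have hcle : ∀ k, ‖c k‖ ≤ 1 := fun k => by
    by_cases h : A (b k) = 0
    · simp [hc, h]
    · have : ‖A (b k)‖ ≠ 0 := norm_ne_zero_iff.2 h
      simp [hc, norm_smul, this]
  have hcj : ∀ k, ∑ j, ‖inner ℂ (c k) (a j)‖ ^ 2 ≤ 1 := fun k => by
    have h := ha.sum_inner_products_le (c k) (s := Finset.univ)
    refine le_trans (le_of_eq ?_) (h.trans (pow_le_one₀ (norm_nonneg _) (hcle k)))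
    refine Finset.sum_congr rfl fun j _ => ?_
    rw [norm_inner_symm]
  have hck : ∀ (S : Finset κ) j, ∑ k ∈ S, ‖inner ℂ (c k) (a j)‖ ^ 2 ≤ 1 := fun S j => by
    classical
    have ho : Orthonormal ℂ (fun k : {k : κ // A (b k) ≠ 0} => c k) := by
      refine ⟨fun k => ?_, fun k k' h => ?_⟩
      · have : ‖A (b k)‖ ≠ 0 := norm_ne_zero_iff.2 k.2
        simp [hc, norm_smul, this]
      · have h2 := horth k k' (fun h' => h (Subtype.ext h'))
        simp only [hc, inner_smul_left, inner_smul_right, h2, mul_zero]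
    have h := ho.sum_inner_products_le (a j) (s := S.subtype _)
    rw [ha.1 j, one_pow, Finset.sum_subtype_eq_sum_filter
      (f := fun k => ‖inner ℂ (c k) (a j)‖ ^ 2), Finset.sum_filter_of_ne] at h
    · exact h
    · intro k _ h0 h1
      exact h0 (by simp [hc, h1])
  have hfin : ∀ S : Finset κ,
      ∑ j, ENNReal.ofReal (∑ k ∈ S, ‖inner ℂ (A (b k)) (a j)‖ ^ 2) ^ (p / 2) ≤
        ∑' n : ℕ, ENNReal.ofReal (singularValue A n) ^ p := fun S => by
    refine le_trans ?_ (sum_norm_apply_rpow_le b.orthonormal hb (by linarith) S)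
    have hp2 : 1 ≤ p / 2 := by linarith
    have h1 : ∀ j, (∑ k ∈ S, ‖inner ℂ (A (b k)) (a j)‖ ^ 2) ^ (p / 2) ≤
        ∑ k ∈ S, ‖inner ℂ (c k) (a j)‖ ^ 2 * ‖A (b k)‖ ^ p := fun j => by
      have h := Real.inner_le_weight_mul_Lp_of_nonneg S hp2
        (fun k => ‖inner ℂ (c k) (a j)‖ ^ 2) (fun k => ‖A (b k)‖ ^ 2)
        (fun _ => by positivity) (fun _ => by positivity)
      have h2 : ∑ k ∈ S, ‖inner ℂ (A (b k)) (a j)‖ ^ 2 =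
          ∑ k ∈ S, ‖inner ℂ (c k) (a j)‖ ^ 2 * ‖A (b k)‖ ^ 2 := by
        refine Finset.sum_congr rfl fun k _ => ?_
        conv_lhs => rw [hcA k, inner_smul_left, norm_mul, mul_pow]
        simp [mul_comm]
      have h3 : ∀ k, (‖A (b k)‖ ^ 2) ^ (p / 2) = ‖A (b k)‖ ^ p := fun k => by
        rw [← Real.rpow_natCast, ← Real.rpow_mul (norm_nonneg _)]
        congr 1
        push_cast
        ring
      simp only [h3] at h
      have h4 : (∑ k ∈ S, ‖inner ℂ (c k) (a j)‖ ^ 2) ^ (1 - (p / 2)⁻¹) ≤ 1 :=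
        Real.rpow_le_one (by positivity) (hck S j) (by
          have := inv_le_one_of_one_le₀ hp2
          linarith)
      have h5 : 0 ≤ ∑ k ∈ S, ‖inner ℂ (c k) (a j)‖ ^ 2 * ‖A (b k)‖ ^ p := by positivity
      calc _ ≤ ((∑ k ∈ S, ‖inner ℂ (c k) (a j)‖ ^ 2 * ‖A (b k)‖ ^ p) ^ (p / 2)⁻¹) ^ (p / 2) := by
            refine Real.rpow_le_rpow (by positivity) ?_ (by positivity)
            rw [h2]
            exact h.trans (mul_le_of_le_one_left (by positivity) h4)
        _ = _ := by
            rw [← Real.rpow_mul h5, inv_mul_cancel₀ (by positivity), Real.rpow_one]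
    calc ∑ j, ENNReal.ofReal (∑ k ∈ S, ‖inner ℂ (A (b k)) (a j)‖ ^ 2) ^ (p / 2)
        = ENNReal.ofReal (∑ j, (∑ k ∈ S, ‖inner ℂ (A (b k)) (a j)‖ ^ 2) ^ (p / 2)) := by
          rw [ENNReal.ofReal_sum_of_nonneg (fun _ _ => by positivity)]
          refine Finset.sum_congr rfl fun j _ => ?_
          rw [ENNReal.ofReal_rpow_of_nonneg (by positivity) (by positivity)]
      _ ≤ ENNReal.ofReal (∑ j, ∑ k ∈ S, ‖inner ℂ (c k) (a j)‖ ^ 2 * ‖A (b k)‖ ^ p) :=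
          ENNReal.ofReal_le_ofReal (Finset.sum_le_sum fun j _ => h1 j)
      _ ≤ ENNReal.ofReal (∑ k ∈ S, ‖A (b k)‖ ^ p) := by
          refine ENNReal.ofReal_le_ofReal ?_
          rw [Finset.sum_comm]
          refine Finset.sum_le_sum fun k _ => ?_
          rw [← Finset.sum_mul]
          exact mul_le_of_le_one_left (by positivity) (hcj k)
      _ = _ := by
          rw [ENNReal.ofReal_sum_of_nonneg (fun _ _ => by positivity)]
          refine Finset.sum_congr rfl fun j _ => ?_
          rw [ENNReal.ofReal_rpow_of_nonneg (by positivity) (by linarith)]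
  have hlim : Filter.Tendsto (fun S : Finset κ =>
      ∑ j, ENNReal.ofReal (∑ k ∈ S, ‖inner ℂ (A (b k)) (a j)‖ ^ 2) ^ (p / 2)) Filter.atTop
      (nhds (∑ j, ENNReal.ofReal (‖adjoint A (a j)‖ ^ 2) ^ (p / 2))) := by
    refine tendsto_finsetSum _ fun j _ => ?_
    exact (ENNReal.continuous_rpow_const.tendsto _).comp
      ((ENNReal.continuous_ofReal.tendsto _).comp (hsum j))
  refine le_trans (le_of_eq ?_) (le_of_tendsto' hlim hfin)
  refine Finset.sum_congr rfl fun j _ => ?_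
  rw [ENNReal.ofReal_pow (norm_nonneg _), ← ENNReal.rpow_natCast, ← ENNReal.rpow_mul]
  congr 1
  push_cast
  ring

theorem eSchattenNorm_rpow {p : ℝ} (hp : p ≠ 0) (A : E →L[ℂ] F) :
    eSchattenNorm p A ^ p = ∑' n : ℕ, ENNReal.ofReal (singularValue A n) ^ p := by
  rw [eSchattenNorm, ← ENNReal.rpow_mul, one_div, inv_mul_cancel₀ hp, ENNReal.rpow_one]

/-- The preceding estimate for a system consisting of a single unit vector. -/
theorem enorm_le_eSchattenNorm {A : E →L[ℂ] F} (hA : IsCompactOperator A) {p : ℝ} (hp : 2 ≤ p) :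
    ‖A‖ₑ ≤ eSchattenNorm p A := by
  by_cases htop : eSchattenNorm p A = ∞
  · simp [htop]
  rw [← ENNReal.ofReal_toReal htop, ← ofReal_norm]
  refine ENNReal.ofReal_le_ofReal ?_
  rw [← LinearIsometryEquiv.norm_map (adjoint : (E →L[ℂ] F) ≃ₗᵢ⋆[ℂ] F →L[ℂ] E) A]
  refine opNorm_le_of_unit_norm ENNReal.toReal_nonneg fun x hx => ?_
  have h := sum_norm_adjoint_rpow_le hA hp (ι := Unit) (a := fun _ => x)
    ⟨fun _ => hx, fun i j h => (h (Subsingleton.elim _ _)).elim⟩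
  rw [← eSchattenNorm_rpow (by linarith)] at h
  simp only [Finset.univ_unique, Finset.sum_const, Finset.card_singleton, one_smul] at h
  rw [ENNReal.rpow_le_rpow_iff (by linarith)] at h
  exact (ENNReal.ofReal_le_iff_le_toReal htop).1 h

end Schatten

end Cwikel

namespace Cwikel

/-! ### Measurability of operator-valued functions -/

section Measurability

variable {X : Type*} [MeasurableSpace X] {μ : Measure X}
  {H : Type*} [NormedAddCommGroup H] [InnerProductSpace ℂ H] [CompleteSpace H]

theorem exists_countable_hilbertBasis (H : Type*) [NormedAddCommGroup H] [InnerProductSpace ℂ H]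
    [CompleteSpace H] [TopologicalSpace.SeparableSpace H] :
    ∃ (w : Set H) (_ : Countable w), Nonempty (HilbertBasis w ℂ H) := by
  obtain ⟨w, b, -⟩ := exists_hilbertBasis ℂ H
  refine ⟨w, ?_, ⟨b⟩⟩
  -- Distinct basis vectors have distance `√2`, so these balls are disjoint, and a separable space
  -- admits only countably many.
  refine Pairwise.countable_of_isOpen_disjoint (s := fun i => Metric.ball (b i) (1 / 2)) ?_
    (fun _ => Metric.isOpen_ball) (fun i => ⟨b i, Metric.mem_ball_self (by norm_num)⟩)
  intro i j hij
  refine Metric.ball_disjoint_ball ?_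
  rw [dist_eq_norm]
  have h : ‖b i - b j‖ ^ 2 = 2 := by
    rw [@norm_sub_sq ℂ, b.orthonormal.2 hij, b.orthonormal.1 i, b.orthonormal.1 j]
    norm_num
  nlinarith [norm_nonneg (b i - b j)]

/-- Expanding `u x` in a countable basis leaves only values of `f` at fixed vectors; countability
makes the limit over finite partial sums measurable. -/
theorem OpMeasurable.apply [TopologicalSpace.SeparableSpace H] {f : X → H →L[ℂ] H}
    (hf : OpMeasurable f μ) {u : X → H} (hu : AEStronglyMeasurable u μ) :
    AEStronglyMeasurable (fun x => f x (u x)) μ := by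
  obtain ⟨w, _, ⟨b⟩⟩ := exists_countable_hilbertBasis H
  refine aestronglyMeasurable_of_tendsto_ae (Filter.atTop : Filter (Finset w))
    (f := fun S x => ∑ k ∈ S, (inner ℂ (b k) (u x)) • f x (b k)) (fun S => ?_) ?_
  · refine Finset.aestronglyMeasurable_fun_sum _ fun k _ => ?_
    exact (aestronglyMeasurable_const.inner hu).smul (hf (b k))
  · refine Filter.Eventually.of_forall fun x => ?_
    have h := (b.hasSum_repr (u x)).mapL (f x)
    simpa [HasSum, b.repr_apply_apply] using h

theorem OpMeasurable.adjoint [TopologicalSpace.SeparableSpace H] {f : X → H →L[ℂ] H}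
    (hf : OpMeasurable f μ) : OpMeasurable (fun x => ContinuousLinearMap.adjoint (f x)) μ := by
  intro h
  obtain ⟨w, _, ⟨b⟩⟩ := exists_countable_hilbertBasis H
  refine aestronglyMeasurable_of_tendsto_ae (Filter.atTop : Filter (Finset w))
    (f := fun S x => ∑ k ∈ S, (inner ℂ (f x (b k)) h) • b k) (fun S => ?_) ?_
  · refine Finset.aestronglyMeasurable_fun_sum _ fun k _ => ?_
    exact ((hf (b k)).inner aestronglyMeasurable_const).smul aestronglyMeasurable_const
  · refine Filter.Eventually.of_forall fun x => ?_
    have h := b.hasSum_repr (ContinuousLinearMap.adjoint (f x) h)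
    simpa [HasSum, b.repr_apply_apply, ContinuousLinearMap.adjoint_inner_right] using h

theorem OpMeasurable.aemeasurable_enorm [TopologicalSpace.SeparableSpace H] {f : X → H →L[ℂ] H}
    (hf : OpMeasurable f μ) : AEMeasurable (fun x => ‖f x‖ₑ) μ := by
  have h : (fun x => ‖f x‖ₑ) =
      fun x => ⨆ n : ℕ, ‖f x (TopologicalSpace.denseSeq H n)‖ₑ / ‖TopologicalSpace.denseSeq H n‖ₑ := by
    funext x
    refine le_antisymm ?_ (iSup_le fun n => ?_)
    · set C := ⨆ n : ℕ, ‖f x (TopologicalSpace.denseSeq H n)‖ₑ / ‖TopologicalSpace.denseSeq H n‖ₑ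
      by_cases hC : C = ∞
      · simp [hC]
      rw [← ENNReal.ofReal_toReal hC, ← ofReal_norm]
      refine ENNReal.ofReal_le_ofReal (ContinuousLinearMap.opNorm_le_bound _ ENNReal.toReal_nonneg
        fun y => ?_)
      refine (TopologicalSpace.denseRange_denseSeq H).induction_on
        (p := fun y => ‖f x y‖ ≤ C.toReal * ‖y‖) y ?_ fun n => ?_
      · exact isClosed_le (by fun_prop) (by fun_prop)
      · have h1 : ‖f x (TopologicalSpace.denseSeq H n)‖ₑ / ‖TopologicalSpace.denseSeq H n‖ₑ ≤ C :=
          le_iSup (fun n => ‖f x (TopologicalSpace.denseSeq H n)‖ₑ /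
            ‖TopologicalSpace.denseSeq H n‖ₑ) n
        by_cases h0 : TopologicalSpace.denseSeq H n = 0
        · simp [h0]
        rw [ENNReal.div_le_iff (by simpa using h0) (by simp)] at h1
        have := ENNReal.toReal_mono (ENNReal.mul_ne_top hC (by simp)) h1
        simpa [ENNReal.toReal_mul] using this
    · exact ENNReal.div_le_of_le_mul (ContinuousLinearMap.le_opENorm _ _)
  rw [h]
  exact AEMeasurable.iSup fun n => (hf _).enorm.div_const _

theorem OpMeasurable.aemeasurable_norm [TopologicalSpace.SeparableSpace H] {f : X → H →L[ℂ] H}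
    (hf : OpMeasurable f μ) : AEMeasurable (fun x => ‖f x‖) μ := by
  simpa using hf.aemeasurable_enorm.ennreal_toReal

end Measurability

end Cwikel

namespace Cwikel

/-! ### The kernel inequality behind the bounded part -/

section MinKernel

variable {V : Type*} [NormedAddCommGroup V] [InnerProductSpace ℂ V] [CompleteSpace V]
  {ι : Type*} [Fintype ι]

/-- Cauchy-Schwarz for the step function `∑ i, 1_{(0, a i]} u i` integrated over `(0, b]`. -/
theorem norm_sum_min_smul_sq_le {b : ℝ} (hb : 0 ≤ b) {a : ι → ℝ} (ha : ∀ i, 0 ≤ a i) (u : ι → V) :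
    ‖∑ i, min b (a i) • u i‖ ^ 2 ≤
      b * (∑ i, ∑ j, ((min (a i) (a j) : ℝ) : ℂ) * inner ℂ (u i) (u j)).re := by
  have hfin : ∀ r : ℝ, volume (Set.Ioc 0 r) ≠ ∞ := fun r => by simp
  have hvol : ∀ {r r' : ℝ}, 0 ≤ r → 0 ≤ r' →
      volume.real (Set.Ioc 0 r ∩ Set.Ioc 0 r') = min r r' := fun hr hr' => by
    rw [Set.Ioc_inter_Ioc, max_self, Real.volume_real_Ioc_of_le (le_min hr hr'), sub_zero]
  set h : Lp V 2 (volume : Measure ℝ) :=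
    ∑ i, indicatorConstLp 2 (measurableSet_Ioc (a := 0) (b := a i)) (hfin _) (u i) with hh
  have hnorm : ‖h‖ ^ 2 = (∑ i, ∑ j, ((min (a i) (a j) : ℝ) : ℂ) * inner ℂ (u i) (u j)).re := by
    rw [← Complex.ofReal_re (‖h‖ ^ 2), ofReal_norm_sq, hh, sum_inner]
    congr 1
    refine Finset.sum_congr rfl fun i _ => ?_
    rw [inner_sum]
    refine Finset.sum_congr rfl fun j _ => ?_
    rw [L2.inner_indicatorConstLp_indicatorConstLp _ _ (hfin _) (hfin _), hvol (ha i) (ha j), Complex.real_smul]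
  set w := ∑ i, min b (a i) • u i with hw
  -- Pairing the step function with the constant `w` on `(0, b]` produces the factors `min b (a i)`,
  -- hence `‖w‖ ^ 2`.
  have hinner : ((‖w‖ ^ 2 : ℝ) : ℂ) =
      inner ℂ (indicatorConstLp 2 (measurableSet_Ioc (a := 0) (b := b)) (hfin _) w) h := by
    rw [ofReal_norm_sq, hh, inner_sum]
    nth_rw 2 [hw]
    rw [inner_sum]
    refine Finset.sum_congr rfl fun i _ => ?_
    rw [L2.inner_indicatorConstLp_indicatorConstLp _ _ (hfin _) (hfin _), hvol hb (ha i), inner_smul_right_eq_smul]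
  have hle : ‖w‖ ^ 2 ≤ √b * ‖w‖ * ‖h‖ := by
    have h1 := norm_inner_le_norm (𝕜 := ℂ)
      (indicatorConstLp 2 (measurableSet_Ioc (a := 0) (b := b)) (hfin b) w) h
    rw [← hinner, Complex.norm_real, Real.norm_of_nonneg (by positivity),
      norm_indicatorConstLp two_ne_zero (by simp)] at h1
    refine h1.trans (le_of_eq ?_)
    rw [Real.volume_real_Ioc_of_le hb, sub_zero, Real.sqrt_eq_rpow]
    simp [mul_comm]
  rw [← hnorm]
  rcases (norm_nonneg w).eq_or_lt with h0 | h0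
  · rw [← h0, zero_pow two_ne_zero]
    positivity
  · have h2 : ‖w‖ ≤ √b * ‖h‖ := by nlinarith
    calc ‖w‖ ^ 2 ≤ (√b * ‖h‖) ^ 2 := by gcongr
      _ = b * ‖h‖ ^ 2 := by rw [mul_pow, Real.sq_sqrt hb]

/-- The kernel `min (s / s') (s' / s)`, written so that it vanishes if `s s' = 0`. -/
def ratioKernel (s s' : ℝ) : ℝ := min (s ^ 2) (s' ^ 2) / (s * s')

theorem ratioKernel_self_nonneg (s : ℝ) : 0 ≤ ratioKernel s s := by
  unfold ratioKernel
  have : 0 ≤ s * s := mul_self_nonneg s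
  positivity

theorem ratioKernel_self_le_one (s : ℝ) : ratioKernel s s ≤ 1 := by
  rw [ratioKernel, min_self, sq]
  exact div_self_le_one _

/-- The previous inequality with `b = γ⁻¹ ^ 2`, `a i = s i ^ 2` and `u i = (s i)⁻¹ • x i`. The gain
is that the right side does not involve `γ`, so `γ` may later depend on the point. -/
theorem norm_sum_min_inv_smul_sq_le {s : ι → ℝ} (hs : ∀ i, 0 ≤ s i) {γ : ℝ} (hγ : 0 ≤ γ)
    (x : ι → V) :
    ‖∑ i, min (s i * γ) (s i * γ)⁻¹ • x i‖ ^ 2 ≤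
      (∑ i, ∑ j, (ratioKernel (s i) (s j) : ℂ) * inner ℂ (x i) (x j)).re := by
  have key := fun b hb => norm_sum_min_smul_sq_le (V := V) (b := b) hb (a := fun i => s i ^ 2)
    (fun i => sq_nonneg _) (fun i => (s i)⁻¹ • x i)
  have hk : (∑ i, ∑ j, ((min (s i ^ 2) (s j ^ 2) : ℝ) : ℂ) *
        inner ℂ ((s i)⁻¹ • x i) ((s j)⁻¹ • x j)) =
      ∑ i, ∑ j, (ratioKernel (s i) (s j) : ℂ) * inner ℂ (x i) (x j) := by
    refine Finset.sum_congr rfl fun i _ => Finset.sum_congr rfl fun j _ => ?_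
    rw [inner_smul_left_eq_smul, inner_smul_right_eq_smul, ratioKernel]
    simp only [Complex.real_smul]
    push_cast
    rw [div_eq_mul_inv, mul_inv]
    ring
  rcases hγ.eq_or_lt with rfl | hγ
  -- For `γ = 0` the left side vanishes; any positive `b` shows that the right side is nonnegative.
  · have := key 1 zero_le_one
    rw [one_mul, hk] at this
    simpa using (sq_nonneg _).trans this
  · have := key (γ⁻¹ ^ 2) (by positivity)
    rw [hk] at this
    have he : ∑ i, min (γ⁻¹ ^ 2) (s i ^ 2) • (s i)⁻¹ • x i =
        γ⁻¹ • ∑ i, min (s i * γ) (s i * γ)⁻¹ • x i := by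
      rw [Finset.smul_sum]
      refine Finset.sum_congr rfl fun i _ => ?_
      rw [smul_smul, smul_smul]
      congr 1
      rcases (hs i).eq_or_lt with h0 | h0
      · simp [← h0]
      · rw [min_mul_of_nonneg _ _ (inv_nonneg.2 h0.le), mul_min_of_nonneg _ _ (by positivity),
          min_comm]
        congr 1
        · field_simp
        · field_simp
    rw [he, norm_smul, mul_pow, Real.norm_of_nonneg (by positivity)] at this
    exact le_of_mul_le_mul_left this (by positivity)

end MinKernel

/-! ### Hilbert-Schmidt norms and contractions -/

section HilbertSchmidt

/-- In terms of the rows `r m` of `L`, relative to an orthonormal basis of its range, the two sums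
are `∑ m, ‖J* (r m)‖ ^ 2` and `∑ m, ‖r m‖ ^ 2`. -/
theorem sum_norm_comp_sq_le {V ι κ : Type*} [NormedAddCommGroup V] [InnerProductSpace ℂ V]
    [Fintype ι] [Fintype κ] [DecidableEq ι] [DecidableEq κ]
    (L : EuclideanSpace ℂ ι →ₗ[ℂ] V) (J : EuclideanSpace ℂ κ →L[ℂ] EuclideanSpace ℂ ι)
    (hJ : ‖J‖ ≤ 1) :
    ∑ k, ‖L (J (EuclideanSpace.single k 1))‖ ^ 2 ≤ ∑ i, ‖L (EuclideanSpace.single i 1)‖ ^ 2 := by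
  let b := stdOrthonormalBasis ℂ (LinearMap.range L)
  let L' : EuclideanSpace ℂ ι →L[ℂ] LinearMap.range L := LinearMap.toContinuousLinearMap L.rangeRestrict
  let r := fun m => ContinuousLinearMap.adjoint L' (b m)
  have hL : ∀ v, ‖L v‖ ^ 2 = ∑ m, ‖inner ℂ (r m) v‖ ^ 2 := fun v => by
    have h1 : ‖L v‖ = ‖L' v‖ := rfl
    rw [h1, ← b.sum_sq_norm_inner_right]
    refine Finset.sum_congr rfl fun m _ => ?_
    rw [ContinuousLinearMap.adjoint_inner_left]
  simp only [hL]
  rw [Finset.sum_comm, Finset.sum_comm (s := (Finset.univ : Finset ι))]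
  refine Finset.sum_le_sum fun m _ => ?_
  have e1 := (EuclideanSpace.basisFun κ ℂ).sum_sq_norm_inner_left (ContinuousLinearMap.adjoint J (r m))
  have e2 := (EuclideanSpace.basisFun ι ℂ).sum_sq_norm_inner_left (r m)
  simp only [EuclideanSpace.basisFun_apply, ContinuousLinearMap.adjoint_inner_left] at e1 e2
  rw [e1, e2]
  refine pow_le_pow_left₀ (norm_nonneg _) ?_ 2
  refine ((ContinuousLinearMap.adjoint J).le_opNorm _).trans ?_
  rw [LinearIsometryEquiv.norm_map]
  exact mul_le_of_le_one_left (norm_nonneg _) hJ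

end HilbertSchmidt

/-! ### The layer-cake estimate for the remainder -/

section LayerCake

variable {Y : Type*} [MeasurableSpace Y] {ν : Measure Y}

/-- The value is `2 / (p - 2) - 2 / (p + 2)`; convergence at infinity is where `p > 2` enters. -/
theorem lintegral_layer_weight {p : ℝ} (hp : 2 < p) :
    ∫⁻ t in Set.Ioi (1 : ℝ), ENNReal.ofReal (t ^ (-p)) * ENNReal.ofReal (2 * (t - t ^ (-3 : ℝ))) =
      ENNReal.ofReal (8 / ((p - 2) * (p + 2))) := by
  have h1 : IntegrableOn (fun t : ℝ => t ^ (1 - p)) (Set.Ioi 1) :=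
    integrableOn_Ioi_rpow_of_lt (by linarith) zero_lt_one
  have h2 : IntegrableOn (fun t : ℝ => t ^ (-3 - p)) (Set.Ioi 1) :=
    integrableOn_Ioi_rpow_of_lt (by linarith) zero_lt_one
  have h3 : ∫ t in Set.Ioi (1 : ℝ), 2 * (t ^ (1 - p) - t ^ (-3 - p)) =
      8 / ((p - 2) * (p + 2)) := by
    rw [integral_const_mul, integral_sub h1 h2, integral_Ioi_rpow_of_lt (by linarith) zero_lt_one,
      integral_Ioi_rpow_of_lt (by linarith) zero_lt_one, Real.one_rpow, Real.one_rpow]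
    have e1 : 1 - p + 1 ≠ 0 := by linarith
    have e2 : -3 - p + 1 ≠ 0 := by linarith
    have e3 : p - 2 ≠ 0 := by linarith
    have e4 : p + 2 ≠ 0 := by linarith
    field_simp
    ring
  have h4 : IntegrableOn (fun t : ℝ => 2 * (t ^ (1 - p) - t ^ (-3 - p))) (Set.Ioi 1) :=
    (h1.sub h2).const_mul 2
  rw [← h3, ofReal_integral_eq_lintegral_ofReal h4]
  · refine setLIntegral_congr_fun measurableSet_Ioi fun t (ht : 1 < t) => ?_
    have ht0 : 0 < t := by linarith
    rw [← ENNReal.ofReal_mul (by positivity)]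
    congr 1
    rw [sub_eq_add_neg 1 p, sub_eq_add_neg (-3) p, Real.rpow_add ht0, Real.rpow_add ht0,
      Real.rpow_one]
    ring
  · refine (ae_restrict_iff' measurableSet_Ioi).2 (Filter.Eventually.of_forall fun t ht => ?_)
    have : t ^ (-3 - p) ≤ t ^ (1 - p) := Real.rpow_le_rpow_of_exponent_le (le_of_lt ht) (by linarith)
    simp only [Pi.zero_apply]
    linarith

/-- For `σ > 1` the derivative of `(σ - σ⁻¹) ^ 2` is `2 * (σ - σ ^ (-3))`; for `σ ≤ 1` both sides
vanish. -/
theorem intervalIntegral_layer {σ : ℝ} (hσ : 0 ≤ σ) :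
    ∫ t in (0 : ℝ)..σ, (Set.Ioi (1 : ℝ)).indicator (fun t => 2 * (t - t ^ (-3 : ℝ))) t =
      (σ - min σ σ⁻¹) ^ 2 := by
  rw [intervalIntegral.integral_of_le hσ, setIntegral_indicator measurableSet_Ioi]
  rcases le_or_gt σ 1 with h | h
  · have : Set.Ioc 0 σ ∩ Set.Ioi 1 = ∅ := by
      ext t
      simp only [Set.mem_inter_iff, Set.mem_Ioc, Set.mem_Ioi, Set.mem_empty_iff_false, iff_false]
      rintro ⟨⟨_, h1⟩, h2⟩
      linarith
    rw [this]
    rcases hσ.eq_or_lt with rfl | h0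
    · simp
    · rw [min_eq_left (h.trans ((one_le_inv₀ h0).2 h))]
      simp
  · have : Set.Ioc 0 σ ∩ Set.Ioi 1 = Set.Ioc 1 σ := by
      ext t
      simp only [Set.mem_inter_iff, Set.mem_Ioc, Set.mem_Ioi]
      constructor
      · rintro ⟨⟨_, h1⟩, h2⟩
        exact ⟨h2, h1⟩
      · rintro ⟨h1, h2⟩
        exact ⟨⟨by linarith, h2⟩, h1⟩
    have h0 : 0 < σ := by linarith
    have hu : (0 : ℝ) ∉ Set.uIcc 1 σ := by
      rw [Set.uIcc_of_le h.le]
      simp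
    rw [this, ← intervalIntegral.integral_of_le h.le,
      min_eq_right ((inv_le_one_of_one_le₀ h.le).trans h.le), intervalIntegral.integral_const_mul,
      intervalIntegral.integral_sub intervalIntegral.intervalIntegrable_id
        (intervalIntegral.intervalIntegrable_rpow (Or.inr hu)),
      integral_id, integral_rpow (Or.inr ⟨by norm_num, hu⟩)]
    have e : σ ^ (-3 + 1 : ℝ) = (σ ^ 2)⁻¹ := by
      rw [show (-3 + 1 : ℝ) = -(2 : ℕ) by norm_num, Real.rpow_neg h0.le, Real.rpow_natCast]
    rw [e, Real.one_rpow]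
    field_simp
    ring

/-- Only the levels `t > 1` contribute, and there the superlevel set of `a * γ` has measure at most
`(a / t) ^ p * W`. -/
theorem lintegral_sq_sub_min_le {p : ℝ} (hp : 2 < p) {γ : Y → ℝ} (hγ : AEMeasurable γ ν)
    (hγ0 : ∀ y, 0 ≤ γ y) {W : ℝ≥0∞}
    (hW : ∀ t : ℝ, 0 < t → ENNReal.ofReal t ^ p * ν {y | t < γ y} ≤ W) {a : ℝ} (ha : 0 ≤ a) :
    ∫⁻ y, ENNReal.ofReal ((a * γ y - min (a * γ y) (a * γ y)⁻¹) ^ 2) ∂ν ≤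
      ENNReal.ofReal (8 / ((p - 2) * (p + 2))) * ENNReal.ofReal a ^ p * W := by
  rcases ha.eq_or_lt with rfl | ha
  · simp
  set h : ℝ → ℝ := (Set.Ioi (1 : ℝ)).indicator (fun t => 2 * (t - t ^ (-3 : ℝ))) with hh
  have hpos : ∀ t : ℝ, 1 < t → 0 ≤ 2 * (t - t ^ (-3 : ℝ)) := fun t ht => by
    have : t ^ (-3 : ℝ) ≤ t ^ (1 : ℝ) := Real.rpow_le_rpow_of_exponent_le ht.le (by norm_num)
    rw [Real.rpow_one] at this
    linarith
  have hcake := lintegral_comp_eq_lintegral_meas_lt_mul ν (f := fun y => a * γ y) (g := h)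
    (Filter.Eventually.of_forall fun y => mul_nonneg ha.le (hγ0 y)) (hγ.const_mul a)
    (fun t ht => by
      rw [intervalIntegrable_iff, hh]
      refine IntegrableOn.of_bound (by simp) ?_ (2 * t) ?_
      · refine (Measurable.indicator ?_ measurableSet_Ioi).aestronglyMeasurable
        fun_prop
      · refine (ae_restrict_iff' measurableSet_uIoc).2 (Filter.Eventually.of_forall fun r hr => ?_)
        rw [Set.uIoc_of_le (le_of_lt ht)] at hr
        by_cases h1 : r ∈ Set.Ioi (1 : ℝ)
        · rw [Set.indicator_of_mem h1, Real.norm_of_nonneg (hpos r h1)]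
          have : 0 ≤ r ^ (-3 : ℝ) := Real.rpow_nonneg hr.1.le _
          linarith [hr.2]
        · rw [Set.indicator_of_notMem h1, norm_zero]
          have : 0 < t := ht
          positivity)
    (Filter.Eventually.of_forall fun t => Set.indicator_nonneg (fun t ht => hpos t ht) t)
  simp only [hh, intervalIntegral_layer (mul_nonneg ha.le (hγ0 _))] at hcake
  rw [hcake]
  calc _ = ∫⁻ t in Set.Ioi (1 : ℝ), ν {y | t < a * γ y} *
        ENNReal.ofReal (2 * (t - t ^ (-3 : ℝ))) := by
        have : (fun t => ν {y | t < a * γ y} *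
            ENNReal.ofReal ((Set.Ioi (1 : ℝ)).indicator (fun t => 2 * (t - t ^ (-3 : ℝ))) t)) =
            (Set.Ioi (1 : ℝ)).indicator (fun t => ν {y | t < a * γ y} *
              ENNReal.ofReal (2 * (t - t ^ (-3 : ℝ)))) := by
          funext t
          by_cases h1 : t ∈ Set.Ioi (1 : ℝ) <;> simp [h1]
        rw [this, setLIntegral_indicator measurableSet_Ioi]
        congr 2
        rw [Set.inter_eq_left]
        exact Set.Ioi_subset_Ioi zero_le_one
    _ ≤ ∫⁻ t in Set.Ioi (1 : ℝ), (ENNReal.ofReal a ^ p * W) * (ENNReal.ofReal (t ^ (-p)) *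
        ENNReal.ofReal (2 * (t - t ^ (-3 : ℝ)))) := by
        refine setLIntegral_mono' measurableSet_Ioi fun t (ht : 1 < t) => ?_
        rw [← mul_assoc]
        gcongr
        have ht0 : 0 < t := by linarith
        have h1 := hW (t / a) (by positivity)
        have h2 : {y | t < a * γ y} = {y | t / a < γ y} := by
          ext y
          simp [div_lt_iff₀' ha]
        rw [h2]
        have h3 : ENNReal.ofReal a ^ p * ENNReal.ofReal (t ^ (-p)) * ENNReal.ofReal (t / a) ^ p =
            1 := by
          rw [ENNReal.ofReal_rpow_of_pos ha, ENNReal.ofReal_rpow_of_pos (by positivity),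
            ← ENNReal.ofReal_mul (by positivity), ← ENNReal.ofReal_mul (by positivity),
            Real.div_rpow ht0.le ha.le, Real.rpow_neg ht0.le]
          have e1 : 0 < a ^ p := by positivity
          have e2 : 0 < t ^ p := by positivity
          rw [← ENNReal.ofReal_one]
          congr 1
          field_simp
        calc ν {y | t / a < γ y} = (ENNReal.ofReal a ^ p * ENNReal.ofReal (t ^ (-p)) *
              ENNReal.ofReal (t / a) ^ p) * ν {y | t / a < γ y} := by rw [h3, one_mul]
          _ = ENNReal.ofReal a ^ p * ENNReal.ofReal (t ^ (-p)) *
              (ENNReal.ofReal (t / a) ^ p * ν {y | t / a < γ y}) := by ring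
          _ ≤ ENNReal.ofReal a ^ p * ENNReal.ofReal (t ^ (-p)) * W := by gcongr
          _ = _ := by ring
    _ = _ := by
        rw [lintegral_const_mul _ (by fun_prop), lintegral_layer_weight hp]
        ring

end LayerCake

end Cwikel

namespace Cwikel

/-! ### Norms and finite sums in `L²` -/

section LpNorm

variable {Y : Type*} [MeasurableSpace Y] {ν : Measure Y} {G : Type*} [NormedAddCommGroup G]

theorem Lp_enorm_sq (v : Lp G 2 ν) : ‖v‖ₑ ^ 2 = ∫⁻ y, ‖v y‖ₑ ^ 2 ∂ν := by
  rw [Lp.enorm_def, eLpNorm_eq_lintegral_rpow_enorm_toReal two_ne_zero ENNReal.ofNat_ne_top,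
    ← ENNReal.rpow_natCast, ← ENNReal.rpow_mul]
  simp

theorem Lp_norm_sq_le {v : Lp G 2 ν} {C : ℝ} (hC : 0 ≤ C)
    (h : ∫⁻ y, ‖v y‖ₑ ^ 2 ∂ν ≤ ENNReal.ofReal C) : ‖v‖ ^ 2 ≤ C := by
  rw [← Lp_enorm_sq, ← ofReal_norm, ← ENNReal.ofReal_pow (norm_nonneg _)] at h
  exact (ENNReal.ofReal_le_ofReal_iff hC).1 h

theorem coeFn_sum_smul {𝕜 ι : Type*} [NormedField 𝕜] [NormedSpace 𝕜 G] {r : ℝ≥0∞}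
    (S : Finset ι) (d : ι → 𝕜) (v : ι → Lp G r ν) :
    (∑ i ∈ S, d i • v i : Lp G r ν) =ᵐ[ν] fun y => ∑ i ∈ S, d i • v i y := by
  classical
  induction S using Finset.induction_on with
  | empty =>
    simp only [Finset.sum_empty]
    exact Lp.coeFn_zero _ _ _
  | insert i S hi ih =>
    simp only [Finset.sum_insert hi]
    filter_upwards [Lp.coeFn_add (d i • v i) (∑ i ∈ S, d i • v i), Lp.coeFn_smul (d i) (v i), ih]
      with y h1 h2 h3
    rw [h1, Pi.add_apply, h2, h3, Pi.smul_apply]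

end LpNorm

/-! ### The splitting into a bounded and a Hilbert-Schmidt part -/

section Discrete

variable {Y : Type*} [MeasurableSpace Y] {ν : Measure Y}
  {G : Type*} [NormedAddCommGroup G] [InnerProductSpace ℂ G] [CompleteSpace G]
  {ι : Type*} [Fintype ι]

/-- The kernel in the pointwise bound is constant in `y`, so integration turns `⟨θ i y, θ j y⟩` into
`⟨θ i, θ j⟩`. Only the diagonal survives, where the kernel is at most one. -/
theorem lintegral_sum_min_smul_sq_le {θ : ι → Lp G 2 ν}
    (horth : ∀ i j, i ≠ j → inner ℂ (θ i) (θ j) = 0) (hθ : ∀ i, ‖θ i‖ ≤ 1)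
    {s : ι → ℝ} (hs : ∀ i, 0 ≤ s i) {γ : Y → ℝ} (hγ : ∀ y, 0 ≤ γ y) (d : ι → ℂ) :
    ∫⁻ y, ‖∑ i, min (s i * γ y) (s i * γ y)⁻¹ • (d i • θ i y)‖ₑ ^ 2 ∂ν ≤
      ENNReal.ofReal (∑ i, ‖d i‖ ^ 2) := by
  set F : Y → ℂ := fun y => ∑ i, ∑ j, (ratioKernel (s i) (s j) : ℂ) *
    inner ℂ (d i • θ i y) (d j • θ j y) with hF
  have hle : ∀ y, ‖∑ i, min (s i * γ y) (s i * γ y)⁻¹ • (d i • θ i y)‖ ^ 2 ≤ (F y).re :=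
    fun y => norm_sum_min_inv_smul_sq_le hs (hγ y) fun i => d i • θ i y
  have hF' : F = fun y => ∑ i, ∑ j, ((ratioKernel (s i) (s j) : ℂ) *
      ((starRingEnd ℂ) (d i) * d j)) * inner ℂ (θ i y) (θ j y) := by
    funext y
    refine Finset.sum_congr rfl fun i _ => Finset.sum_congr rfl fun j _ => ?_
    rw [inner_smul_left, inner_smul_right]
    ring
  have hint : ∀ i j, Integrable (fun y => ((ratioKernel (s i) (s j) : ℂ) *
      ((starRingEnd ℂ) (d i) * d j)) * inner ℂ (θ i y) (θ j y)) ν := fun i j =>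
    (L2.integrable_inner (𝕜 := ℂ) (θ i) (θ j)).const_mul _
  have hFint : Integrable F ν := by
    rw [hF']
    exact integrable_finsetSum _ fun i _ => integrable_finsetSum _ fun j _ => hint i j
  have hFval : ∫ y, (F y).re ∂ν ≤ ∑ i, ‖d i‖ ^ 2 := by
    have h1 : ∫ y, F y ∂ν =
        ((∑ i, ratioKernel (s i) (s i) * ‖d i‖ ^ 2 * ‖θ i‖ ^ 2 : ℝ) : ℂ) := by
      rw [hF', integral_finsetSum _ fun i _ => integrable_finsetSum _ fun j _ => hint i j,
        Complex.ofReal_sum]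
      refine Finset.sum_congr rfl fun i _ => ?_
      rw [integral_finsetSum _ fun j _ => hint i j, Finset.sum_eq_single i]
      · rw [integral_const_mul, ← L2.inner_def, ← ofReal_norm_sq, Complex.conj_mul']
        push_cast
        ring
      · intro j _ hj
        rw [integral_const_mul, ← L2.inner_def, horth i j hj.symm, mul_zero]
      · exact fun h => (h (Finset.mem_univ _)).elim
    have h2 : ∫ y, (F y).re ∂ν = (∫ y, F y ∂ν).re := integral_re hFint
    rw [h2, h1, Complex.ofReal_re]
    refine Finset.sum_le_sum fun i _ => ?_
    have e1 : ‖θ i‖ ^ 2 ≤ 1 := pow_le_one₀ (norm_nonneg _) (hθ i)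
    have e2 := ratioKernel_self_le_one (s i)
    have e3 := ratioKernel_self_nonneg (s i)
    calc ratioKernel (s i) (s i) * ‖d i‖ ^ 2 * ‖θ i‖ ^ 2 ≤ 1 * ‖d i‖ ^ 2 * 1 := by gcongr
      _ = _ := by ring
  calc ∫⁻ y, ‖∑ i, min (s i * γ y) (s i * γ y)⁻¹ • (d i • θ i y)‖ₑ ^ 2 ∂ν
      ≤ ∫⁻ y, ENNReal.ofReal (F y).re ∂ν := by
        refine lintegral_mono fun y => ?_
        rw [← ofReal_norm, ← ENNReal.ofReal_pow (norm_nonneg _)]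
        exact ENNReal.ofReal_le_ofReal (hle y)
    _ = ENNReal.ofReal (∫ y, (F y).re ∂ν) :=
        (ofReal_integral_eq_lintegral_ofReal hFint.re
          (Filter.Eventually.of_forall fun y => (sq_nonneg _).trans (hle y))).symm
    _ ≤ _ := ENNReal.ofReal_le_ofReal hFval

/-- The value `t = (p - 2) / p * r` minimizes `t ^ (2 - p) / (r - t) ^ 2` on `(0, r)`, and `r - t =
2 * r / p`. -/
theorem cwikel_constant {p r N Q : ℝ} (hp : 2 < p) (hr : 0 < r)
    (h : N * (r - (p - 2) / p * r) ^ 2 ≤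
      ((p - 2) / p * r) ^ 2 * (8 / ((p - 2) * (p + 2))) * (((p - 2) / p * r) ^ p)⁻¹ * Q) :
    N * r ^ p ≤ 2 * (p - 2) / (p + 2) * (p / (p - 2)) ^ p * Q := by
  have h2 : 0 < p - 2 := by linarith
  have h0 : 0 < p := by linarith
  have h3 : 0 < p + 2 := by linarith
  have e1 : (((p - 2) / p * r) ^ p)⁻¹ = (p / (p - 2)) ^ p * (r ^ p)⁻¹ := by
    rw [Real.mul_rpow (by positivity) hr.le, mul_inv, ← Real.inv_rpow (by positivity), inv_div]
  rw [e1] at h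
  have hrp : 0 < r ^ p := by positivity
  have e2 : N * (r - (p - 2) / p * r) ^ 2 = N * r ^ p * (4 * r ^ 2 / p ^ 2 * (r ^ p)⁻¹) := by
    field_simp
    ring
  have e3 : ((p - 2) / p * r) ^ 2 * (8 / ((p - 2) * (p + 2))) * ((p / (p - 2)) ^ p * (r ^ p)⁻¹) * Q =
      2 * (p - 2) / (p + 2) * (p / (p - 2)) ^ p * Q * (4 * r ^ 2 / p ^ 2 * (r ^ p)⁻¹) := by
    field_simp
    ring
  rw [e2, e3] at h
  exact le_of_mul_le_mul_right h (by positivity)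

/-- The map `d ↦ ∑ i, d i • s i • τ i` is a part of norm at most `t` plus a Hilbert-Schmidt part.
Composed with the contraction `J`, the latter must have norm at least `r - t` on each of the `N`
unit vectors. -/
theorem discrete_cwikel [TopologicalSpace.SeparableSpace G] {g : Y → G →L[ℂ] G}
    (hg : OpMeasurable g ν) {p : ℝ} (hp : 2 < p)
    {W : ℝ} (hW0 : 0 ≤ W)
    (hW : ∀ t : ℝ, 0 < t → ENNReal.ofReal t ^ p * ν {y | t < ‖g y‖} ≤ ENNReal.ofReal W)
    {θ τ : ι → Lp G 2 ν} (horth : ∀ i j, i ≠ j → inner ℂ (θ i) (θ j) = 0) (hθ : ∀ i, ‖θ i‖ ≤ 1)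
    {q : ι → ℝ} (hq : ∀ i, 0 ≤ q i) {M : ℝ}
    (hbd : ∀ i, ∀ᵐ y ∂ν, ‖θ i y‖ ^ 2 ≤ M ^ 2 * q i)
    (hτ : ∀ i, τ i =ᵐ[ν] fun y => ContinuousLinearMap.adjoint (g y) (θ i y))
    {s : ι → ℝ} (hs : ∀ i, 0 ≤ s i) {N : ℕ}
    {J : EuclideanSpace ℂ (Fin N) →L[ℂ] EuclideanSpace ℂ ι} (hJ : ‖J‖ ≤ 1) {r : ℝ} (hr : 0 < r)
    (hlow : ∀ c, r * ‖c‖ ≤ ‖∑ i, J c i • (s i • τ i)‖) :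
    N * r ^ p ≤ 2 * (p - 2) / (p + 2) * (p / (p - 2)) ^ p * (M ^ 2 * (∑ i, q i * s i ^ p) * W) := by
  classical
  refine cwikel_constant hp hr ?_
  set t : ℝ := (p - 2) / p * r with ht_def
  have ht : 0 < t := by
    have : 0 < p - 2 := by linarith
    positivity
  set γ : Y → ℝ := fun y => ‖g y‖ / t with hγ_def
  have hγ0 : ∀ y, 0 ≤ γ y := fun y => by positivity
  have hγm : AEMeasurable γ ν := hg.aemeasurable_norm.div_const t
  set m : ι → Y → ℝ := fun i y => min (s i * γ y) (s i * γ y)⁻¹ with hm_def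
  have hm0 : ∀ i y, 0 ≤ m i y := fun i y => by
    have := mul_nonneg (hs i) (hγ0 y)
    exact le_min this (inv_nonneg.2 this)
  have hτle : ∀ i, ∀ᵐ y ∂ν, ‖τ i y‖ ≤ t * γ y * ‖θ i y‖ := fun i => by
    filter_upwards [hτ i] with y hy
    rw [hy]
    refine (ContinuousLinearMap.le_opNorm _ _).trans (le_of_eq ?_)
    rw [LinearIsometryEquiv.norm_map, hγ_def]
    field_simp
  -- This replaces the factor `s i = γ⁻¹ * (s i * γ)` by `γ⁻¹ * min (s i * γ) (s i * γ)⁻¹`, which is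
  -- at most `s i`. Where `γ = 0`, so is `τ i`.
  have hβ : ∀ i, MemLp (fun y => ((γ y)⁻¹ * m i y) • τ i y) 2 ν := fun i => by
    refine (Lp.memLp (τ i)).of_le_mul (c := s i) ?_ (Filter.Eventually.of_forall fun y => ?_)
    · have h1 : AEStronglyMeasurable (fun y => (γ y)⁻¹ * m i y) ν :=
        (hγm.inv.mul ((hγm.const_mul _).min (hγm.const_mul _).inv)).aestronglyMeasurable
      exact h1.smul (Lp.aestronglyMeasurable _)
    · rw [norm_smul, Real.norm_of_nonneg (mul_nonneg (inv_nonneg.2 (hγ0 y)) (hm0 i y))]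
      gcongr
      rcases (hγ0 y).eq_or_lt with h0 | h0
      · rw [← h0]
        simpa using hs i
      · rw [inv_mul_le_iff₀ h0, mul_comm (γ y)]
        exact min_le_left _ _
  set β : ι → Lp G 2 ν := fun i => (hβ i).toLp with hβ_def
  set κ : ι → Lp G 2 ν := fun i => s i • τ i - β i with hκ_def
  -- the bounded part
  have hB : ∀ d : EuclideanSpace ℂ ι, ‖∑ i, d i • β i‖ ≤ t * ‖d‖ := fun d => by
    refine (pow_le_pow_iff_left₀ (norm_nonneg _) (by positivity) two_ne_zero).1 ?_
    rw [mul_pow, EuclideanSpace.norm_sq_eq]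
    refine Lp_norm_sq_le (by positivity) ?_
    rw [ENNReal.ofReal_mul (by positivity)]
    calc ∫⁻ y, ‖(∑ i, d i • β i : Lp G 2 ν) y‖ₑ ^ 2 ∂ν
        ≤ ∫⁻ y, ENNReal.ofReal (t ^ 2) * ‖∑ i, m i y • (d i • θ i y)‖ₑ ^ 2 ∂ν := by
          refine lintegral_mono_ae ?_
          filter_upwards [coeFn_sum_smul Finset.univ (fun i => d i) β,
            ae_all_iff.2 fun i => (hβ i).coeFn_toLp, ae_all_iff.2 hτ] with y h1 h2 h3
          have h4 : (∑ i, d i • β i : Lp G 2 ν) y =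
              -- The operator `(γ y)⁻¹ • (g y)*` has norm at most `t` and comes out of the sum; what
              -- is left is the kernel estimate.
              ContinuousLinearMap.adjoint (g y) ((γ y)⁻¹ • ∑ i, m i y • (d i • θ i y)) := by
            rw [h1, Finset.smul_sum, map_sum]
            refine Finset.sum_congr rfl fun i _ => ?_
            rw [h2 i, h3 i, ContinuousLinearMap.map_smul_of_tower,
              ContinuousLinearMap.map_smul_of_tower, map_smul, smul_comm (d i), mul_smul]
          have h5 : ‖(∑ i, d i • β i : Lp G 2 ν) y‖ ≤ t * ‖∑ i, m i y • (d i • θ i y)‖ := by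
            rw [h4]
            refine (ContinuousLinearMap.le_opNorm _ _).trans ?_
            rw [LinearIsometryEquiv.norm_map, norm_smul, ← mul_assoc,
              Real.norm_of_nonneg (inv_nonneg.2 (hγ0 y))]
            gcongr
            rw [hγ_def]
            rcases (norm_nonneg (g y)).eq_or_lt with h0 | h0
            · simp [← h0, ht.le]
            · field_simp
              exact le_rfl
          rw [← ofReal_norm, ← ofReal_norm, ← ENNReal.ofReal_pow (norm_nonneg _),
            ← ENNReal.ofReal_pow (norm_nonneg _), ← ENNReal.ofReal_mul (by positivity), ← mul_pow]
          exact ENNReal.ofReal_le_ofReal (pow_le_pow_left₀ (norm_nonneg _) h5 2)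
      _ = ENNReal.ofReal (t ^ 2) * ∫⁻ y, ‖∑ i, m i y • (d i • θ i y)‖ₑ ^ 2 ∂ν :=
          lintegral_const_mul' _ _ ENNReal.ofReal_ne_top
      _ ≤ _ := by
          gcongr
          exact lintegral_sum_min_smul_sq_le horth hθ hs hγ0 _
  -- the Hilbert-Schmidt part
  have hC : ∀ i, ‖κ i‖ ^ 2 ≤
      t ^ 2 * (M ^ 2 * q i) * (8 / ((p - 2) * (p + 2)) * (s i / t) ^ p * W) := fun i => by
    have hD : 0 ≤ 8 / ((p - 2) * (p + 2)) := by
      have : 0 < p - 2 := by linarith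
      positivity
    have hqi := hq i
    have hsi : 0 ≤ s i / t := div_nonneg (hs i) ht.le
    refine Lp_norm_sq_le (by positivity) ?_
    calc ∫⁻ y, ‖κ i y‖ₑ ^ 2 ∂ν
        ≤ ∫⁻ y, ENNReal.ofReal (t ^ 2 * (M ^ 2 * q i)) * ENNReal.ofReal
            ((s i / t * ‖g y‖ - min (s i / t * ‖g y‖) (s i / t * ‖g y‖)⁻¹) ^ 2) ∂ν := by
          refine lintegral_mono_ae ?_
          filter_upwards [Lp.coeFn_sub (s i • τ i) (β i), Lp.coeFn_smul (s i) (τ i),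
            (hβ i).coeFn_toLp, hτle i, hbd i] with y h1 h2 h3 h4 h5
          have h6 : s i / t * ‖g y‖ = s i * γ y := by
            rw [hγ_def]
            ring
          rw [h6, ← ENNReal.ofReal_mul (by positivity), ← ofReal_norm,
            ← ENNReal.ofReal_pow (norm_nonneg _)]
          refine ENNReal.ofReal_le_ofReal ?_
          have h7 : ‖κ i y‖ ≤ (s i * γ y - m i y) * (t * ‖θ i y‖) := by
            have h8 : κ i y = (s i - (γ y)⁻¹ * m i y) • τ i y := by
              rw [hκ_def, h1, Pi.sub_apply, h2, h3, Pi.smul_apply, sub_smul]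
            rw [h8, norm_smul]
            have hle : m i y ≤ s i * γ y := min_le_left _ _
            rcases (hγ0 y).eq_or_lt with h0 | h0
            · rw [← h0] at h4
              have h9 : ‖τ i y‖ = 0 := le_antisymm (by simpa using h4) (norm_nonneg _)
              rw [h9, mul_zero]
              have := sub_nonneg.2 hle
              positivity
            · have h9 : s i - (γ y)⁻¹ * m i y = (γ y)⁻¹ * (s i * γ y - m i y) := by
                field_simp
              have h10 := sub_nonneg.2 hle
              rw [h9, Real.norm_of_nonneg (by positivity)]
              calc (γ y)⁻¹ * (s i * γ y - m i y) * ‖τ i y‖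
                  ≤ (γ y)⁻¹ * (s i * γ y - m i y) * (t * γ y * ‖θ i y‖) := by gcongr
                _ = _ := by field_simp
          calc ‖κ i y‖ ^ 2 ≤ ((s i * γ y - m i y) * (t * ‖θ i y‖)) ^ 2 := by gcongr
            _ = t ^ 2 * ‖θ i y‖ ^ 2 * (s i * γ y - m i y) ^ 2 := by ring
            _ ≤ t ^ 2 * (M ^ 2 * q i) * (s i * γ y - m i y) ^ 2 := by gcongr
      _ = ENNReal.ofReal (t ^ 2 * (M ^ 2 * q i)) * ∫⁻ y, ENNReal.ofReal
            ((s i / t * ‖g y‖ - min (s i / t * ‖g y‖) (s i / t * ‖g y‖)⁻¹) ^ 2) ∂ν :=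
          lintegral_const_mul' _ _ ENNReal.ofReal_ne_top
      _ ≤ ENNReal.ofReal (t ^ 2 * (M ^ 2 * q i)) * (ENNReal.ofReal (8 / ((p - 2) * (p + 2))) *
            ENNReal.ofReal (s i / t) ^ p * ENNReal.ofReal W) := by
          gcongr
          exact lintegral_sq_sub_min_le hp hg.aemeasurable_norm (fun y => norm_nonneg _) hW hsi
      _ = _ := by
          rw [ENNReal.ofReal_rpow_of_nonneg hsi (by linarith), ← ENNReal.ofReal_mul hD,
            ← ENNReal.ofReal_mul (by positivity), ← ENNReal.ofReal_mul (by positivity)]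
  let L : EuclideanSpace ℂ ι →ₗ[ℂ] Lp G 2 ν :=
    { toFun := fun d => ∑ i, d i • κ i
      map_add' := fun a b => by simp [add_smul, Finset.sum_add_distrib]
      map_smul' := fun a b => by simp [mul_smul, Finset.smul_sum] }
  have hHS := sum_norm_comp_sq_le L J hJ
  have hL1 : ∀ i, L (EuclideanSpace.single i 1) = κ i := fun i => by
    change ∑ j, (EuclideanSpace.single i (1 : ℂ)) j • κ j = κ i
    rw [Finset.sum_eq_single i]
    · simp
    · intro j _ hj
      simp [hj]
    · exact fun h => (h (Finset.mem_univ _)).elim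
  have hk : ∀ k : Fin N, (r - t) ^ 2 ≤ ‖L (J (EuclideanSpace.single k 1))‖ ^ 2 := fun k => by
    have h1 := hlow (EuclideanSpace.single k 1)
    have h2 : ∑ i, J (EuclideanSpace.single k 1) i • (s i • τ i) =
        (∑ i, J (EuclideanSpace.single k 1) i • β i) + L (J (EuclideanSpace.single k 1)) := by
      change _ = _ + ∑ i, J (EuclideanSpace.single k 1) i • κ i
      rw [← Finset.sum_add_distrib]
      refine Finset.sum_congr rfl fun i _ => ?_
      rw [← smul_add, hκ_def, add_sub_cancel]
    have h3 : ‖(EuclideanSpace.single k 1 : EuclideanSpace ℂ (Fin N))‖ = 1 := by simp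
    have h4 : ‖J (EuclideanSpace.single k 1)‖ ≤ 1 :=
      (J.le_opNorm _).trans (by rw [h3, mul_one]; exact hJ)
    rw [h2, h3, mul_one] at h1
    have h5 := (hB (J (EuclideanSpace.single k 1))).trans (mul_le_of_le_one_right ht.le h4)
    have h6 := h1.trans (norm_add_le _ _)
    have h7 : 0 ≤ r - t := by
      have : t ≤ 1 * r := by
        rw [ht_def]
        gcongr
        rw [div_le_one (by linarith)]
        linarith
      linarith
    exact pow_le_pow_left₀ h7 (by linarith) 2
  calc N * (r - t) ^ 2 = ∑ _k : Fin N, (r - t) ^ 2 := by simp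
    _ ≤ ∑ k : Fin N, ‖L (J (EuclideanSpace.single k 1))‖ ^ 2 := Finset.sum_le_sum fun k _ => hk k
    _ ≤ ∑ i, ‖κ i‖ ^ 2 := by simpa only [hL1] using hHS
    _ ≤ ∑ i, t ^ 2 * (M ^ 2 * q i) * (8 / ((p - 2) * (p + 2)) * (s i / t) ^ p * W) :=
        Finset.sum_le_sum fun i _ => hC i
    _ = _ := by
        rw [Finset.mul_sum, Finset.sum_mul, Finset.mul_sum]
        refine Finset.sum_congr rfl fun i _ => ?_
        rw [Real.div_rpow (hs i) ht.le]
        ring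

end Discrete

end Cwikel

namespace Cwikel

/-! ### Multiplication of bounded functions by a weak `L^p` multiplier -/

section WeakMultiplier

variable {Y : Type*} [MeasurableSpace Y] {ν : Measure Y}
  {G : Type*} [NormedAddCommGroup G] [InnerProductSpace ℂ G] [CompleteSpace G]
  [TopologicalSpace.SeparableSpace G]

/-- Where `‖g‖ ≤ 1` the `L²` norm of `θ` suffices; where `‖g‖ > 1`, `‖g‖ ^ 2` is integrable because
`p > 2`, and `θ` is bounded. -/
theorem exists_lintegral_adjoint_apply_le {g : Y → G →L[ℂ] G} (hg : OpMeasurable g ν) {p : ℝ}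
    (hp : 2 < p) {W : ℝ}
    (hW : ∀ t : ℝ, 0 < t → ENNReal.ofReal t ^ p * ν {y | t < ‖g y‖} ≤ ENNReal.ofReal W) :
    ∃ K : ℝ, 0 ≤ K ∧ ∀ (θ : Lp G 2 ν) (B : ℝ), 0 ≤ B → (∀ᵐ y ∂ν, ‖θ y‖ ≤ B) →
      ∫⁻ y, ‖ContinuousLinearMap.adjoint (g y) (θ y)‖ₑ ^ 2 ∂ν ≤
        ENNReal.ofReal (‖θ‖ ^ 2 + B ^ 2 * K) := by
  -- The layer-cake function with `a = 2`: the factor two gives `2 * ‖g‖ - 1 ≥ ‖g‖` when `‖g‖ > 1`.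
  set k : Y → ℝ := fun y => (2 * ‖g y‖ - min (2 * ‖g y‖) (2 * ‖g y‖)⁻¹) ^ 2 with hk
  have hkW := lintegral_sq_sub_min_le hp hg.aemeasurable_norm (fun y => norm_nonneg _) hW
    (zero_le_two (α := ℝ))
  have hfin : ∫⁻ y, ENNReal.ofReal (k y) ∂ν ≠ ∞ :=
    ne_top_of_le_ne_top (by finiteness) hkW
  have hgk : ∀ y, ‖g y‖ ^ 2 ≤ 1 + k y := fun y => by
    have h0 := norm_nonneg (g y)
    rcases le_or_gt ‖g y‖ 1 with h | h
    · have : 0 ≤ k y := sq_nonneg _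
      nlinarith
    · have h1 : (2 * ‖g y‖)⁻¹ ≤ 1 := inv_le_one_of_one_le₀ (by linarith)
      have h2 : min (2 * ‖g y‖) (2 * ‖g y‖)⁻¹ ≤ 1 := (min_le_right _ _).trans h1
      have h3 : ‖g y‖ ^ 2 ≤ k y := by
        rw [hk]
        exact pow_le_pow_left₀ h0 (by linarith) 2
      linarith
  have hkm : AEMeasurable (fun y => ENNReal.ofReal (k y)) ν := by
    have h := hg.aemeasurable_norm.const_mul 2
    exact ((h.sub (h.min h.inv)).pow_const 2).ennreal_ofReal
  refine ⟨(∫⁻ y, ENNReal.ofReal (k y) ∂ν).toReal, ENNReal.toReal_nonneg, fun θ B hB hθ => ?_⟩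
  calc ∫⁻ y, ‖ContinuousLinearMap.adjoint (g y) (θ y)‖ₑ ^ 2 ∂ν
      ≤ ∫⁻ y, (‖θ y‖ₑ ^ 2 + ENNReal.ofReal (B ^ 2) * ENNReal.ofReal (k y)) ∂ν := by
        refine lintegral_mono_ae ?_
        filter_upwards [hθ] with y hy
        have hk0 : 0 ≤ k y := sq_nonneg _
        rw [← ofReal_norm, ← ofReal_norm, ← ENNReal.ofReal_pow (norm_nonneg _),
          ← ENNReal.ofReal_pow (norm_nonneg _), ← ENNReal.ofReal_mul (by positivity),
          ← ENNReal.ofReal_add (by positivity) (by positivity)]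
        refine ENNReal.ofReal_le_ofReal ?_
        have h1 : ‖ContinuousLinearMap.adjoint (g y) (θ y)‖ ≤ ‖g y‖ * ‖θ y‖ := by
          refine (ContinuousLinearMap.le_opNorm _ _).trans ?_
          rw [LinearIsometryEquiv.norm_map]
        calc _ ≤ (‖g y‖ * ‖θ y‖) ^ 2 := pow_le_pow_left₀ (norm_nonneg _) h1 2
          _ = ‖g y‖ ^ 2 * ‖θ y‖ ^ 2 := by ring
          _ ≤ (1 + k y) * ‖θ y‖ ^ 2 := by gcongr; exact hgk y
          _ = ‖θ y‖ ^ 2 + ‖θ y‖ ^ 2 * k y := by ring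
          _ ≤ _ := by gcongr
    _ = _ := by
        rw [lintegral_add_right' _ (hkm.const_mul _), lintegral_const_mul' _ _ ENNReal.ofReal_ne_top,
          ← Lp_enorm_sq, ← ofReal_norm, ← ENNReal.ofReal_pow (norm_nonneg _),
          ENNReal.ofReal_add (by positivity) (by positivity), ENNReal.ofReal_mul (by positivity),
          ENNReal.ofReal_toReal hfin]

theorem memLp_two_of_lintegral {E : Type*} [NormedAddCommGroup E] {u : Y → E}
    (hu : AEStronglyMeasurable u ν) (h : ∫⁻ y, ‖u y‖ₑ ^ 2 ∂ν < ∞) : MemLp u 2 ν := by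
  refine ⟨hu, ?_⟩
  rw [eLpNorm_lt_top_iff_lintegral_rpow_enorm_lt_top two_ne_zero ENNReal.ofNat_ne_top]
  simpa using h

theorem memLp_adjoint_apply {g : Y → G →L[ℂ] G} (hg : OpMeasurable g ν) {p : ℝ}
    (hp : 2 < p) {W : ℝ}
    (hW : ∀ t : ℝ, 0 < t → ENNReal.ofReal t ^ p * ν {y | t < ‖g y‖} ≤ ENNReal.ofReal W)
    {θ : Lp G 2 ν} {B : ℝ} (hB : 0 ≤ B) (hθ : ∀ᵐ y ∂ν, ‖θ y‖ ≤ B) :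
    MemLp (fun y => ContinuousLinearMap.adjoint (g y) (θ y)) 2 ν := by
  obtain ⟨K, -, hK⟩ := exists_lintegral_adjoint_apply_le hg hp hW
  exact memLp_two_of_lintegral (hg.adjoint.apply (Lp.aestronglyMeasurable θ))
    ((hK θ B hB hθ).trans_lt ENNReal.ofReal_lt_top)

end WeakMultiplier

/-! ### The `L¹ → L^∞` bound on `L¹ ∩ L²` -/

section L1Linfty

variable {X Y : Type*} [MeasurableSpace X] [MeasurableSpace Y] {μ : Measure X} {ν : Measure Y}
  {H : Type*} [NormedAddCommGroup H] [InnerProductSpace ℂ H]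
  {G : Type*} [NormedAddCommGroup G] [InnerProductSpace ℂ G]

theorem ae_norm_le_of_memLp_one {Φ : Lp H 2 μ → Lp G 2 ν} {Φ₁ : Lp H 1 μ →L[ℂ] Lp G ∞ ν}
    (hΦ₁ : ∀ (φ : Lp H 2 μ) (φ₁ : Lp H 1 μ), φ =ᵐ[μ] φ₁ → Φ φ =ᵐ[ν] Φ₁ φ₁)
    {ζ : Lp H 2 μ} (hζ : MemLp ζ 1 μ) :
    ∀ᵐ y ∂ν, ‖Φ ζ y‖ ≤ ‖Φ₁‖ * (eLpNorm ζ 1 μ).toReal := by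
  have h1 := hΦ₁ ζ (hζ.toLp _) hζ.coeFn_toLp.symm
  have h2 : ∀ᵐ y ∂ν, ‖(Φ₁ (hζ.toLp _)) y‖ₑ ≤ ‖Φ₁ (hζ.toLp _)‖ₑ := by
    rw [Lp.enorm_def, eLpNorm_exponent_top]
    exact ae_le_eLpNormEssSup
  filter_upwards [h1, h2] with y hy hy2
  rw [hy]
  rw [← ofReal_norm, ← ofReal_norm, ENNReal.ofReal_le_ofReal_iff (norm_nonneg _)] at hy2
  refine hy2.trans ((Φ₁.le_opNorm _).trans (le_of_eq ?_))
  rw [Lp.norm_toLp]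

end L1Linfty

/-! ### Singular value decomposition on `ℂ^d` -/

section SingularValueDecomposition

variable {H : Type*} [NormedAddCommGroup H] [InnerProductSpace ℂ H]

/-- The operator from `ℂ^d` to `H` which maps the standard basis to the family `v`. -/
def synthesis {d : ℕ} (v : Fin d → H) : EuclideanSpace ℂ (Fin d) →ₗ[ℂ] H where
  toFun a := ∑ m, a m • v m
  map_add' a b := by simp [add_smul, Finset.sum_add_distrib]
  map_smul' c a := by simp [mul_smul, Finset.smul_sum]

theorem synthesis_apply {d : ℕ} (v : Fin d → H) (a : EuclideanSpace ℂ (Fin d)) :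
    synthesis v a = ∑ m, a m • v m := rfl

/-- An eigenbasis of `S* S` is mapped by `S` to an orthogonal family. Restricting to the
finite-dimensional range provides the adjoint without completeness of `H`. -/
theorem exists_orthonormalBasis_synthesis {d : ℕ} (v : Fin d → H) :
    ∃ b : OrthonormalBasis (Fin d) ℂ (EuclideanSpace ℂ (Fin d)),
      ∀ i j, i ≠ j → inner ℂ (synthesis v (b i)) (synthesis v (b j)) = 0 := by
  let S := (synthesis v).rangeRestrict
  have hS : (LinearMap.adjoint S ∘ₗ S).IsSymmetric := fun x y => by
    simp [LinearMap.adjoint_inner_left, LinearMap.adjoint_inner_right]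
  have hd : Module.finrank ℂ (EuclideanSpace ℂ (Fin d)) = d := by simp
  refine ⟨hS.eigenvectorBasis hd, fun i j hij => ?_⟩
  have h1 : inner ℂ (synthesis v (hS.eigenvectorBasis hd i)) (synthesis v (hS.eigenvectorBasis hd j)) =
      inner ℂ ((LinearMap.adjoint S ∘ₗ S) (hS.eigenvectorBasis hd i))
        (hS.eigenvectorBasis hd j) := by
    rw [LinearMap.comp_apply, LinearMap.adjoint_inner_left]
    rfl
  rw [h1, hS.apply_eigenvectorBasis, inner_smul_left,
    (hS.eigenvectorBasis hd).orthonormal.2 hij, mul_zero]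

/-- An orthonormal basis of `ℂ^d` of right singular vectors of `synthesis v`. -/
def singularBasis {d : ℕ} (v : Fin d → H) :
    OrthonormalBasis (Fin d) ℂ (EuclideanSpace ℂ (Fin d)) :=
  (exists_orthonormalBasis_synthesis v).choose

theorem inner_synthesis_singularBasis {d : ℕ} (v : Fin d → H) {i j : Fin d} (h : i ≠ j) :
    inner ℂ (synthesis v (singularBasis v i)) (synthesis v (singularBasis v j)) = 0 :=
  (exists_orthonormalBasis_synthesis v).choose_spec i j h

end SingularValueDecomposition

end Cwikel

namespace Cwikel

/-! ### The count for simple data -/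

section SimpleFunctions

variable {X Y : Type*} [MeasurableSpace X] [MeasurableSpace Y] {μ : Measure X} {ν : Measure Y}
  {H : Type*} [NormedAddCommGroup H] [InnerProductSpace ℂ H] [CompleteSpace H]
  {G : Type*} [NormedAddCommGroup G] [InnerProductSpace ℂ G] [CompleteSpace G]
  [TopologicalSpace.SeparableSpace G]

theorem lintegral_comp_simpleFunc {α : Type*} (Ξ : SimpleFunc X α) (h : α → ℝ≥0∞) :
    ∫⁻ x, h (Ξ x) ∂μ = ∑ z ∈ Ξ.range, h z * μ (Ξ ⁻¹' {z}) := by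
  rw [← SimpleFunc.map_lintegral, ← SimpleFunc.lintegral_eq_lintegral]
  rfl

/-- Reduction to `discrete_cwikel`. On a fibre of the pair `(η, v)` the operator `synthesis (v x)`
is constant, so the index set consists of fibres paired with singular vectors. -/
theorem simple_cwikel {Φ : Lp H 2 μ ≃ₗᵢ[ℂ] Lp G 2 ν} {Φ₁ : Lp H 1 μ →L[ℂ] Lp G ∞ ν}
    (hΦ₁ : ∀ (φ : Lp H 2 μ) (φ₁ : Lp H 1 μ), φ =ᵐ[μ] φ₁ → Φ φ =ᵐ[ν] Φ₁ φ₁)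
    {g : Y → G →L[ℂ] G} (hg : OpMeasurable g ν) {p : ℝ} (hp : 2 < p) {W : ℝ} (hW0 : 0 ≤ W)
    (hW : ∀ t : ℝ, 0 < t → ENNReal.ofReal t ^ p * ν {y | t < ‖g y‖} ≤ ENNReal.ofReal W)
    {N d : ℕ} (η : SimpleFunc X (Fin N → EuclideanSpace ℂ (Fin d))) (hη : μ {x | η x ≠ 0} < ∞)
    (v : SimpleFunc X (Fin d → H))
    (hcontr : ∀ c : EuclideanSpace ℂ (Fin N),
      ∫⁻ x, ‖∑ i, c i • η x i‖ₑ ^ 2 ∂μ ≤ ENNReal.ofReal (‖c‖ ^ 2))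
    {ζ : Fin N → Lp H 2 μ} (hζ : ∀ i, ζ i =ᵐ[μ] fun x => synthesis (v x) (η x i))
    {τ : Fin N → Lp G 2 ν}
    (hτ : ∀ i, τ i =ᵐ[ν] fun y => ContinuousLinearMap.adjoint (g y) (Φ (ζ i) y))
    {r : ℝ} (hr : 0 < r)
    (hlow : ∀ c : EuclideanSpace ℂ (Fin N), r * ‖c‖ ≤ ‖∑ i, c i • τ i‖) {S : ℝ} (hS0 : 0 ≤ S)
    (hS : ∫⁻ x in {x | η x ≠ 0}, ∑ j, ‖synthesis (v x) (singularBasis (v x) j)‖ₑ ^ p ∂μ ≤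
      ENNReal.ofReal S) :
    N * r ^ p ≤ 2 * (p - 2) / (p + 2) * (p / (p - 2)) ^ p * (‖Φ₁‖ ^ 2 * S * W) := by
  classical
  set Ξ := η.pair v with hΞ
  -- Fibres with `η = 0` do not contribute and may have infinite measure.
  set Z := Ξ.range.filter (fun z => z.1 ≠ 0) with hZ
  have hfin : ∀ z : Z, μ (Ξ ⁻¹' {z.1}) ≠ ∞ := fun z => by
    refine (lt_of_le_of_lt (measure_mono fun x hx => ?_) hη).ne
    have h1 : Ξ x = z.1 := hx
    have h2 := (Finset.mem_filter.1 z.2).2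
    rw [← h1] at h2
    exact h2
  set q : Z × Fin d → ℝ := fun α => μ.real (Ξ ⁻¹' {α.1.1}) with hq_def
  set sv : Z × Fin d → H := fun α => synthesis α.1.1.2 (singularBasis α.1.1.2 α.2) with hsv
  have hq : ∀ α, 0 ≤ q α := fun α => measureReal_nonneg
  -- Normalized left singular vectors on a fibre, normalized in `L²`. If `q α` or `sv α` is zero
  -- then `χ α = 0`, so the norms are at most one rather than equal to one.
  set χ : Z × Fin d → Lp H 2 μ := fun α => indicatorConstLp 2 (Ξ.measurableSet_fiber α.1.1)
    (hfin α.1) (((√(q α))⁻¹ * ‖sv α‖⁻¹ : ℝ) • sv α) with hχ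
  have hnc : ∀ α, ‖((√(q α))⁻¹ * ‖sv α‖⁻¹ : ℝ) • sv α‖ ≤ (√(q α))⁻¹ := fun α => by
    rw [norm_smul, Real.norm_of_nonneg (by positivity), mul_assoc]
    exact mul_le_of_le_one_right (by positivity) (inv_mul_le_one)
  have hχ1 : ∀ α, MemLp (χ α) 1 μ := fun α => by
    have : MemLp ((Ξ ⁻¹' {α.1.1}).indicator fun _ => ((√(q α))⁻¹ * ‖sv α‖⁻¹ : ℝ) • sv α) 1 μ :=
      memLp_indicator_const 1 (Ξ.measurableSet_fiber _) _ (Or.inr (hfin α.1))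
    exact (memLp_congr_ae indicatorConstLp_coeFn).2 this
  have hχ1n : ∀ α, (eLpNorm (χ α) 1 μ).toReal ≤ √(q α) := fun α => by
    rw [eLpNorm_congr_ae indicatorConstLp_coeFn,
      eLpNorm_indicator_const (Ξ.measurableSet_fiber _) one_ne_zero ENNReal.one_ne_top,
      ENNReal.toReal_mul]
    simp only [toReal_enorm, ENNReal.toReal_one, div_one, ENNReal.rpow_one]
    calc _ ≤ (√(q α))⁻¹ * q α := by
          gcongr
          · exact hnc α
          · exact le_rfl
      _ = √(q α) := by
          rw [inv_mul_eq_div, Real.div_sqrt]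
  have hbd : ∀ α, ∀ᵐ y ∂ν, ‖Φ (χ α) y‖ ≤ ‖Φ₁‖ * √(q α) := fun α => by
    filter_upwards [ae_norm_le_of_memLp_one hΦ₁ (hχ1 α)] with y hy
    exact hy.trans (mul_le_mul_of_nonneg_left (hχ1n α) Φ₁.opNorm_nonneg)
  have hmem := fun α => memLp_adjoint_apply hg hp hW (by positivity) (hbd α)
  set τ' : Z × Fin d → Lp G 2 ν := fun α => (hmem α).toLp with hτ'
  -- The coefficients of `∑ i, c i • η i` in the singular bases, weighted by `√(q α)`. By Parseval
  -- on each fibre, `‖J₀ c‖ ^ 2` is the integral bounded in `hcontr`.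
  let J₀ : EuclideanSpace ℂ (Fin N) →ₗ[ℂ] EuclideanSpace ℂ (Z × Fin d) :=
    { toFun := fun c => WithLp.toLp 2 fun α =>
        (√(q α) : ℂ) * (singularBasis α.1.1.2).repr (∑ i, c i • α.1.1.1 i) α.2
      map_add' := fun a b => by
        ext α
        simp [add_smul, Finset.sum_add_distrib, mul_add]
      map_smul' := fun a b => by
        ext α
        simp only [PiLp.smul_apply, smul_eq_mul, RingHom.id_apply, mul_smul]
        rw [← Finset.smul_sum, map_smul, PiLp.smul_apply, smul_eq_mul]
        ring }
  have hJ : ‖LinearMap.toContinuousLinearMap J₀‖ ≤ 1 := by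
    refine ContinuousLinearMap.opNorm_le_bound _ zero_le_one fun c => ?_
    rw [one_mul]
    refine (pow_le_pow_iff_left₀ (norm_nonneg _) (norm_nonneg _) two_ne_zero).1 ?_
    rw [← ENNReal.ofReal_le_ofReal_iff (by positivity)]
    refine le_trans (le_of_eq ?_) (hcontr c)
    have h1 := lintegral_comp_simpleFunc (μ := μ) Ξ (fun z => ‖∑ i, c i • z.1 i‖ₑ ^ 2)
    have h2 : ∫⁻ x, ‖∑ i, c i • (Ξ x).1 i‖ₑ ^ 2 ∂μ = ∫⁻ x, ‖∑ i, c i • η x i‖ₑ ^ 2 ∂μ := rfl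
    rw [← h2, h1, ← Finset.sum_filter_of_ne (p := fun z => z.1 ≠ 0), ← Finset.sum_coe_sort,
      EuclideanSpace.norm_sq_eq, Fintype.sum_prod_type,
      ENNReal.ofReal_sum_of_nonneg fun _ _ => by positivity]
    · refine Finset.sum_congr rfl fun z _ => ?_
      have h3 : ∀ j, ‖(LinearMap.toContinuousLinearMap J₀) c (z, j)‖ ^ 2 = μ.real (Ξ ⁻¹' {z.1}) *
          ‖(singularBasis z.1.2).repr (∑ i, c i • z.1.1 i) j‖ ^ 2 := fun j => by
        change ‖(√(q (z, j)) : ℂ) * (singularBasis z.1.2).repr (∑ i, c i • z.1.1 i) j‖ ^ 2 = _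
        rw [norm_mul, mul_pow, Complex.norm_real, Real.norm_of_nonneg (Real.sqrt_nonneg _),
          Real.sq_sqrt (hq _)]
      simp only [h3]
      rw [← Finset.mul_sum, ← EuclideanSpace.norm_sq_eq, LinearIsometryEquiv.norm_map,
        ENNReal.ofReal_mul measureReal_nonneg, ofReal_measureReal (hfin z),
        ENNReal.ofReal_pow (norm_nonneg _), ofReal_norm, mul_comm]
    · intro z _ hz h0
      apply hz
      simp [h0]
  have hζsum : ∀ c : EuclideanSpace ℂ (Fin N),
      ∑ i, c i • ζ i = ∑ α, J₀ c α • (‖sv α‖ • χ α) := fun c => by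
    refine Lp.ext ?_
    -- On fibres of measure zero `√(q α)` cannot be cancelled; they are discarded.
    have hnull : ∀ᵐ x ∂μ, ∀ z ∈ Ξ.range, μ (Ξ ⁻¹' {z}) = 0 → x ∉ Ξ ⁻¹' {z} := by
      rw [Filter.eventually_all_finset]
      intro z _
      by_cases h0 : μ (Ξ ⁻¹' {z}) = 0
      · filter_upwards [measure_eq_zero_iff_ae_notMem.1 h0] with x hx _ using hx
      · exact Filter.Eventually.of_forall fun x h => (h0 h).elim
    filter_upwards [coeFn_sum_smul Finset.univ (fun i => c i) ζ, ae_all_iff.2 hζ,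
      coeFn_sum_smul Finset.univ (fun α => J₀ c α) (fun α => ‖sv α‖ • χ α),
      ae_all_iff.2 fun α => Lp.coeFn_smul ‖sv α‖ (χ α),
      ae_all_iff.2 fun α => indicatorConstLp_coeFn (p := 2) (hs := Ξ.measurableSet_fiber α.1.1)
        (hμs := hfin α.1) (c := ((√(q α))⁻¹ * ‖sv α‖⁻¹ : ℝ) • sv α), hnull]
      with x h1 h2 h3 h4 h5 h6
    rw [h1, h3, Fintype.sum_prod_type]
    have h7 : ∀ α : Z × Fin d, J₀ c α • (‖sv α‖ • χ α : Lp H 2 μ) x =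
        if Ξ x = α.1.1 then (singularBasis α.1.1.2).repr (∑ i, c i • α.1.1.1 i) α.2 • sv α
          else 0 := fun α => by
      rw [h4 α, Pi.smul_apply, hχ, h5 α]
      split_ifs with h
      · rw [Set.indicator_of_mem (by exact h)]
        have hne : q α ≠ 0 := fun h0 => by
          have hz : α.1.1 ∈ Ξ.range := (Finset.mem_filter.1 α.1.2).1
          exact h6 _ hz ((measureReal_eq_zero_iff (hfin α.1)).1 h0) h
        have hsq : √(q α) ≠ 0 := fun h0 => hne ((Real.sqrt_eq_zero (hq α)).1 h0)
        change ((√(q α) : ℂ) * (singularBasis α.1.1.2).repr (∑ i, c i • α.1.1.1 i) α.2) • _ = _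
        by_cases hs0 : sv α = 0
        · simp [hs0]
        · have hs1 : ‖sv α‖ ≠ 0 := norm_ne_zero_iff.2 hs0
          rw [mul_comm ((√(q α) : ℝ) : ℂ), mul_smul, Complex.coe_smul, smul_smul, smul_smul,
            show √(q α) * ‖sv α‖ * ((√(q α))⁻¹ * ‖sv α‖⁻¹) = 1 by field_simp, one_smul]
      · rw [Set.indicator_of_notMem (by exact h), smul_zero, smul_zero]
    simp only [h7, h2]
    have h8 : ∑ i, c i • synthesis (v x) (η x i) = synthesis (v x) (∑ i, c i • η x i) := by
      simp only [map_sum, map_smul]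
    rw [h8]
    by_cases hx : η x = 0
    · have h9 : ∀ z : Z, Ξ x ≠ z.1 := fun z h => (Finset.mem_filter.1 z.2).2 (by rw [← h]; exact hx)
      simp [hx, h9]
    · have hz : Ξ x ∈ Z := Finset.mem_filter.2 ⟨SimpleFunc.mem_range_self _ _, hx⟩
      rw [Finset.sum_eq_single (⟨Ξ x, hz⟩ : Z)]
      · simp only [if_true]
        have h9 := (singularBasis (v x)).sum_repr (∑ i, c i • η x i)
        nth_rw 1 [← h9]
        rw [map_sum]
        simp only [map_smul]
        rfl
      · intro z _ hz'
        refine Finset.sum_eq_zero fun j _ => if_neg fun h => hz' (Subtype.ext h.symm)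
      · exact fun h => (h (Finset.mem_univ _)).elim
  have hτsum : ∀ c : EuclideanSpace ℂ (Fin N),
      ∑ i, c i • τ i = ∑ α, J₀ c α • (‖sv α‖ • τ' α) := fun c => by
    refine Lp.ext ?_
    have hΦsum : ∑ i, c i • Φ (ζ i) = ∑ α, J₀ c α • (‖sv α‖ • Φ (χ α)) := by
      have := congrArg Φ (hζsum c)
      simp only [map_sum, map_smul] at this
      rw [this]
      refine Finset.sum_congr rfl fun α _ => ?_
      exact congrArg _ (Φ.toLinearEquiv.toLinearMap.map_smul_of_tower ‖sv α‖ (χ α))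
    filter_upwards [coeFn_sum_smul Finset.univ (fun i => c i) τ, ae_all_iff.2 hτ,
      coeFn_sum_smul Finset.univ (fun α => J₀ c α) (fun α => ‖sv α‖ • τ' α),
      ae_all_iff.2 fun α => Lp.coeFn_smul ‖sv α‖ (τ' α), ae_all_iff.2 fun α => (hmem α).coeFn_toLp,
      coeFn_sum_smul Finset.univ (fun i => c i) (fun i => Φ (ζ i)),
      coeFn_sum_smul Finset.univ (fun α => J₀ c α) (fun α => ‖sv α‖ • Φ (χ α)),
      ae_all_iff.2 fun α => Lp.coeFn_smul ‖sv α‖ (Φ (χ α))] with y h1 h2 h3 h4 h5 h6 h7 h8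
    rw [h1, h3]
    rw [hΦsum] at h6
    have h9 := congrArg (ContinuousLinearMap.adjoint (g y)) (h6.symm.trans h7)
    simp only [map_sum, map_smul, h8, Pi.smul_apply,
      ContinuousLinearMap.map_smul_of_tower] at h9
    have h10 : ∀ α, τ' α y = ContinuousLinearMap.adjoint (g y) (Φ (χ α) y) := h5
    simp only [h2, h4, Pi.smul_apply, h10]
    exact h9
  have hSle : ∑ α, q α * ‖sv α‖ ^ p ≤ S := by
    rw [← ENNReal.ofReal_le_ofReal_iff hS0]
    refine le_trans (le_of_eq ?_) hS
    have hmeas : MeasurableSet {x | η x ≠ 0} := (η.measurableSet_fiber 0).compl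
    rw [← lintegral_indicator hmeas]
    have h1 := lintegral_comp_simpleFunc (μ := μ) Ξ (fun z => if z.1 ≠ 0 then
      ∑ j, ‖synthesis z.2 (singularBasis z.2 j)‖ₑ ^ p else 0)
    have h2 : ∀ x, {x | η x ≠ 0}.indicator
        (fun x => ∑ j, ‖synthesis (v x) (singularBasis (v x) j)‖ₑ ^ p) x =
        if (Ξ x).1 ≠ 0 then ∑ j, ‖synthesis (Ξ x).2 (singularBasis (Ξ x).2 j)‖ₑ ^ p else 0 :=
      fun x => by
        simp only [Set.indicator_apply, Set.mem_ofPred_eq]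
        rfl
    simp only [h2]
    rw [h1, Fintype.sum_prod_type, ENNReal.ofReal_sum_of_nonneg fun _ _ => by positivity]
    simp only [ite_mul, zero_mul]
    rw [← Finset.sum_filter, ← Finset.sum_coe_sort (Ξ.range.filter fun z => z.1 ≠ 0)]
    refine Finset.sum_congr rfl fun z _ => ?_
    rw [ENNReal.ofReal_sum_of_nonneg fun _ _ => by positivity, Finset.sum_mul]
    refine Finset.sum_congr rfl fun j _ => ?_
    rw [ENNReal.ofReal_mul (hq _), ofReal_measureReal (hfin z), ← ENNReal.ofReal_rpow_of_nonneg
      (norm_nonneg _) (by linarith), ofReal_norm, mul_comm]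
  have key := discrete_cwikel hg hp hW0 hW (θ := fun α => Φ (χ α)) (τ := τ') (q := q)
    (M := ‖Φ₁‖) (s := fun α => ‖sv α‖) (J := LinearMap.toContinuousLinearMap J₀) (r := r)
    (fun α β hαβ => by
      rw [LinearIsometryEquiv.inner_map_map, hχ,
        L2.inner_indicatorConstLp_indicatorConstLp _ _ (hfin α.1) (hfin β.1)]
      by_cases h : α.1 = β.1
      · have h2 : α.2 ≠ β.2 := fun h2 => hαβ (Prod.ext h h2)
        have h3 : inner ℂ (sv α) (sv β) = 0 := by
          rw [hsv]
          simp only [h]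
          exact inner_synthesis_singularBasis _ h2
        rw [inner_smul_left_eq_smul, inner_smul_right_eq_smul, h3]
        simp
      · have h2 : (Ξ ⁻¹' {α.1.1}) ∩ (Ξ ⁻¹' {β.1.1}) = ∅ := by
          ext x
          simp only [Set.mem_inter_iff, Set.mem_preimage, Set.mem_singleton_iff,
            Set.mem_empty_iff_false, iff_false, not_and]
          intro h3 h4
          exact h (Subtype.ext (h3.symm.trans h4))
        rw [h2]
        simp)
    (fun α => by
      rw [LinearIsometryEquiv.norm_map, hχ, norm_indicatorConstLp two_ne_zero ENNReal.ofNat_ne_top]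
      have h1 : μ.real (Ξ ⁻¹' {α.1.1}) ^ (1 / (2 : ℝ≥0∞).toReal) = √(q α) := by
        rw [Real.sqrt_eq_rpow]
        simp [hq_def]
      rw [h1]
      calc _ ≤ (√(q α))⁻¹ * √(q α) := by gcongr; exact hnc α
        _ ≤ 1 := inv_mul_le_one)
    hq
    (fun α => by
      filter_upwards [hbd α] with y hy
      calc ‖Φ (χ α) y‖ ^ 2 ≤ (‖Φ₁‖ * √(q α)) ^ 2 := by gcongr
        _ = _ := by rw [mul_pow, Real.sq_sqrt (hq α)])
    (fun α => (hmem α).coeFn_toLp) (fun α => norm_nonneg _) hJ hr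
    (fun c => by
      refine (hlow c).trans (le_of_eq ?_)
      rw [hτsum]
      rfl)
  refine key.trans ?_
  have h2 : 0 < p - 2 := by linarith
  gcongr

end SimpleFunctions

end Cwikel

namespace Cwikel

/-! ### Approximation of `f*` by simple functions -/

section Approximation

variable {X : Type*} [MeasurableSpace X] {μ : Measure X}
  {H : Type*} [NormedAddCommGroup H] [InnerProductSpace ℂ H] [CompleteSpace H]

theorem exists_simpleFunc_pi {α : Type*} {n : ℕ} (η : Fin n → SimpleFunc X α) :
    ∃ Ξ : SimpleFunc X (Fin n → α), ∀ x i, Ξ x i = η i x := by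
  refine ⟨⟨fun x i => η i x, fun z => ?_, ?_⟩, fun x i => rfl⟩
  · have h : (fun x i => η i x) ⁻¹' {z} = ⋂ i, η i ⁻¹' {z i} := by
      ext x
      simp [funext_iff]
    rw [h]
    exact MeasurableSet.iInter fun i => (η i).measurableSet_fiber _
  · refine (Set.Finite.pi fun i => (η i).finite_range).subset ?_
    rintro _ ⟨x, rfl⟩ i _
    exact ⟨x, rfl⟩

theorem exists_simpleFunc_eLpNorm_sum_le {d : ℕ} {v : Fin d → X → H} {P : ℝ≥0∞} (hP1 : 1 ≤ P)
    (hP : P ≠ ∞) (hv : ∀ m, MemLp (v m) P μ) {δ : ℝ} (hδ : 0 < δ) :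
    ∃ v' : SimpleFunc X (Fin d → H),
      eLpNorm (fun x => ∑ m, ‖v m x - v' x m‖) P μ ≤ ENNReal.ofReal δ := by
  -- `d + 1` rather than `d`, to cover `d = 0`.
  have hε : 0 < δ / (d + 1) := by positivity
  choose w hw _ using fun m => (hv m).exists_simpleFunc_eLpNorm_sub_lt hP
    (ε := ENNReal.ofReal (δ / (d + 1))) (by simpa using hε)
  obtain ⟨v', hv'⟩ := exists_simpleFunc_pi w
  refine ⟨v', ?_⟩
  have h1 : (fun x => ∑ m, ‖v m x - v' x m‖) = ∑ m, fun x => ‖(v m - w m) x‖ := by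
    funext x
    simp [hv']
  rw [h1]
  calc _ ≤ ∑ m, eLpNorm (fun x => ‖(v m - w m) x‖) P μ :=
        eLpNorm_sum_le (fun m _ => ((hv m).1.sub (w m).aestronglyMeasurable).norm) hP1
    _ ≤ ∑ _m : Fin d, ENNReal.ofReal (δ / (d + 1)) := by
        refine Finset.sum_le_sum fun m _ => ?_
        rw [eLpNorm_norm]
        exact (hw m).le
    _ = ENNReal.ofReal (d * (δ / (d + 1))) := by
        rw [Finset.sum_const, Finset.card_univ, Fintype.card_fin, nsmul_eq_mul,
          ENNReal.ofReal_mul (by positivity), ENNReal.ofReal_natCast]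
    _ ≤ ENNReal.ofReal δ := by
        refine ENNReal.ofReal_le_ofReal ?_
        rw [← mul_div_assoc, div_le_iff₀ (by positivity)]
        nlinarith

theorem inner_synthesis {d : ℕ} {e : Fin d → H} (he : Orthonormal ℂ e)
    (a b : EuclideanSpace ℂ (Fin d)) :
    inner ℂ (synthesis e a) (synthesis e b) = inner ℂ a b := by
  rw [synthesis_apply, synthesis_apply, he.inner_sum, PiLp.inner_apply]
  refine Finset.sum_congr rfl fun i _ => ?_
  simp [mul_comm]

/-- `synthesis e` is isometric, so it carries `b` to an orthonormal system on which `A*` is tested.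
-/
theorem sum_enorm_synthesis_rpow_le {A : H →L[ℂ] H} (hA : IsCompactOperator A) {p : ℝ}
    (hp : 2 ≤ p) {d : ℕ} {e : Fin d → H} (he : Orthonormal ℂ e)
    (b : OrthonormalBasis (Fin d) ℂ (EuclideanSpace ℂ (Fin d))) :
    ∑ j, ‖synthesis (fun m => ContinuousLinearMap.adjoint A (e m)) (b j)‖ₑ ^ p ≤
      eSchattenNorm p A ^ p := by
  have ho : Orthonormal ℂ (fun j => synthesis e (b j)) := by
    rw [orthonormal_iff_ite]
    intro i j
    rw [inner_synthesis he]
    exact orthonormal_iff_ite.1 b.orthonormal i j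
  rw [eSchattenNorm_rpow (by linarith)]
  refine le_trans (le_of_eq ?_) (sum_norm_adjoint_rpow_le hA hp ho)
  refine Finset.sum_congr rfl fun j _ => ?_
  rw [ofReal_norm, synthesis_apply, synthesis_apply, map_sum]
  simp only [map_smul]

theorem norm_synthesis_sub_le {d : ℕ} (v w : Fin d → H) (a : EuclideanSpace ℂ (Fin d)) {C : ℝ}
    (ha : ‖a‖ ≤ C) : ‖synthesis v a - synthesis w a‖ ≤ C * ∑ m, ‖v m - w m‖ := by
  rw [synthesis_apply, synthesis_apply, ← Finset.sum_sub_distrib, Finset.mul_sum]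
  refine norm_sum_le_of_le _ fun m _ => ?_
  rw [← smul_sub, norm_smul]
  gcongr
  exact (PiLp.norm_apply_le a m).trans ha

theorem aestronglyMeasurable_synthesis {d : ℕ} {v : X → Fin d → H}
    (hv : ∀ m, AEStronglyMeasurable (fun x => v x m) μ) {α : Type*} (Ξ : SimpleFunc X α)
    (a : α → EuclideanSpace ℂ (Fin d)) :
    AEStronglyMeasurable (fun x => synthesis (v x) (a (Ξ x))) μ := by
  simp only [synthesis_apply]
  refine Finset.aestronglyMeasurable_fun_sum _ fun m _ => ?_
  exact (Ξ.map fun z => a z m).aestronglyMeasurable.smul (hv m)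

/-- Minkowski in `ℓ^p` and then in `L^p`. The singular basis of the approximant is used for `f*`
too: the Schatten bound holds in every orthonormal basis, so no continuity of singular bases is
needed. -/
theorem lintegral_sum_synthesis_le {p : ℝ} (hp : 2 < p) {f : X → H →L[ℂ] H}
    (hfc : ∀ᵐ x ∂μ, IsCompactOperator (f x)) {d : ℕ} {e : Fin d → H} (he : Orthonormal ℂ e)
    (hfm : ∀ m, AEStronglyMeasurable (fun x => ContinuousLinearMap.adjoint (f x) (e m)) μ)
    {F : ℝ} (hF0 : 0 ≤ F) (hF : ∫⁻ x, eSchattenNorm p (f x) ^ p ∂μ ≤ ENNReal.ofReal F)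
    (v' : SimpleFunc X (Fin d → H)) {δ : ℝ} (hδ : 0 ≤ δ)
    (hv' : eLpNorm (fun x => ∑ m, ‖ContinuousLinearMap.adjoint (f x) (e m) - v' x m‖)
      (ENNReal.ofReal p) μ ≤ ENNReal.ofReal δ) :
    ∫⁻ x, ∑ j, ‖synthesis (v' x) (singularBasis (v' x) j)‖ₑ ^ p ∂μ ≤
      ENNReal.ofReal ((F ^ (1 / p) + (d : ℝ) ^ (1 / p) * δ) ^ p) := by
  have hp0 : 0 < p := by linarith
  set v : X → Fin d → H := fun x m => ContinuousLinearMap.adjoint (f x) (e m) with hv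
  set D : X → ℝ≥0∞ := fun x => ‖∑ m, ‖v x m - v' x m‖‖ₑ with hD
  set V : X → ℝ≥0∞ := fun x =>
    (∑ j, ‖synthesis (v x) (singularBasis (v' x) j)‖ₑ ^ p) ^ (1 / p) with hV
  have hVm : AEMeasurable V μ := by
    refine AEMeasurable.pow_const (Finset.aemeasurable_fun_sum _ fun j _ => ?_) _
    exact ((aestronglyMeasurable_synthesis hfm v' fun z => singularBasis z j).enorm).pow_const _
  have hDm : AEMeasurable D μ := by
    refine AEStronglyMeasurable.enorm (Finset.aestronglyMeasurable_fun_sum _ fun m _ => ?_)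
    exact ((hfm m).sub (v'.map fun z => z m).aestronglyMeasurable).norm
  have hpt : ∀ x, (∑ j, ‖synthesis (v' x) (singularBasis (v' x) j)‖ₑ ^ p) ^ (1 / p) ≤
      (V + fun x => (d : ℝ≥0∞) ^ (1 / p) * D x) x := fun x => by
    have h1 : ∀ j, ‖synthesis (v' x) (singularBasis (v' x) j)‖ₑ ≤
        ‖synthesis (v x) (singularBasis (v' x) j)‖ₑ + D x := fun j => by
      rw [show D x = ‖∑ m, ‖v x m - v' x m‖‖ₑ from rfl, ← ofReal_norm, ← ofReal_norm,
        ← ofReal_norm, ← ENNReal.ofReal_add (norm_nonneg _)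
        (norm_nonneg _)]
      refine ENNReal.ofReal_le_ofReal ?_
      have h2 := norm_synthesis_sub_le (v x) (v' x) (singularBasis (v' x) j)
        ((singularBasis (v' x)).orthonormal.1 j).le
      rw [one_mul] at h2
      rw [Real.norm_of_nonneg (by positivity)]
      have h3 := norm_sub_norm_le (synthesis (v' x) (singularBasis (v' x) j))
        (synthesis (v x) (singularBasis (v' x) j))
      rw [norm_sub_rev] at h3
      linarith
    calc _ ≤ (∑ j, (‖synthesis (v x) (singularBasis (v' x) j)‖ₑ + D x) ^ p) ^ (1 / p) := by
          gcongr with j _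
          exact h1 j
      _ ≤ V x + (∑ _j : Fin d, D x ^ p) ^ (1 / p) :=
          ENNReal.Lp_add_le _ _ _ (by linarith)
      _ = _ := by
          rw [Pi.add_apply, Finset.sum_const, Finset.card_univ, Fintype.card_fin, nsmul_eq_mul,
            ENNReal.mul_rpow_of_nonneg _ _ (by positivity), ← ENNReal.rpow_mul,
            mul_one_div_cancel hp0.ne', ENNReal.rpow_one]
  have hroot : (∫⁻ x, ((V + fun x => (d : ℝ≥0∞) ^ (1 / p) * D x) x) ^ p ∂μ) ^ (1 / p) ≤
      ENNReal.ofReal (F ^ (1 / p) + (d : ℝ) ^ (1 / p) * δ) := by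
    refine (ENNReal.lintegral_Lp_add_le hVm (hDm.const_mul _) (by linarith)).trans ?_
    rw [ENNReal.ofReal_add (by positivity) (by positivity)]
    refine add_le_add ?_ ?_
    · rw [← ENNReal.ofReal_rpow_of_nonneg hF0 (by positivity)]
      refine ENNReal.rpow_le_rpow (le_trans (lintegral_mono_ae ?_) hF) (by positivity)
      filter_upwards [hfc] with x hx
      rw [hV, ← ENNReal.rpow_mul, one_div_mul_cancel hp0.ne', ENNReal.rpow_one]
      exact sum_enorm_synthesis_rpow_le hx hp.le he _
    · have h1 : ∀ x, ((d : ℝ≥0∞) ^ (1 / p) * D x) ^ p = d * D x ^ p := fun x => by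
        rw [ENNReal.mul_rpow_of_nonneg _ _ hp0.le, ← ENNReal.rpow_mul, one_div_mul_cancel hp0.ne',
          ENNReal.rpow_one]
      simp only [h1]
      rw [lintegral_const_mul' _ _ (by simp), ENNReal.mul_rpow_of_nonneg _ _ (by positivity),
        ENNReal.ofReal_mul (by positivity), ← ENNReal.ofReal_rpow_of_nonneg (by positivity)
        (by positivity), ENNReal.ofReal_natCast]
      gcongr
      rw [eLpNorm_eq_lintegral_rpow_enorm_toReal (by simpa using hp0) ENNReal.ofReal_ne_top,
        ENNReal.toReal_ofReal hp0.le] at hv'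
      exact hv'
  calc _ = ∫⁻ x, ((∑ j, ‖synthesis (v' x) (singularBasis (v' x) j)‖ₑ ^ p) ^ (1 / p)) ^ p ∂μ := by
        refine lintegral_congr fun x => ?_
        rw [← ENNReal.rpow_mul, one_div_mul_cancel hp0.ne', ENNReal.rpow_one]
    _ ≤ ∫⁻ x, ((V + fun x => (d : ℝ≥0∞) ^ (1 / p) * D x) x) ^ p ∂μ :=
        lintegral_mono fun x => ENNReal.rpow_le_rpow (hpt x) hp0.le
    _ = ((∫⁻ x, ((V + fun x => (d : ℝ≥0∞) ^ (1 / p) * D x) x) ^ p ∂μ) ^ (1 / p)) ^ p := by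
        rw [← ENNReal.rpow_mul, one_div_mul_cancel hp0.ne', ENNReal.rpow_one]
    _ ≤ ENNReal.ofReal (F ^ (1 / p) + (d : ℝ) ^ (1 / p) * δ) ^ p :=
        ENNReal.rpow_le_rpow hroot hp0.le
    _ = _ := ENNReal.ofReal_rpow_of_nonneg (by positivity) hp0.le

end Approximation

end Cwikel

namespace Cwikel

/-! ### The count for general `f` on simple functions -/

section SimpleInput

variable {X Y : Type*} [MeasurableSpace X] [MeasurableSpace Y] {μ : Measure X} {ν : Measure Y}
  {H : Type*} [NormedAddCommGroup H] [InnerProductSpace ℂ H] [CompleteSpace H]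
  [TopologicalSpace.SeparableSpace H]
  {G : Type*} [NormedAddCommGroup G] [InnerProductSpace ℂ G] [CompleteSpace G]
  [TopologicalSpace.SeparableSpace G]

theorem MemLpSchatten.lintegral_lt_top {p : ℝ} (hp : 2 < p) {f : X → H →L[ℂ] H}
    (hf : MemLpSchatten p f μ) : ∫⁻ x, eSchattenNorm p (f x) ^ p ∂μ < ∞ := by
  have h := hf.norm_lt_top
  rwa [eLpSchattenNorm, ENNReal.rpow_lt_top_iff_of_pos (by positivity)] at h

theorem MemLpSchatten.memLp_norm {p : ℝ} (hp : 2 < p) {f : X → H →L[ℂ] H}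
    (hf : MemLpSchatten p f μ) : MemLp (fun x => ‖f x‖) (ENNReal.ofReal p) μ := by
  have hp0 : 0 < p := by linarith
  refine ⟨hf.measurable.aemeasurable_norm.aestronglyMeasurable, ?_⟩
  rw [eLpNorm_lt_top_iff_lintegral_rpow_enorm_lt_top (by simpa using hp0) ENNReal.ofReal_ne_top,
    ENNReal.toReal_ofReal hp0.le]
  refine lt_of_le_of_lt (lintegral_mono_ae ?_) (hf.lintegral_lt_top hp)
  filter_upwards [hf.memSchatten] with x hx
  rw [enorm_norm]
  exact ENNReal.rpow_le_rpow (enorm_le_eSchattenNorm hx.1 hp.le) hp0.le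

theorem memLp_of_le_indicator {E : Type*} [NormedAddCommGroup E] {u : X → E} {D : X → ℝ}
    {P q : ℝ≥0∞} (hqP : q ≤ P) {Z : Set X} (hZ : MeasurableSet Z) (hZfin : μ Z < ∞)
    (hD : MemLp D P (μ.restrict Z)) (hu : AEStronglyMeasurable u μ) {C : ℝ}
    (huD : ∀ x, ‖u x‖ ≤ C * ‖Z.indicator D x‖) : MemLp u q μ := by
  have : IsFiniteMeasure (μ.restrict Z) := ⟨by simpa using hZfin⟩
  have h1 : MemLp (Z.indicator D) q μ := (memLp_indicator_iff_restrict hZ).2 (hD.mono_exponent hqP)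
  exact h1.of_le_mul hu (Filter.Eventually.of_forall huD)

theorem two_le_ofReal {p : ℝ} (hp : 2 < p) : (2 : ℝ≥0∞) ≤ ENNReal.ofReal p := by
  rw [← ENNReal.ofReal_ofNat 2]
  exact ENNReal.ofReal_le_ofReal hp.le

theorem MemLpSchatten.memLp_adjoint_simpleFunc {p : ℝ} (hp : 2 < p) {f : X → H →L[ℂ] H}
    (hf : MemLpSchatten p f μ) {η : SimpleFunc X H} (hη : MemLp η 2 μ) {q : ℝ≥0∞} (hq : q ≤ 2) :
    MemLp (fun x => ContinuousLinearMap.adjoint (f x) (η x)) q μ := by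
  obtain ⟨C, hC⟩ := η.exists_forall_norm_le
  refine memLp_of_le_indicator (hq.trans (two_le_ofReal hp)) η.measurableSet_support
    (η.measure_support_lt_top_of_memLp hη two_ne_zero ENNReal.ofNat_ne_top)
    ((hf.memLp_norm hp).restrict _)
    (hf.measurable.adjoint.apply η.aestronglyMeasurable) (C := C) fun x => ?_
  by_cases hx : η x = 0
  · simp [hx]
  · rw [Set.indicator_of_mem (by exact hx), norm_norm, mul_comm]
    refine (ContinuousLinearMap.le_opNorm _ _).trans ?_
    rw [LinearIsometryEquiv.norm_map]
    gcongr
    exact hC x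

/-- The coordinates of a vector with respect to a finite family. -/
def coordinates {d : ℕ} (e : Fin d → H) (h : H) : EuclideanSpace ℂ (Fin d) :=
  WithLp.toLp 2 fun m => inner ℂ (e m) h

theorem norm_coordinates_le {d : ℕ} {e : Fin d → H} (he : Orthonormal ℂ e) (h : H) :
    ‖coordinates e h‖ ≤ ‖h‖ := by
  refine (pow_le_pow_iff_left₀ (norm_nonneg _) (norm_nonneg _) two_ne_zero).1 ?_
  rw [EuclideanSpace.norm_sq_eq]
  exact he.sum_inner_products_le h (s := Finset.univ)

theorem coordinates_sum_smul {d n : ℕ} (e : Fin d → H) (c : Fin n → ℂ) (h : Fin n → H) :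
    coordinates e (∑ i, c i • h i) = ∑ i, c i • coordinates e (h i) := by
  ext m
  simp [coordinates]

/-- All values lie in one finite-dimensional space, so only finitely many vectors `f* (e m)` have to
be approximated. -/
theorem exists_orthonormal_expansion {n : ℕ} (η : Fin n → SimpleFunc X H) :
    ∃ (d : ℕ) (e : Fin d → H), Orthonormal ℂ e ∧
      ∀ i x, synthesis e (coordinates e (η i x)) = η i x := by
  have hfin : (⋃ i, Set.range (η i)).Finite := Set.finite_iUnion fun i => (η i).finite_range
  let U := Submodule.span ℂ (⋃ i, Set.range (η i))
  have : FiniteDimensional ℂ U := FiniteDimensional.span_of_finite ℂ hfin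
  let b := stdOrthonormalBasis ℂ U
  refine ⟨_, fun m => (b m : H), b.orthonormal.comp_linearIsometry U.subtypeₗᵢ, fun i x => ?_⟩
  have hmem : η i x ∈ U := Submodule.subset_span (Set.mem_iUnion.2 ⟨i, x, rfl⟩)
  have h := congrArg (Subtype.val) (b.sum_repr' ⟨η i x, hmem⟩)
  rw [synthesis_apply]
  simpa [coordinates] using h

theorem synthesis_adjoint_eq {A : H →L[ℂ] H} {d : ℕ} (e : Fin d → H)
    (a : EuclideanSpace ℂ (Fin d)) :
    synthesis (fun m => ContinuousLinearMap.adjoint A (e m)) a =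
      ContinuousLinearMap.adjoint A (synthesis e a) := by
  simp [synthesis_apply]

set_option maxHeartbeats 1000000 in
-- The `f* (e m)` are replaced by simple functions on the set `Z` of finite measure, up to `δ` in
-- `L^p`. The error is then small in `L¹` and in `L²`, so `g* Φ` maps it to something small in `L²`,
-- and `δ → 0` in `simple_cwikel` gives the claim.
theorem cwikel_of_simpleFunc {Φ : Lp H 2 μ ≃ₗᵢ[ℂ] Lp G 2 ν} {Φ₁ : Lp H 1 μ →L[ℂ] Lp G ∞ ν}
    (hΦ₁ : ∀ (φ : Lp H 2 μ) (φ₁ : Lp H 1 μ), φ =ᵐ[μ] φ₁ → Φ φ =ᵐ[ν] Φ₁ φ₁)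
    {g : Y → G →L[ℂ] G} (hg : OpMeasurable g ν) {p : ℝ} (hp : 2 < p) {W : ℝ} (hW0 : 0 ≤ W)
    (hW : ∀ t : ℝ, 0 < t → ENNReal.ofReal t ^ p * ν {y | t < ‖g y‖} ≤ ENNReal.ofReal W)
    {f : X → H →L[ℂ] H} (hf : MemLpSchatten p f μ) {F : ℝ} (hF0 : 0 ≤ F)
    (hF : ∫⁻ x, eSchattenNorm p (f x) ^ p ∂μ ≤ ENNReal.ofReal F)
    {N : ℕ} {η : Fin N → SimpleFunc X H} (hη : ∀ i, MemLp (η i) 2 μ)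
    (hcontr : ∀ c : EuclideanSpace ℂ (Fin N),
      ∫⁻ x, ‖∑ i, c i • η i x‖ₑ ^ 2 ∂μ ≤ ENNReal.ofReal (‖c‖ ^ 2))
    {ζ : Fin N → Lp H 2 μ}
    (hζ : ∀ i, ζ i =ᵐ[μ] fun x => ContinuousLinearMap.adjoint (f x) (η i x))
    {τ : Fin N → Lp G 2 ν}
    (hτ : ∀ i, τ i =ᵐ[ν] fun y => ContinuousLinearMap.adjoint (g y) (Φ (ζ i) y))
    {r : ℝ} (hr : 0 < r)
    (hlow : ∀ c : EuclideanSpace ℂ (Fin N), r * ‖c‖ ≤ ‖∑ i, c i • τ i‖) :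
    N * r ^ p ≤ 2 * (p - 2) / (p + 2) * (p / (p - 2)) ^ p * (‖Φ₁‖ ^ 2 * F * W) := by
  have hp0 : 0 < p := by linarith
  have h1P : (1 : ℝ≥0∞) ≤ ENNReal.ofReal p := one_le_two.trans (two_le_ofReal hp)
  obtain ⟨d, e, he, hexp⟩ := exists_orthonormal_expansion η
  obtain ⟨Ξ, hΞ⟩ := exists_simpleFunc_pi η
  obtain ⟨K, hK0, hK⟩ := exists_lintegral_adjoint_apply_le hg hp hW
  set η' : SimpleFunc X (Fin N → EuclideanSpace ℂ (Fin d)) :=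
    Ξ.map fun z i => coordinates e (z i) with hη'
  have hη'x : ∀ x i, η' x i = coordinates e (η i x) := fun x i => by
    rw [hη', SimpleFunc.map_apply, hΞ]
  set Z : Set X := {x | η' x ≠ 0} with hZ
  have hZm : MeasurableSet Z := (η'.measurableSet_fiber 0).compl
  have hZfin : μ Z < ∞ := by
    refine lt_of_le_of_lt (measure_mono (t := ⋃ i, Function.support (η i)) fun x hx => ?_)
      ((measure_iUnion_fintype_le _ _).trans_lt (ENNReal.sum_lt_top.2 fun i _ =>
        (η i).measure_support_lt_top_of_memLp (hη i) two_ne_zero ENNReal.ofNat_ne_top))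
    by_contra h
    simp only [Set.mem_iUnion, Function.mem_support, not_exists, not_not] at h
    apply hx
    funext i
    rw [hη'x, h i]
    ext m
    simp [coordinates]
  have : IsFiniteMeasure (μ.restrict Z) := ⟨by simpa using hZfin⟩
  obtain ⟨C, hC⟩ := η'.exists_forall_norm_le
  set C' := max C 0 with hC'
  have hC'0 : 0 ≤ C' := le_max_right _ _
  have hη'C : ∀ x i, ‖η' x i‖ ≤ C' := fun x i =>
    (norm_le_pi_norm (η' x) i).trans ((hC x).trans (le_max_left _ _))
  have hvm : ∀ m, AEStronglyMeasurable (fun x => ContinuousLinearMap.adjoint (f x) (e m)) μ :=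
    fun m => hf.measurable.adjoint (e m)
  have hv : ∀ m, MemLp (fun x => ContinuousLinearMap.adjoint (f x) (e m)) (ENNReal.ofReal p)
      (μ.restrict Z) := fun m => by
    refine MemLp.restrict _ ((hf.memLp_norm hp).of_le_mul (c := 1) (hvm m)
      (Filter.Eventually.of_forall fun x => ?_))
    refine (ContinuousLinearMap.le_opNorm _ _).trans ?_
    rw [LinearIsometryEquiv.norm_map, he.1 m, norm_norm, mul_one, one_mul]
  -- comparison of the norms on the set `Z` of finite measure
  obtain ⟨K', hK'0, hK'⟩ : ∃ K' : ℝ, 0 ≤ K' ∧ ∀ q : ℝ≥0∞, q = 1 ∨ q = 2 → ∀ D : X → ℝ,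
      AEStronglyMeasurable D (μ.restrict Z) → eLpNorm D q (μ.restrict Z) ≤
        eLpNorm D (ENNReal.ofReal p) (μ.restrict Z) * ENNReal.ofReal K' := by
    set k : ℝ≥0∞ → ℝ≥0∞ := fun q =>
      (μ.restrict Z) Set.univ ^ (1 / q.toReal - 1 / (ENNReal.ofReal p).toReal) with hk
    have hkfin : ∀ q : ℝ≥0∞, q = 1 ∨ q = 2 → k q ≠ ∞ := fun q hq => by
      refine ENNReal.rpow_ne_top_of_nonneg ?_ (measure_ne_top _ _)
      rw [ENNReal.toReal_ofReal hp0.le, sub_nonneg]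
      rcases hq with rfl | rfl
      · rw [ENNReal.toReal_one]
        exact one_div_le_one_div_of_le one_pos (by linarith)
      · rw [ENNReal.toReal_ofNat]
        exact one_div_le_one_div_of_le two_pos hp.le
    refine ⟨(k 1 + k 2).toReal, ENNReal.toReal_nonneg, fun q hq D hD => ?_⟩
    rw [ENNReal.ofReal_toReal
      (ENNReal.add_ne_top.2 ⟨hkfin 1 (Or.inl rfl), hkfin 2 (Or.inr rfl)⟩)]
    rcases hq with rfl | rfl
    · exact (eLpNorm_le_eLpNorm_mul_rpow_measure_univ h1P hD).trans
        (mul_le_mul_right le_self_add _)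
    · exact (eLpNorm_le_eLpNorm_mul_rpow_measure_univ (two_le_ofReal hp) hD).trans
        (mul_le_mul_right le_add_self _)
  -- An approximation error `δ` moves each `τ i` by at most `A * δ`: `C' * K' * δ` bounds both the
  -- `L¹` and the `L²` norm of the error in `f* η`, and the root comes from applying `g* Φ`.
  set A : ℝ := C' * K' * √(1 + ‖Φ₁‖ ^ 2 * K) with hA
  have hvm' : ∀ (v' : SimpleFunc X (Fin d → H)) (m : Fin d) (ρ : Measure X),
      AEStronglyMeasurable (fun x => v' x m) ρ := fun v' m ρ =>
    (v'.map fun z : Fin d → H => z m).aestronglyMeasurable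
  have hstep : ∀ δ : ℝ, 0 < δ → 0 < r - N * (A * δ) →
      N * (r - N * (A * δ)) ^ p ≤ 2 * (p - 2) / (p + 2) * (p / (p - 2)) ^ p *
        (‖Φ₁‖ ^ 2 * (F ^ (1 / p) + (d : ℝ) ^ (1 / p) * δ) ^ p * W) := fun δ hδ hrδ => by
    obtain ⟨v', hv'⟩ := exists_simpleFunc_eLpNorm_sum_le h1P ENNReal.ofReal_ne_top hv hδ
    set D : X → ℝ := fun x => ∑ m, ‖ContinuousLinearMap.adjoint (f x) (e m) - v' x m‖ with hD
    have hDm : AEStronglyMeasurable D (μ.restrict Z) :=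
      Finset.aestronglyMeasurable_fun_sum _ fun m _ =>
        ((hvm m).restrict.sub (hvm' v' m _)).norm
    have hDmem : MemLp D (ENNReal.ofReal p) (μ.restrict Z) :=
      ⟨hDm, hv'.trans_lt ENNReal.ofReal_lt_top⟩
    set Δ : Fin N → X → H := fun i x =>
      ContinuousLinearMap.adjoint (f x) (η i x) - synthesis (v' x) (η' x i) with hΔ
    have hΔm : ∀ i, AEStronglyMeasurable (Δ i) μ := fun i =>
      (hf.measurable.adjoint.apply (η i).aestronglyMeasurable).sub
        (aestronglyMeasurable_synthesis (fun m => hvm' v' m μ) η'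
          fun z => z i)
    have hΔle : ∀ i x, ‖Δ i x‖ ≤ C' * ‖Z.indicator D x‖ := fun i x => by
      have h1 : Δ i x = synthesis (fun m => ContinuousLinearMap.adjoint (f x) (e m)) (η' x i) -
          synthesis (v' x) (η' x i) := by
        rw [synthesis_adjoint_eq, hη'x, hexp]
        simp only [hΔ, hη'x]
      by_cases hx : x ∈ Z
      · rw [Set.indicator_of_mem hx, h1, Real.norm_of_nonneg (by positivity)]
        exact norm_synthesis_sub_le _ _ _ (hη'C x i)
      · have h2 : η' x i = 0 := by
          have : η' x = 0 := not_not.1 hx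
          rw [this]
          rfl
        rw [h1, h2, map_zero, map_zero, sub_zero, norm_zero]
        positivity
    have hΔmem : ∀ i (q : ℝ≥0∞), q ≤ 2 → MemLp (Δ i) q μ := fun i q hq =>
      memLp_of_le_indicator (hq.trans (two_le_ofReal hp)) hZm hZfin hDmem (hΔm i) (hΔle i)
    have hΔnorm : ∀ i (q : ℝ≥0∞), q = 1 ∨ q = 2 →
        (eLpNorm (Δ i) q μ).toReal ≤ C' * K' * δ := fun i q hq => by
      refine ENNReal.toReal_le_of_le_ofReal (by positivity) ?_
      calc eLpNorm (Δ i) q μ ≤ ENNReal.ofReal C' * eLpNorm (Z.indicator D) q μ :=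
            eLpNorm_le_mul_eLpNorm_of_ae_le_mul (Filter.Eventually.of_forall (hΔle i)) q
        _ = ENNReal.ofReal C' * eLpNorm D q (μ.restrict Z) := by
            rw [eLpNorm_indicator_eq_eLpNorm_restrict hZm]
        _ ≤ ENNReal.ofReal C' * (ENNReal.ofReal δ * ENNReal.ofReal K') := by
            gcongr
            exact (hK' q hq D hDm).trans (by gcongr)
        _ = _ := by
            rw [← ENNReal.ofReal_mul hδ.le, ← ENNReal.ofReal_mul (by positivity)]
            congr 1
            ring
    set Δ' : Fin N → Lp H 2 μ := fun i => (hΔmem i 2 le_rfl).toLp with hΔ'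
    set ζ' : Fin N → Lp H 2 μ := fun i => ζ i - Δ' i with hζ'
    have hζ'ae : ∀ i, ζ' i =ᵐ[μ] fun x => synthesis (v' x) (η' x i) := fun i => by
      filter_upwards [Lp.coeFn_sub (ζ i) (Δ' i), hζ i, (hΔmem i 2 le_rfl).coeFn_toLp]
        with x h1 h2 h3
      have h4 : Δ' i x = Δ i x := h3
      rw [hζ', h1, Pi.sub_apply, h2, h4, hΔ, sub_sub_cancel]
    have hΔ'1 : ∀ i, MemLp (Δ' i) 1 μ := fun i =>
      (memLp_congr_ae (hΔmem i 2 le_rfl).coeFn_toLp).2 (hΔmem i 1 one_le_two)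
    have hζ'1 : ∀ i, MemLp (ζ' i) 1 μ := fun i => by
      have h1 : MemLp (ζ i) 1 μ :=
        (memLp_congr_ae (hζ i)).2 (hf.memLp_adjoint_simpleFunc hp (hη i) one_le_two)
      exact (memLp_congr_ae (Lp.coeFn_sub (ζ i) (Δ' i))).2 (h1.sub (hΔ'1 i))
    have hmem := fun i => memLp_adjoint_apply hg hp hW (by positivity)
      (ae_norm_le_of_memLp_one hΦ₁ (hζ'1 i))
    set τ' : Fin N → Lp G 2 ν := fun i => (hmem i).toLp with hτ'
    have hτdiff : ∀ i, ‖τ i - τ' i‖ ≤ A * δ := fun i => by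
      have hae : (τ i - τ' i : Lp G 2 ν) =ᵐ[ν]
          fun y => ContinuousLinearMap.adjoint (g y) (Φ (Δ' i) y) := by
        have hΦ : Φ (Δ' i) = Φ (ζ i) - Φ (ζ' i) := by
          rw [← map_sub, hζ', sub_sub_cancel]
        filter_upwards [Lp.coeFn_sub (τ i) (τ' i), hτ i, (hmem i).coeFn_toLp,
          Lp.coeFn_sub (Φ (ζ i)) (Φ (ζ' i))] with y h1 h2 h3 h4
        have h5 : τ' i y = ContinuousLinearMap.adjoint (g y) (Φ (ζ' i) y) := h3
        rw [h1, Pi.sub_apply, h2, h5, hΦ, h4, Pi.sub_apply,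
          (ContinuousLinearMap.adjoint (g y)).map_sub]
      have hB : 0 ≤ ‖Φ₁‖ * (eLpNorm (Δ' i) 1 μ).toReal := by positivity
      have h1 := hK (Φ (Δ' i)) _ hB (ae_norm_le_of_memLp_one hΦ₁ (hΔ'1 i))
      have h2 : ‖τ i - τ' i‖ ^ 2 ≤
          ‖Φ (Δ' i)‖ ^ 2 + (‖Φ₁‖ * (eLpNorm (Δ' i) 1 μ).toReal) ^ 2 * K := by
        refine Lp_norm_sq_le (by positivity) (le_trans (le_of_eq (lintegral_congr_ae ?_)) h1)
        filter_upwards [hae] with y hy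
        rw [hy]
      have h3 : ‖Φ (Δ' i)‖ ≤ C' * K' * δ := by
        rw [LinearIsometryEquiv.norm_map, hΔ', Lp.norm_toLp]
        exact hΔnorm i 2 (Or.inr rfl)
      have h4 : (eLpNorm (Δ' i) 1 μ).toReal ≤ C' * K' * δ := by
        rw [eLpNorm_congr_ae (hΔmem i 2 le_rfl).coeFn_toLp]
        exact hΔnorm i 1 (Or.inl rfl)
      refine (pow_le_pow_iff_left₀ (norm_nonneg _) (by positivity) two_ne_zero).1 (h2.trans ?_)
      calc _ ≤ (C' * K' * δ) ^ 2 + (‖Φ₁‖ * (C' * K' * δ)) ^ 2 * K := by gcongr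
        _ = (C' * K' * δ) ^ 2 * (1 + ‖Φ₁‖ ^ 2 * K) := by ring
        _ = (A * δ) ^ 2 := by
            rw [hA, mul_right_comm _ (√_), mul_pow (C' * K' * δ), Real.sq_sqrt (by positivity)]
    have hlow' : ∀ c : EuclideanSpace ℂ (Fin N),
        (r - N * (A * δ)) * ‖c‖ ≤ ‖∑ i, c i • τ' i‖ := fun c => by
      have h1 : ∑ i, c i • τ i = ∑ i, c i • τ' i + ∑ i, c i • (τ i - τ' i) := by
        rw [← Finset.sum_add_distrib]
        refine Finset.sum_congr rfl fun i _ => ?_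
        rw [← smul_add, add_sub_cancel]
      have h2 : ‖∑ i, c i • (τ i - τ' i)‖ ≤ N * (A * δ) * ‖c‖ := by
        calc _ ≤ ∑ _i : Fin N, ‖c‖ * (A * δ) := by
              refine norm_sum_le_of_le _ fun i _ => ?_
              rw [norm_smul]
              gcongr
              · exact PiLp.norm_apply_le c i
              · exact hτdiff i
          _ = _ := by
              rw [Finset.sum_const, Finset.card_univ, Fintype.card_fin, nsmul_eq_mul]
              ring
      have h3 := hlow c
      rw [h1] at h3
      have h4 := h3.trans (norm_add_le _ _)
      linarith
    refine simple_cwikel hΦ₁ hg hp hW0 hW η' hZfin v' (fun c => ?_) hζ'ae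
      (fun i => (hmem i).coeFn_toLp) hrδ hlow' (by positivity) ?_
    · refine le_trans (lintegral_mono fun x => ?_) (hcontr c)
      simp only [hη'x]
      rw [← coordinates_sum_smul, ← ofReal_norm, ← ofReal_norm]
      gcongr
      exact norm_coordinates_le he _
    · refine lintegral_sum_synthesis_le hp (ae_restrict_of_ae (hf.memSchatten.mono fun x h => h.1))
        he (fun m => (hvm m).restrict) hF0 ((setLIntegral_le_lintegral _ _).trans hF) v' hδ.le hv'
  have hlim1 : Filter.Tendsto (fun δ : ℝ => (N : ℝ) * (r - N * (A * δ)) ^ p)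
      (nhdsWithin 0 (Set.Ioi 0)) (nhds (N * r ^ p)) := by
    have h : Continuous fun δ : ℝ => (N : ℝ) * (r - N * (A * δ)) ^ p :=
      continuous_const.mul (Continuous.rpow_const (by fun_prop) fun _ => Or.inr hp0.le)
    have := h.tendsto 0
    simp only [mul_zero, sub_zero] at this
    exact this.mono_left nhdsWithin_le_nhds
  have hlim2 : Filter.Tendsto (fun δ : ℝ => 2 * (p - 2) / (p + 2) * (p / (p - 2)) ^ p *
        (‖Φ₁‖ ^ 2 * (F ^ (1 / p) + (d : ℝ) ^ (1 / p) * δ) ^ p * W))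
      (nhdsWithin 0 (Set.Ioi 0))
      (nhds (2 * (p - 2) / (p + 2) * (p / (p - 2)) ^ p * (‖Φ₁‖ ^ 2 * F * W))) := by
    have h0 : Continuous fun δ : ℝ => (F ^ (1 / p) + (d : ℝ) ^ (1 / p) * δ) ^ p :=
      Continuous.rpow_const (by fun_prop) fun _ => Or.inr hp0.le
    have h : Continuous fun δ : ℝ => 2 * (p - 2) / (p + 2) * (p / (p - 2)) ^ p *
        (‖Φ₁‖ ^ 2 * (F ^ (1 / p) + (d : ℝ) ^ (1 / p) * δ) ^ p * W) :=
      continuous_const.mul ((continuous_const.mul h0).mul continuous_const)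
    have := h.tendsto 0
    simp only [mul_zero, add_zero] at this
    rw [← Real.rpow_mul hF0, one_div_mul_cancel hp0.ne', Real.rpow_one] at this
    exact this.mono_left nhdsWithin_le_nhds
  refine le_of_tendsto_of_tendsto hlim1 hlim2 ?_
  have hpos : ∀ᶠ δ in nhdsWithin (0 : ℝ) (Set.Ioi 0), 0 < r - N * (A * δ) := by
    have h : Continuous fun δ : ℝ => r - N * (A * δ) := by fun_prop
    have h1 := h.tendsto 0
    simp only [mul_zero, sub_zero] at h1
    exact (h1.mono_left nhdsWithin_le_nhds).eventually_const_lt hr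
  filter_upwards [hpos, self_mem_nhdsWithin] with δ h1 h2 using hstep δ h2 h1

end SimpleInput

end Cwikel

namespace Cwikel

open ContinuousLinearMap

/-! ### From the count to singular values and compactness -/

section Counting

variable {E F : Type*}
  [NormedAddCommGroup E] [InnerProductSpace ℂ E] [CompleteSpace E]
  [NormedAddCommGroup F] [InnerProductSpace ℂ F] [CompleteSpace F]

theorem norm_sum_smul_le {n : ℕ} (c : EuclideanSpace ℂ (Fin n)) {v : Fin n → F} {δ : ℝ}
    (hv : ∀ i, ‖v i‖ ≤ δ) : ‖∑ i, c i • v i‖ ≤ n * δ * ‖c‖ := by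
  calc _ ≤ ∑ _i : Fin n, ‖c‖ * δ := by
        refine norm_sum_le_of_le _ fun i _ => ?_
        rw [norm_smul]
        gcongr
        · exact PiLp.norm_apply_le c i
        · exact hv i
    _ = _ := by
        rw [Finset.sum_const, Finset.card_univ, Fintype.card_fin, nsmul_eq_mul]
        ring

theorem norm_sum_smul_of_orthonormal {n : ℕ} {w : Fin n → F} (hw : Orthonormal ℂ w)
    (c : EuclideanSpace ℂ (Fin n)) : ‖∑ i, c i • w i‖ = ‖c‖ := by
  refine (pow_left_inj₀ (norm_nonneg _) (norm_nonneg _) two_ne_zero).1 ?_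
  rw [EuclideanSpace.norm_sq_eq]
  have h : ((‖∑ i, c i • w i‖ ^ 2 : ℝ) : ℂ) = ((∑ i, ‖c i‖ ^ 2 : ℝ) : ℂ) := by
    rw [ofReal_norm_sq, hw.inner_sum, Complex.ofReal_sum]
    refine Finset.sum_congr rfl fun i _ => ?_
    rw [Complex.conj_mul', Complex.ofReal_pow]
  exact_mod_cast h

theorem norm_sum_smul_ofReal_smul {n : ℕ} {a : ℝ} (ha : 0 ≤ a) (c : EuclideanSpace ℂ (Fin n))
    (v : Fin n → F) : ‖∑ i, c i • (a : ℂ) • v i‖ = a * ‖∑ i, c i • v i‖ := by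
  simp_rw [smul_comm (c _)]
  rw [← Finset.smul_sum, norm_smul, Complex.norm_real, Real.norm_of_nonneg ha]

/-- A bound on the number of contractive families in a dense set on which `B` is bounded from
below passes to orthonormal families. -/
theorem count_orthonormal_of_dense {B : F →L[ℂ] E} {p C : ℝ} (hp : 0 < p) {D : Set F}
    (hD : Dense D) (hsmul : ∀ (c : ℂ), ∀ η ∈ D, c • η ∈ D)
    (h : ∀ (n : ℕ) (η : Fin n → F), (∀ i, η i ∈ D) →
      (∀ c : EuclideanSpace ℂ (Fin n), ‖∑ i, c i • η i‖ ≤ ‖c‖) → ∀ r : ℝ, 0 < r →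
      (∀ c : EuclideanSpace ℂ (Fin n), r * ‖c‖ ≤ ‖∑ i, c i • B (η i)‖) → n * r ^ p ≤ C)
    {n : ℕ} {w : Fin n → F} (hw : Orthonormal ℂ w) {r : ℝ} (hr : 0 < r)
    (hlow : ∀ c : EuclideanSpace ℂ (Fin n), r * ‖c‖ ≤ ‖∑ i, c i • B (w i)‖) :
    n * r ^ p ≤ C := by
  -- Moving each `w i` by at most `δ` increases the norm of the family to at most `1 + n * δ`.
  -- Dividing by this restores contractivity, and `ρ δ` is the resulting lower bound.
  set ρ : ℝ → ℝ := fun δ => (1 + n * δ)⁻¹ * (r - n * (‖B‖ * δ)) with hρ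
  have hstep : ∀ δ : ℝ, 0 < δ → 0 < r - n * (‖B‖ * δ) → n * ρ δ ^ p ≤ C := fun δ hδ hrδ => by
    choose σ hσD hσ using fun i => Metric.dense_iff.1 hD (w i) δ hδ
    have hdiff : ∀ i, ‖σ i - w i‖ ≤ δ := fun i => by
      have := hσD i
      rw [Metric.mem_ball, dist_eq_norm] at this
      exact this.le
    have hpos : 0 < 1 + n * δ := by positivity
    refine h n (fun i => (((1 + n * δ)⁻¹ : ℝ) : ℂ) • σ i) (fun i => hsmul _ _ (hσ i)) (fun c => ?_)
      (ρ δ) (by positivity) fun c => ?_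
    · rw [norm_sum_smul_ofReal_smul (by positivity), inv_mul_le_iff₀ hpos]
      have h1 : ∑ i, c i • σ i = ∑ i, c i • w i + ∑ i, c i • (σ i - w i) := by
        rw [← Finset.sum_add_distrib]
        exact Finset.sum_congr rfl fun i _ => by rw [← smul_add, add_sub_cancel]
      rw [h1]
      refine (norm_add_le _ _).trans ?_
      rw [norm_sum_smul_of_orthonormal hw]
      linarith [norm_sum_smul_le c hdiff]
    · simp_rw [map_smul]
      rw [norm_sum_smul_ofReal_smul (by positivity), hρ, mul_assoc]
      refine mul_le_mul_of_nonneg_left ?_ (by positivity)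
      have h1 : ∑ i, c i • B (w i) = ∑ i, c i • B (σ i) - ∑ i, c i • B (σ i - w i) := by
        rw [← Finset.sum_sub_distrib]
        exact Finset.sum_congr rfl fun i _ => by rw [← smul_sub, map_sub, sub_sub_cancel]
      have h2 := hlow c
      rw [h1] at h2
      have h3 := h2.trans (norm_sub_le _ _)
      have h4 : ‖∑ i, c i • B (σ i - w i)‖ ≤ n * (‖B‖ * δ) * ‖c‖ :=
        norm_sum_smul_le c fun i => (B.le_opNorm _).trans (by gcongr; exact hdiff i)
      linarith
  have hc : ContinuousAt ρ 0 := by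
    refine ContinuousAt.mul (ContinuousAt.inv₀ (by fun_prop) (by simp)) (by fun_prop)
  have hρ0 : ρ 0 = r := by simp [hρ]
  have hlim : Filter.Tendsto (fun δ => (n : ℝ) * ρ δ ^ p) (nhdsWithin 0 (Set.Ioi 0))
      (nhds (n * r ^ p)) := by
    have h1 := (hc.rpow_const (p := p) (Or.inr hp.le)).const_mul (n : ℝ)
    have h2 := h1.tendsto
    rw [hρ0] at h2
    exact h2.mono_left nhdsWithin_le_nhds
  have hpos : ∀ᶠ δ in nhdsWithin (0 : ℝ) (Set.Ioi 0), 0 < r - n * (‖B‖ * δ) := by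
    have h : Continuous fun δ : ℝ => r - n * (‖B‖ * δ) := by fun_prop
    have h1 := h.tendsto 0
    simp only [mul_zero, sub_zero] at h1
    exact (h1.mono_left nhdsWithin_le_nhds).eventually_const_lt hr
  refine le_of_tendsto hlim ?_
  filter_upwards [hpos, self_mem_nhdsWithin] with δ h1 h2 using hstep δ h2 h1

theorem finrank_mul_rpow_le_of_orthonormal {B : F →L[ℂ] E} {p C : ℝ}
    (h : ∀ (n : ℕ) (w : Fin n → F), Orthonormal ℂ w → ∀ r : ℝ, 0 < r →
      (∀ c : EuclideanSpace ℂ (Fin n), r * ‖c‖ ≤ ‖∑ i, c i • B (w i)‖) → n * r ^ p ≤ C)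
    (V : Submodule ℂ F) [FiniteDimensional ℂ V] {r : ℝ} (hr : 0 < r)
    (hV : ∀ w ∈ V, r * ‖w‖ ≤ ‖B w‖) : Module.finrank ℂ V * r ^ p ≤ C := by
  have hb := (stdOrthonormalBasis ℂ V).orthonormal.comp_linearIsometry V.subtypeₗᵢ
  refine h _ _ hb r hr fun c => ?_
  rw [← norm_sum_smul_of_orthonormal hb c]
  simp_rw [← map_smul]
  rw [← map_sum]
  exact hV _ (V.sum_mem fun i _ => V.smul_mem _ (Subtype.mem _))

/-- For `t` below the singular value, `A` is injective on `eigenspacesAbove A t`, and the image of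
an `(n + 1)`-dimensional subspace is a space on which `A*` is bounded below by `t`. Then `t` tends
to the singular value. -/
theorem mul_singularValue_rpow_le {A : E →L[ℂ] F} {p C : ℝ} (hp : 0 < p)
    (h : ∀ (V : Submodule ℂ F) [FiniteDimensional ℂ V] (r : ℝ), 0 < r →
      (∀ w ∈ V, r * ‖w‖ ≤ ‖adjoint A w‖) → Module.finrank ℂ V * r ^ p ≤ C) (n : ℕ) :
    ((n + 1 : ℕ) : ℝ) * singularValue A n ^ p ≤ C := by
  rcases (singularValue_nonneg A n).eq_or_lt with h0 | h0
  -- The trivial subspace yields `0 ≤ C`.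
  · have := h ⊥ 1 one_pos (by simp)
    rw [← h0, Real.zero_rpow hp.ne']
    simpa using this
  have hstep : ∀ t, 0 < t → t < singularValue A n → ((n + 1 : ℕ) : ℝ) * t ^ p ≤ C := by
    intro t ht hts
    have h1 : ((n + 1 : ℕ) : Cardinal) ≤ Module.rank ℂ (eigenspacesAbove A t) := by
      rw [Nat.cast_add_one]
      exact Cardinal.add_one_le_of_lt (lt_rank_of_lt_singularValue ht.le hts)
    obtain ⟨e, he⟩ := Module.le_rank_iff_exists_linearMap.1 h1
    set T : (Fin (n + 1) → ℂ) →ₗ[ℂ] F :=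
      (A : E →ₗ[ℂ] F) ∘ₗ (eigenspacesAbove A t).subtype ∘ₗ e with hT
    have hTi : Function.Injective T := by
      rw [injective_iff_map_eq_zero]
      intro x hx
      have h2 := eq_zero_of_mem_eigenspacesAbove ht.le (e x).2 hx
      exact (injective_iff_map_eq_zero e).1 he x (Subtype.ext h2)
    have h3 := h (LinearMap.range T) t ht (by
      rintro _ ⟨x, rfl⟩
      exact le_norm_adjoint_apply ht.le (e x).2)
    rwa [LinearMap.finrank_range_of_inj hTi, Module.finrank_fin_fun] at h3
  have hlim : Filter.Tendsto (fun t : ℝ => ((n + 1 : ℕ) : ℝ) * t ^ p)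
      (nhdsWithin (singularValue A n) (Set.Iio (singularValue A n)))
      (nhds (((n + 1 : ℕ) : ℝ) * singularValue A n ^ p)) := by
    have h1 : Continuous fun t : ℝ => ((n + 1 : ℕ) : ℝ) * t ^ p :=
      continuous_const.mul (Real.continuous_rpow_const hp.le)
    exact (h1.tendsto _).mono_left nhdsWithin_le_nhds
  refine le_of_tendsto hlim ?_
  filter_upwards [Ioo_mem_nhdsLT h0] with t ht using hstep t ht.1 ht.2

/-- If the dimension of the subspaces on which `A*` is bounded from below by `ε` is bounded, then
`A` is within `ε` of an operator of finite rank. -/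
theorem exists_finiteDimensional_norm_sub_le {A : E →L[ℂ] F} {ε : ℝ} (hε : 0 ≤ ε) {M : ℕ}
    (h : ∀ (V : Submodule ℂ F) [FiniteDimensional ℂ V],
      (∀ w ∈ V, ε * ‖w‖ ≤ ‖adjoint A w‖) → Module.finrank ℂ V ≤ M) :
    ∃ (K : Submodule ℂ F) (_ : FiniteDimensional ℂ K), ‖A - K.starProjection ∘L A‖ ≤ ε := by
  classical
  set P : ℕ → Prop := fun k => ∃ (V : Submodule ℂ F) (_ : FiniteDimensional ℂ V),
    (∀ w ∈ V, ε * ‖w‖ ≤ ‖adjoint A w‖) ∧ Module.finrank ℂ V = k with hP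
  have hP0 : P 0 := ⟨⊥, inferInstance, by simp, by simp⟩
  -- A space `V` of maximal dimension on which the form `‖A* w‖ ^ 2 - ε ^ 2 * ‖w‖ ^ 2` is
  -- nonnegative.
  obtain ⟨V, hfin, hV, hk⟩ : P (Nat.findGreatest P M) := Nat.findGreatest_spec (Nat.zero_le M) hP0
  have hmax : ∀ (V' : Submodule ℂ F) [FiniteDimensional ℂ V'],
      (∀ w ∈ V', ε * ‖w‖ ≤ ‖adjoint A w‖) → Module.finrank ℂ V' ≤ Module.finrank ℂ V := by
    intro V' _ hV'
    rw [hk]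
    exact Nat.le_findGreatest (h V' hV') ⟨V', inferInstance, hV', rfl⟩
  set T : F →ₗ[ℂ] F := ((A ∘L adjoint A : F →L[ℂ] F) : F →ₗ[ℂ] F) - ((ε ^ 2 : ℝ) : ℂ) • LinearMap.id
    with hT
  have hTinner : ∀ w v, inner ℂ (T w) v =
      inner ℂ (adjoint A w) (adjoint A v) - (ε ^ 2 : ℝ) * inner ℂ w v := by
    intro w v
    rw [hT, LinearMap.sub_apply, inner_sub_left, LinearMap.smul_apply, inner_smul_left,
      adjoint_inner_right]
    simp
  -- Vectors orthogonal to `T V` are those orthogonal to `V` for the form of `T = A A* - ε ^ 2`. If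
  -- the form were positive at such a `v`, it would be nonnegative on `V ⊔ span {v}`, contradicting
  -- maximality.
  refine ⟨V.map T, inferInstance, ?_⟩
  have hsmall : ∀ v ∈ (V.map T)ᗮ, ‖adjoint A v‖ ≤ ε * ‖v‖ := by
    intro v hv
    by_contra! hlt
    have horth : ∀ w ∈ V, inner ℂ (adjoint A w) (adjoint A v) = (ε ^ 2 : ℝ) * inner ℂ w v := by
      intro w hw
      have h1 := (Submodule.mem_orthogonal _ _).1 hv (T w) (Submodule.mem_map_of_mem hw)
      rw [hTinner, sub_eq_zero] at h1
      exact h1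
    have hvV : v ∉ V := by
      intro hmem
      have h1 := horth v hmem
      rw [← ofReal_norm_sq, ← ofReal_norm_sq, ← Complex.ofReal_mul, Complex.ofReal_inj,
        ← mul_pow] at h1
      exact (pow_lt_pow_left₀ hlt (by positivity) two_ne_zero).ne' h1
    have hbig := hmax (V ⊔ Submodule.span ℂ {v}) (by
      intro z hz
      obtain ⟨w, hw, y, hy, rfl⟩ := Submodule.mem_sup.1 hz
      obtain ⟨c, rfl⟩ := Submodule.mem_span_singleton.1 hy
      refine (pow_le_pow_iff_left₀ (by positivity) (norm_nonneg _) two_ne_zero).1 ?_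
      have h1 : RCLike.re (inner ℂ (adjoint A w) (adjoint A (c • v))) =
          ε ^ 2 * RCLike.re (inner ℂ w (c • v)) := by
        rw [map_smul, inner_smul_right, horth w hw, inner_smul_right, mul_left_comm]
        exact RCLike.re_ofReal_mul _ _
      have h2 : (ε * ‖w‖) ^ 2 ≤ ‖adjoint A w‖ ^ 2 := pow_le_pow_left₀ (by positivity) (hV w hw) 2
      have h3 : (ε * ‖c • v‖) ^ 2 ≤ ‖adjoint A (c • v)‖ ^ 2 := by
        refine pow_le_pow_left₀ (by positivity) ?_ 2
        rw [map_smul, norm_smul, norm_smul, mul_left_comm]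
        gcongr
      rw [mul_pow, map_add, norm_add_sq (𝕜 := ℂ), norm_add_sq (𝕜 := ℂ), h1]
      rw [mul_pow] at h2 h3
      linarith)
    have h4 : Module.finrank ℂ (Submodule.span ℂ {v}) = 1 := finrank_span_singleton (by
      rintro rfl
      exact hvV V.zero_mem)
    have h5 := Submodule.finrank_sup_add_finrank_inf_eq V (Submodule.span ℂ {v})
    have h6 : V ⊓ Submodule.span ℂ {v} = ⊥ := by
      rw [← disjoint_iff]
      exact (Submodule.disjoint_span_singleton' (by rintro rfl; exact hvV V.zero_mem)).2 hvV
    rw [h6, finrank_bot, h4] at h5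
    omega
  refine ContinuousLinearMap.opNorm_le_bound _ hε fun x => ?_
  set z := A x - (V.map T).starProjection (A x) with hz
  have hzK : z ∈ (V.map T)ᗮ := Submodule.sub_starProjection_mem_orthogonal _
  have h1 : ((‖z‖ ^ 2 : ℝ) : ℂ) = inner ℂ x (adjoint A z) := by
    rw [adjoint_inner_right, ofReal_norm_sq]
    nth_rewrite 1 [hz]
    rw [inner_sub_left, (Submodule.mem_orthogonal _ _).1 hzK _
      (Submodule.starProjection_apply_mem _ _), sub_zero]
  have h2 : ‖z‖ ^ 2 ≤ ‖x‖ * (ε * ‖z‖) := by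
    calc ‖z‖ ^ 2 = ‖((‖z‖ ^ 2 : ℝ) : ℂ)‖ := by
          rw [Complex.norm_real, Real.norm_of_nonneg (by positivity)]
      _ ≤ ‖x‖ * ‖adjoint A z‖ := by
          rw [h1]
          exact norm_inner_le_norm _ _
      _ ≤ _ := by
          gcongr
          exact hsmall z hzK
  change ‖z‖ ≤ _
  rcases (norm_nonneg z).eq_or_lt with h0 | h0
  · rw [← h0]
    positivity
  · nlinarith

theorem isCompactOperator_of_finrank_le {A : E →L[ℂ] F}
    (h : ∀ ε : ℝ, 0 < ε → ∃ M : ℕ, ∀ (V : Submodule ℂ F) [FiniteDimensional ℂ V],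
      (∀ w ∈ V, ε * ‖w‖ ≤ ‖adjoint A w‖) → Module.finrank ℂ V ≤ M) :
    IsCompactOperator A := by
  refine isClosed_setOfPred_isCompactOperator.closure_subset (Metric.mem_closure_iff.2 ?_ :
    A ∈ closure {T : E →L[ℂ] F | IsCompactOperator T})
  intro ε hε
  obtain ⟨M, hM⟩ := h (ε / 2) (by positivity)
  obtain ⟨K, hK, hle⟩ := exists_finiteDimensional_norm_sub_le (by positivity) hM
  refine ⟨K.starProjection ∘L A, ?_, ?_⟩
  · have : ProperSpace K := FiniteDimensional.proper ℂ K
    have h1 : IsCompactOperator (K.orthogonalProjectionOnto ∘L A) :=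
      isCompactOperator_of_locallyCompactSpace_dom _
    exact h1.clm_comp K.subtypeL
  · rw [dist_eq_norm]
    linarith

theorem isCompactOperator_of_finrank_mul_rpow_le {A : E →L[ℂ] F} {p C : ℝ}
    (h : ∀ (V : Submodule ℂ F) [FiniteDimensional ℂ V] (r : ℝ), 0 < r →
      (∀ w ∈ V, r * ‖w‖ ≤ ‖adjoint A w‖) → Module.finrank ℂ V * r ^ p ≤ C) :
    IsCompactOperator A := by
  refine isCompactOperator_of_finrank_le fun ε hε => ?_
  obtain ⟨M, hM⟩ := exists_nat_ge (C / ε ^ p)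
  refine ⟨M, fun V _ hV => ?_⟩
  have h1 := (le_div_iff₀ (Real.rpow_pos_of_pos hε p)).2 (h V ε hε hV)
  exact_mod_cast h1.trans hM

end Counting

end Cwikel

namespace Cwikel

/-! ### The natural domain and boundedness by duality -/

section NaturalDomain

theorem mem_pmapComp_domain {E F G : Type*} [AddCommGroup E] [Module ℂ E] [AddCommGroup F]
    [Module ℂ F] [AddCommGroup G] [Module ℂ G] {S : F →ₗ.[ℂ] G} {T : E →ₗ.[ℂ] F} {x : E} :
    x ∈ (pmapComp S T).domain ↔ ∃ hx : x ∈ T.domain, T ⟨x, hx⟩ ∈ S.domain := by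
  constructor
  · rintro ⟨⟨y, hy, rfl⟩, hx⟩
    exact ⟨hx, hy⟩
  · rintro ⟨hx, h⟩
    exact ⟨⟨⟨x, hx⟩, h, rfl⟩, hx⟩

variable {X Y : Type*} [MeasurableSpace X] [MeasurableSpace Y] {μ : Measure X} {ν : Measure Y}
  {H : Type*} [NormedAddCommGroup H] [InnerProductSpace ℂ H] [CompleteSpace H]
  {G : Type*} [NormedAddCommGroup G] [InnerProductSpace ℂ G] [CompleteSpace G]

theorem mem_sandwich_domain {f : X → H →L[ℂ] H} {Φ : Lp H 2 μ →L[ℂ] Lp G 2 ν}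
    {g : Y → G →L[ℂ] G} {ψ : Lp G 2 ν} :
    ψ ∈ (sandwich μ ν f Φ g).domain ↔ ∃ h : MemLp (fun y => g y (ψ y)) 2 ν,
      MemLp (fun x => f x (ContinuousLinearMap.adjoint Φ h.toLp x)) 2 μ :=
  mem_pmapComp_domain

theorem exists_sandwich_apply {f : X → H →L[ℂ] H} {Φ : Lp H 2 μ →L[ℂ] Lp G 2 ν}
    {g : Y → G →L[ℂ] G} (ψ : (sandwich μ ν f Φ g).domain) :
    ∃ θ : Lp G 2 ν, θ =ᵐ[ν] (fun y => g y ((ψ : Lp G 2 ν) y)) ∧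
      sandwich μ ν f Φ g ψ =ᵐ[μ] fun x => f x (ContinuousLinearMap.adjoint Φ θ x) := by
  obtain ⟨h1, h2⟩ := mem_sandwich_domain.1 ψ.2
  exact ⟨h1.toLp, h1.coeFn_toLp, h2.coeFn_toLp⟩

/-- `τ = g* Φ f* η`, where `f* η` is square-integrable. -/
def IsDualImage (f : X → H →L[ℂ] H) (Φ : Lp H 2 μ → Lp G 2 ν) (g : Y → G →L[ℂ] G)
    (η : Lp H 2 μ) (τ : Lp G 2 ν) : Prop :=
  ∃ ζ : Lp H 2 μ, ζ =ᵐ[μ] (fun x => ContinuousLinearMap.adjoint (f x) (η x)) ∧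
    τ =ᵐ[ν] fun y => ContinuousLinearMap.adjoint (g y) (Φ ζ y)

theorem IsDualImage.smul {f : X → H →L[ℂ] H} {Φ : Lp H 2 μ →L[ℂ] Lp G 2 ν}
    {g : Y → G →L[ℂ] G} {η : Lp H 2 μ} {τ : Lp G 2 ν} (h : IsDualImage f Φ g η τ) (c : ℂ) :
    IsDualImage f Φ g (c • η) (c • τ) := by
  obtain ⟨ζ, h1, h2⟩ := h
  refine ⟨c • ζ, ?_, ?_⟩
  · filter_upwards [Lp.coeFn_smul c ζ, Lp.coeFn_smul c η, h1] with x h3 h4 h5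
    rw [h3, h4, Pi.smul_apply, Pi.smul_apply, h5, map_smul]
  · have h6 : Φ (c • ζ) = c • Φ ζ := map_smul Φ c ζ
    filter_upwards [Lp.coeFn_smul c (Φ ζ), Lp.coeFn_smul c τ, h2] with y h3 h4 h5
    rw [h4, h6, h3, Pi.smul_apply, Pi.smul_apply, h5, map_smul]

/-- The factors `f` and `g` are moved across pointwise under the integral, `Φ*` in `L²`. Every
intermediate function is in `L²`, by the natural domain on one side and by `IsDualImage` on the
other. -/
theorem inner_sandwich_apply {f : X → H →L[ℂ] H} {Φ : Lp H 2 μ →L[ℂ] Lp G 2 ν}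
    {g : Y → G →L[ℂ] G} (ψ : (sandwich μ ν f Φ g).domain) {η : Lp H 2 μ} {τ : Lp G 2 ν}
    (h : IsDualImage f Φ g η τ) :
    inner ℂ (sandwich μ ν f Φ g ψ) η = inner ℂ (ψ : Lp G 2 ν) τ := by
  obtain ⟨θ, hθ, hS⟩ := exists_sandwich_apply ψ
  obtain ⟨ζ, hζ, hτ⟩ := h
  calc inner ℂ (sandwich μ ν f Φ g ψ) η = inner ℂ (ContinuousLinearMap.adjoint Φ θ) ζ := by
        rw [L2.inner_def, L2.inner_def]
        refine integral_congr_ae ?_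
        filter_upwards [hS, hζ] with x h1 h2
        rw [h1, h2, ContinuousLinearMap.adjoint_inner_right]
    _ = inner ℂ θ (Φ ζ) := ContinuousLinearMap.adjoint_inner_left _ _ _
    _ = _ := by
        rw [L2.inner_def, L2.inner_def]
        refine integral_congr_ae ?_
        filter_upwards [hθ, hτ] with x h1 h2
        rw [h1, h2, ContinuousLinearMap.adjoint_inner_right]

/-- The classes in `L²` of the simple functions. -/
def simpleVectors (H : Type*) [NormedAddCommGroup H] (μ : Measure X) : Set (Lp H 2 μ) :=
  {η | ∃ σ : SimpleFunc X H, η =ᵐ[μ] σ}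

theorem dense_simpleVectors : Dense (simpleVectors H μ) := by
  refine (Lp.simpleFunc.dense (E := H) (p := 2) (μ := μ) ENNReal.ofNat_ne_top).mono
    fun η hη => ?_
  exact ⟨Lp.simpleFunc.toSimpleFunc ⟨η, hη⟩,
    (Lp.simpleFunc.toSimpleFunc_eq_toFun (⟨η, hη⟩ : Lp.simpleFunc H 2 μ)).symm⟩

theorem smul_mem_simpleVectors (c : ℂ) {η : Lp H 2 μ} (hη : η ∈ simpleVectors H μ) :
    c • η ∈ simpleVectors H μ := by
  obtain ⟨σ, hσ⟩ := hη
  refine ⟨c • σ, ?_⟩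
  filter_upwards [Lp.coeFn_smul c η, hσ] with x h1 h2
  rw [h1, Pi.smul_apply, h2, SimpleFunc.smul_apply]

variable [TopologicalSpace.SeparableSpace H] [TopologicalSpace.SeparableSpace G]
  {Φ : Lp H 2 μ ≃ₗᵢ[ℂ] Lp G 2 ν} {Φ₁ : Lp H 1 μ →L[ℂ] Lp G ∞ ν}

theorem exists_isDualImage
    (hΦ₁ : ∀ (φ : Lp H 2 μ) (φ₁ : Lp H 1 μ), φ =ᵐ[μ] φ₁ → Φ φ =ᵐ[ν] Φ₁ φ₁)
    {g : Y → G →L[ℂ] G} (hg : OpMeasurable g ν) {p : ℝ} (hp : 2 < p) {W : ℝ}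
    (hW : ∀ t : ℝ, 0 < t → ENNReal.ofReal t ^ p * ν {y | t < ‖g y‖} ≤ ENNReal.ofReal W)
    {f : X → H →L[ℂ] H} (hf : MemLpSchatten p f μ) {η : Lp H 2 μ} (hη : η ∈ simpleVectors H μ) :
    ∃ τ, IsDualImage f Φ g η τ := by
  obtain ⟨σ, hσ⟩ := hη
  have hσm : MemLp σ 2 μ := (memLp_congr_ae hσ).1 (Lp.memLp η)
  have h2 := hf.memLp_adjoint_simpleFunc hp hσm (q := 2) le_rfl
  have h1 := (memLp_congr_ae h2.coeFn_toLp).2 (hf.memLp_adjoint_simpleFunc hp hσm one_le_two)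
  have h3 := memLp_adjoint_apply hg hp hW (by positivity) (ae_norm_le_of_memLp_one hΦ₁ h1)
  refine ⟨h3.toLp, h2.toLp, ?_, h3.coeFn_toLp⟩
  filter_upwards [h2.coeFn_toLp, hσ] with x h4 h5
  rw [h4, h5]

theorem cwikel_of_simpleVectors
    (hΦ₁ : ∀ (φ : Lp H 2 μ) (φ₁ : Lp H 1 μ), φ =ᵐ[μ] φ₁ → Φ φ =ᵐ[ν] Φ₁ φ₁)
    {g : Y → G →L[ℂ] G} (hg : OpMeasurable g ν) {p : ℝ} (hp : 2 < p) {W : ℝ} (hW0 : 0 ≤ W)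
    (hW : ∀ t : ℝ, 0 < t → ENNReal.ofReal t ^ p * ν {y | t < ‖g y‖} ≤ ENNReal.ofReal W)
    {f : X → H →L[ℂ] H} (hf : MemLpSchatten p f μ) {F : ℝ} (hF0 : 0 ≤ F)
    (hF : ∫⁻ x, eSchattenNorm p (f x) ^ p ∂μ ≤ ENNReal.ofReal F)
    {N : ℕ} {η : Fin N → Lp H 2 μ} (hη : ∀ i, η i ∈ simpleVectors H μ)
    (hcontr : ∀ c : EuclideanSpace ℂ (Fin N), ‖∑ i, c i • η i‖ ≤ ‖c‖)
    {τ : Fin N → Lp G 2 ν} (hτ : ∀ i, IsDualImage f Φ g (η i) (τ i)) {r : ℝ} (hr : 0 < r)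
    (hlow : ∀ c : EuclideanSpace ℂ (Fin N), r * ‖c‖ ≤ ‖∑ i, c i • τ i‖) :
    N * r ^ p ≤ 2 * (p - 2) / (p + 2) * (p / (p - 2)) ^ p * (‖Φ₁‖ ^ 2 * F * W) := by
  choose σ hσ using hη
  choose ζ hζ hτζ using hτ
  refine cwikel_of_simpleFunc hΦ₁ hg hp hW0 hW hf hF0 hF
    (fun i => (memLp_congr_ae (hσ i)).1 (Lp.memLp (η i))) (fun c => ?_) (fun i => ?_) hτζ hr hlow
  · have h1 : ∫⁻ x, ‖∑ i, c i • σ i x‖ₑ ^ 2 ∂μ = ‖∑ i, c i • η i‖ₑ ^ 2 := by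
      rw [Lp_enorm_sq]
      refine lintegral_congr_ae ?_
      filter_upwards [coeFn_sum_smul Finset.univ c η, ae_all_iff.2 hσ] with x h2 h3
      rw [h2]
      simp_rw [h3]
    rw [h1, ← ofReal_norm, ← ENNReal.ofReal_pow (norm_nonneg _)]
    exact ENNReal.ofReal_le_ofReal (pow_le_pow_left₀ (norm_nonneg _) (hcontr c) 2)
  · filter_upwards [hζ i, hσ i] with x h1 h2
    rw [h1, h2]

/-- The count for `N = 1`, where `r` is the norm of the image of a vector of norm at most one. -/
theorem norm_le_of_isDualImage
    (hΦ₁ : ∀ (φ : Lp H 2 μ) (φ₁ : Lp H 1 μ), φ =ᵐ[μ] φ₁ → Φ φ =ᵐ[ν] Φ₁ φ₁)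
    {g : Y → G →L[ℂ] G} (hg : OpMeasurable g ν) {p : ℝ} (hp : 2 < p) {W : ℝ} (hW0 : 0 ≤ W)
    (hW : ∀ t : ℝ, 0 < t → ENNReal.ofReal t ^ p * ν {y | t < ‖g y‖} ≤ ENNReal.ofReal W)
    {f : X → H →L[ℂ] H} (hf : MemLpSchatten p f μ) {F : ℝ} (hF0 : 0 ≤ F)
    (hF : ∫⁻ x, eSchattenNorm p (f x) ^ p ∂μ ≤ ENNReal.ofReal F) :
    ∃ κ : ℝ, 0 ≤ κ ∧ ∀ η ∈ simpleVectors H μ, ∀ τ, IsDualImage f Φ g η τ → ‖τ‖ ≤ κ * ‖η‖ := by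
  set C := 2 * (p - 2) / (p + 2) * (p / (p - 2)) ^ p * (‖Φ₁‖ ^ 2 * F * W) with hC
  have hp0 : 0 < p := by linarith
  have hp2 : 0 < p - 2 := by linarith
  have hC0 : 0 ≤ C := by positivity
  refine ⟨C ^ (1 / p), by positivity, fun η hη τ hτ => ?_⟩
  set κ := C ^ (1 / p) with hκ
  have hκ0 : 0 ≤ κ := by positivity
  -- Normalizing by `a > ‖η‖` instead of `‖η‖` also covers `η = 0`.
  have hstep : ∀ a : ℝ, ‖η‖ < a → ‖τ‖ ≤ κ * a := fun a ha => by
    have ha0 : 0 < a := (norm_nonneg _).trans_lt ha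
    rcases (norm_nonneg τ).eq_or_lt with h0 | h0
    · rw [← h0]
      positivity
    have hnorm : ∀ c : EuclideanSpace ℂ (Fin 1), ‖c‖ = ‖c 0‖ := fun c => by
      rw [EuclideanSpace.norm_eq]
      simp
    have han : ‖((a⁻¹ : ℝ) : ℂ)‖ = a⁻¹ := by
      rw [Complex.norm_real, Real.norm_of_nonneg (by positivity)]
    have h1 := cwikel_of_simpleVectors (N := 1) hΦ₁ hg hp hW0 hW hf hF0 hF
      (η := fun _ => ((a⁻¹ : ℝ) : ℂ) • η) (τ := fun _ => ((a⁻¹ : ℝ) : ℂ) • τ)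
      (fun _ => smul_mem_simpleVectors _ hη) (fun c => ?_)
      (fun _ => hτ.smul (Φ := (Φ.toContinuousLinearEquiv : Lp H 2 μ →L[ℂ] Lp G 2 ν)) _)
      (r := a⁻¹ * ‖τ‖) (by positivity) (fun c => ?_)
    · rw [Nat.cast_one, one_mul] at h1
      have h2 := Real.rpow_le_rpow (by positivity) h1 (by positivity : 0 ≤ 1 / p)
      rw [← Real.rpow_mul (by positivity), mul_one_div_cancel hp0.ne', Real.rpow_one] at h2
      rwa [inv_mul_le_iff₀ ha0, mul_comm] at h2
    · rw [Fin.sum_univ_one, hnorm, norm_smul, norm_smul, han]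
      refine mul_le_of_le_one_right (norm_nonneg _) ?_
      rw [inv_mul_le_iff₀ ha0, mul_one]
      exact ha.le
    · rw [Fin.sum_univ_one, hnorm, norm_smul, norm_smul, han, mul_comm]
  have hlim : Filter.Tendsto (fun a : ℝ => κ * a) (nhdsWithin ‖η‖ (Set.Ioi ‖η‖))
      (nhds (κ * ‖η‖)) := by
    have h : Continuous fun a : ℝ => κ * a := by fun_prop
    exact (h.tendsto _).mono_left nhdsWithin_le_nhds
  refine ge_of_tendsto hlim ?_
  filter_upwards [self_mem_nhdsWithin] with a ha using hstep a ha

theorem norm_sandwich_le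
    (hΦ₁ : ∀ (φ : Lp H 2 μ) (φ₁ : Lp H 1 μ), φ =ᵐ[μ] φ₁ → Φ φ =ᵐ[ν] Φ₁ φ₁)
    {g : Y → G →L[ℂ] G} (hg : OpMeasurable g ν) {p : ℝ} (hp : 2 < p) {W : ℝ} (hW0 : 0 ≤ W)
    (hW : ∀ t : ℝ, 0 < t → ENNReal.ofReal t ^ p * ν {y | t < ‖g y‖} ≤ ENNReal.ofReal W)
    {f : X → H →L[ℂ] H} (hf : MemLpSchatten p f μ) {F : ℝ} (hF0 : 0 ≤ F)
    (hF : ∫⁻ x, eSchattenNorm p (f x) ^ p ∂μ ≤ ENNReal.ofReal F) :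
    ∃ κ : ℝ, ∀ ψ : (sandwich μ ν f (Φ.toContinuousLinearEquiv : Lp H 2 μ →L[ℂ] Lp G 2 ν) g).domain,
      ‖sandwich μ ν f (Φ.toContinuousLinearEquiv : Lp H 2 μ →L[ℂ] Lp G 2 ν) g ψ‖ ≤
        κ * ‖(ψ : Lp G 2 ν)‖ := by
  obtain ⟨κ, hκ0, hκ⟩ := norm_le_of_isDualImage hΦ₁ hg hp hW0 hW hf hF0 hF
  refine ⟨κ, fun ψ => ?_⟩
  set v := sandwich μ ν f (Φ.toContinuousLinearEquiv : Lp H 2 μ →L[ℂ] Lp G 2 ν) g ψ with hv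
  have h1 : ∀ η : Lp H 2 μ, ‖inner ℂ v η‖ ≤ κ * ‖(ψ : Lp G 2 ν)‖ * ‖η‖ := by
    intro η
    refine dense_simpleVectors.induction (P := fun η : Lp H 2 μ =>
      ‖inner ℂ v η‖ ≤ κ * ‖(ψ : Lp G 2 ν)‖ * ‖η‖) (fun η hη => ?_)
      (isClosed_le (by fun_prop) (by fun_prop)) η
    obtain ⟨τ, hτ⟩ := exists_isDualImage hΦ₁ hg hp hW hf hη
    rw [inner_sandwich_apply ψ (τ := τ) hτ]
    calc _ ≤ ‖(ψ : Lp G 2 ν)‖ * ‖τ‖ := norm_inner_le_norm _ _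
      _ ≤ ‖(ψ : Lp G 2 ν)‖ * (κ * ‖η‖) := by
          gcongr
          exact hκ η hη τ hτ
      _ = _ := by ring
  have h2 := h1 v
  rw [← ofReal_norm_sq, Complex.norm_real, Real.norm_of_nonneg (by positivity)] at h2
  rcases (norm_nonneg v).eq_or_lt with h0 | h0
  · rw [← h0]
    positivity
  · nlinarith

end NaturalDomain

end Cwikel

namespace Cwikel

/-! ### Density of the natural domain -/

section DenseDomain

variable {X Y : Type*} [MeasurableSpace X] [MeasurableSpace Y] {μ : Measure X} {ν : Measure Y}
  {H : Type*} [NormedAddCommGroup H] [InnerProductSpace ℂ H] [CompleteSpace H]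
  {G : Type*} [NormedAddCommGroup G] [InnerProductSpace ℂ G] [CompleteSpace G]

theorem inner_eq_indicator_norm {u : X → H} {E : Set X}
    {χ : X → H} (hχ : ∀ x, χ x = E.indicator (fun x => ((‖u x‖⁻¹ : ℝ) : ℂ) • u x) x) (x : X) :
    inner ℂ (u x) (χ x) = ((E.indicator (fun x => ‖u x‖) x : ℝ) : ℂ) := by
  rw [hχ]
  by_cases hx : x ∈ E
  · rw [Set.indicator_of_mem hx, Set.indicator_of_mem hx, inner_smul_right, ← ofReal_norm_sq,
      ← Complex.ofReal_mul]
    congr 1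
    rcases eq_or_ne ‖u x‖ 0 with h | h
    · simp [h]
    · field_simp
  · simp [hx]

/-- The adjoint of a unitary operator which maps `L¹` to `L^∞` maps `L¹` to `L^∞`. -/
theorem ae_norm_adjoint_le [SigmaFinite μ] {Φ : Lp H 2 μ →L[ℂ] Lp G 2 ν}
    {Φ₁ : Lp H 1 μ →L[ℂ] Lp G ∞ ν}
    (hΦ₁ : ∀ (φ : Lp H 2 μ) (φ₁ : Lp H 1 μ), φ =ᵐ[μ] φ₁ → Φ φ =ᵐ[ν] Φ₁ φ₁)
    {θ : Lp G 2 ν} (hθ : MemLp θ 1 ν) :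
    ∀ᵐ x ∂μ, ‖ContinuousLinearMap.adjoint Φ θ x‖ ≤ ‖Φ₁‖ * (eLpNorm θ 1 ν).toReal := by
  set u := ContinuousLinearMap.adjoint Φ θ with hu
  set B := ‖Φ₁‖ * (eLpNorm θ 1 ν).toReal with hB
  have hB0 : 0 ≤ B := by positivity
  have hum := Lp.aestronglyMeasurable u
  -- Duality: testing `u` against its own direction `u / ‖u‖` on `E` gives the integral of `‖u‖`
  -- over `E`, while `Φ` maps the test function into `L^∞` with bound `‖Φ₁‖ * μ E`. By σ-finiteness,
  -- averages over such sets determine the pointwise bound.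
  have key : ∀ E : Set X, MeasurableSet E → μ E < ∞ →
      ∫⁻ x in E, ‖u x‖ₑ ∂μ ≤ ∫⁻ _ in E, ENNReal.ofReal B ∂μ := by
    intro E hE hEfin
    have : IsFiniteMeasure (μ.restrict E) := ⟨by simpa using hEfin⟩
    set w : X → H := fun x => ((‖u x‖⁻¹ : ℝ) : ℂ) • u x with hw
    have hwm : AEStronglyMeasurable w μ := by
      refine AEStronglyMeasurable.smul ?_ hum
      exact Complex.continuous_ofReal.comp_aestronglyMeasurable
        hum.norm.aemeasurable.inv.aestronglyMeasurable
    have hw1 : ∀ x, ‖w x‖ ≤ 1 := fun x => by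
      rw [hw, norm_smul, Complex.norm_real, norm_inv, norm_norm]
      exact inv_mul_le_one
    have hχ : ∀ q : ℝ≥0∞, MemLp (E.indicator w) q μ := fun q =>
      (memLp_indicator_iff_restrict hE).2
        (MemLp.of_bound hwm.restrict 1 (Filter.Eventually.of_forall hw1))
    set χ : Lp H 2 μ := (hχ 2).toLp with hχdef
    have hχae : χ =ᵐ[μ] E.indicator w := (hχ 2).coeFn_toLp
    have hχ1 : MemLp χ 1 μ := (memLp_congr_ae hχae).2 (hχ 1)
    have hχn : (eLpNorm χ 1 μ).toReal ≤ μ.real E := by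
      refine ENNReal.toReal_mono hEfin.ne ?_
      rw [eLpNorm_congr_ae hχae, eLpNorm_one_eq_lintegral_enorm]
      calc ∫⁻ x, ‖E.indicator w x‖ₑ ∂μ ≤ ∫⁻ x, E.indicator 1 x ∂μ := by
            refine lintegral_mono fun x => ?_
            by_cases hx : x ∈ E
            · rw [Set.indicator_of_mem hx, Set.indicator_of_mem hx, ← ofReal_norm,
                Pi.one_apply, ← ENNReal.ofReal_one]
              exact ENNReal.ofReal_le_ofReal (hw1 x)
            · simp [hx]
        _ = μ E := by rw [lintegral_indicator_one hE]
    have h1 : inner ℂ u χ = ((∫ x in E, ‖u x‖ ∂μ : ℝ) : ℂ) := by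
      rw [L2.inner_def, ← integral_indicator hE, ← integral_complex_ofReal]
      refine integral_congr_ae ?_
      filter_upwards [hχae] with x hx
      rw [hx]
      exact inner_eq_indicator_norm (fun _ => rfl) x
    have h2 : ‖inner ℂ u χ‖ ≤ B * μ.real E := by
      rw [hu, ContinuousLinearMap.adjoint_inner_left, L2.inner_def]
      refine (norm_integral_le_of_norm_le
        (g := fun y => ‖θ y‖ * (‖Φ₁‖ * (eLpNorm χ 1 μ).toReal))
        ((memLp_one_iff_integrable.1 hθ).norm.mul_const _) ?_).trans ?_
      · filter_upwards [ae_norm_le_of_memLp_one (Φ := Φ) hΦ₁ hχ1] with y hy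
        refine (norm_inner_le_norm _ _).trans ?_
        gcongr
      · rw [integral_mul_const, integral_norm_eq_lintegral_enorm hθ.1,
          ← eLpNorm_one_eq_lintegral_enorm, hB]
        calc _ ≤ (eLpNorm θ 1 ν).toReal * (‖Φ₁‖ * μ.real E) := by gcongr
          _ = _ := by ring
    have hint : Integrable u (μ.restrict E) :=
      memLp_one_iff_integrable.1 (((Lp.memLp u).restrict E).mono_exponent one_le_two)
    rw [h1, Complex.norm_real, Real.norm_of_nonneg (by positivity)] at h2
    rw [← ofReal_integral_norm_eq_lintegral_enorm hint, setLIntegral_const]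
    refine (ENNReal.ofReal_le_ofReal h2).trans (le_of_eq ?_)
    rw [ENNReal.ofReal_mul hB0, ofReal_measureReal hEfin.ne]
  filter_upwards [ae_le_of_forall_setLIntegral_le_of_sigmaFinite₀ hum.enorm key] with x hx
  rw [← ofReal_norm] at hx
  exact (ENNReal.ofReal_le_ofReal_iff hB0).1 hx

/-- Where `‖f‖ ≤ 1`, `‖f u‖ ≤ ‖u‖`; elsewhere `‖f‖ ^ 2 ≤ ‖f‖ ^ p`, which is dominated by the
integrable Schatten term, and `u` is bounded. -/
theorem MemLpSchatten.memLp_two_apply [TopologicalSpace.SeparableSpace H] {p : ℝ} (hp : 2 < p)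
    {f : X → H →L[ℂ] H} (hf : MemLpSchatten p f μ) {u : X → H} (hu : MemLp u 2 μ) {B : ℝ}
    (hB : ∀ᵐ x ∂μ, ‖u x‖ ≤ B) : MemLp (fun x => f x (u x)) 2 μ := by
  have hp0 : 0 < p := by linarith
  refine memLp_two_of_lintegral (hf.measurable.apply hu.1) ?_
  have h2 : ∫⁻ x, ‖u x‖ₑ ^ 2 ∂μ < ∞ := by
    have := hu.2
    rw [eLpNorm_lt_top_iff_lintegral_rpow_enorm_lt_top two_ne_zero ENNReal.ofNat_ne_top] at this
    simpa using this
  calc ∫⁻ x, ‖f x (u x)‖ₑ ^ 2 ∂μ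
      ≤ ∫⁻ x, (‖u x‖ₑ ^ 2 + eSchattenNorm p (f x) ^ p * ENNReal.ofReal B ^ 2) ∂μ := by
        refine lintegral_mono_ae ?_
        filter_upwards [hB, hf.memSchatten] with x h1 h3
        have h4 : ‖f x (u x)‖ₑ ^ 2 ≤ ‖f x‖ₑ ^ 2 * ‖u x‖ₑ ^ 2 := by
          rw [← mul_pow]
          gcongr
          exact (f x).le_opENorm _
        refine h4.trans ?_
        rcases le_total ‖f x‖ₑ 1 with h | h
        · refine le_add_right (mul_le_of_le_one_left zero_le ?_)
          exact pow_le_one₀ zero_le h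
        · refine le_add_left ?_
          gcongr
          · rw [← ENNReal.rpow_ofNat]
            exact (ENNReal.rpow_le_rpow_of_exponent_le h hp.le).trans
              (ENNReal.rpow_le_rpow (enorm_le_eSchattenNorm h3.1 hp.le) hp0.le)
          · rw [← ofReal_norm]
            exact ENNReal.ofReal_le_ofReal h1
    _ = ∫⁻ x, ‖u x‖ₑ ^ 2 ∂μ + (∫⁻ x, eSchattenNorm p (f x) ^ p ∂μ) * ENNReal.ofReal B ^ 2 := by
        rw [lintegral_add_left' (hu.1.enorm.pow_const 2), lintegral_mul_const' _ _ (by finiteness)]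
    _ < ∞ := ENNReal.add_lt_top.2
        ⟨h2, ENNReal.mul_lt_top (hf.lintegral_lt_top hp) (by finiteness)⟩

/-- The operator `f Φ* g` is densely defined. -/
theorem dense_sandwich_domain [SigmaFinite μ] [SigmaFinite ν] [TopologicalSpace.SeparableSpace H]
    [TopologicalSpace.SeparableSpace G] {Φ : Lp H 2 μ →L[ℂ] Lp G 2 ν}
    {Φ₁ : Lp H 1 μ →L[ℂ] Lp G ∞ ν}
    (hΦ₁ : ∀ (φ : Lp H 2 μ) (φ₁ : Lp H 1 μ), φ =ᵐ[μ] φ₁ → Φ φ =ᵐ[ν] Φ₁ φ₁)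
    {g : Y → G →L[ℂ] G} (hg : OpMeasurable g ν) {p : ℝ} (hp : 2 < p)
    {f : X → H →L[ℂ] H} (hf : MemLpSchatten p f μ) :
    Dense ((sandwich μ ν f Φ g).domain : Set (Lp G 2 ν)) := by
  rw [Submodule.dense_iff_topologicalClosure_eq_top, Submodule.topologicalClosure_eq_top_iff,
    eq_bot_iff]
  intro ψ hψ
  rw [Submodule.mem_bot]
  set γ := hg.aemeasurable_norm.mk _ with hγ
  have hγae : (fun y => ‖g y‖) =ᵐ[ν] γ := hg.aemeasurable_norm.ae_eq_mk
  -- Cutting `ψ` off to `Z k` makes `g φ` lie in `L¹ ∩ L²`, so `Φ* (g φ)` is bounded and `φ` is in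
  -- the domain. If `ψ` is orthogonal to the domain, then `0 = ⟨φ, ψ⟩ = ‖φ‖ ^ 2`, and the `Z k`
  -- exhaust `Y`.
  set Z : ℕ → Set Y := fun k => spanningSets ν k ∩ {y | γ y ≤ k} with hZ
  have hZm : ∀ k, MeasurableSet (Z k) := fun k =>
    (measurableSet_spanningSets ν k).inter
      (measurableSet_le hg.aemeasurable_norm.measurable_mk measurable_const)
  have hzero : ∀ k, ∀ᵐ y ∂ν, y ∈ Z k → ψ y = 0 := by
    intro k
    have hfin : ν (Z k) < ∞ :=
      (measure_mono Set.inter_subset_left).trans_lt (measure_spanningSets_lt_top ν k)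
    have : IsFiniteMeasure (ν.restrict (Z k)) := ⟨by simpa using hfin⟩
    have hφ : MemLp ((Z k).indicator ψ) 2 ν := (Lp.memLp ψ).indicator (hZm k)
    set φ : Lp G 2 ν := hφ.toLp with hφdef
    have hφae : φ =ᵐ[ν] (Z k).indicator ψ := hφ.coeFn_toLp
    have hgφm : AEStronglyMeasurable (fun y => g y (φ y)) ν :=
      hg.apply (Lp.aestronglyMeasurable φ)
    have hgφ2 : MemLp (fun y => g y (φ y)) 2 ν := by
      refine (Lp.memLp φ).of_le_mul (c := k) hgφm ?_
      filter_upwards [hφae, hγae] with y h1 h2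
      by_cases hy : y ∈ Z k
      · refine ((g y).le_opNorm _).trans ?_
        gcongr
        have h3 : ‖g y‖ = γ y := h2
        rw [h3]
        exact hy.2
      · rw [h1, Set.indicator_of_notMem hy]
        simp
    have hgφ1 : MemLp (fun y => g y (φ y)) 1 ν := by
      have h1 : (fun y => g y (φ y)) =ᵐ[ν] (Z k).indicator fun y => g y (φ y) := by
        filter_upwards [hφae] with y h1
        by_cases hy : y ∈ Z k
        · rw [Set.indicator_of_mem hy]
        · rw [Set.indicator_of_notMem hy, h1, Set.indicator_of_notMem hy, map_zero]
      refine (memLp_congr_ae h1).2 ((memLp_indicator_iff_restrict (hZm k)).2 ?_)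
      exact (hgφ2.restrict _).mono_exponent one_le_two
    have hdom : φ ∈ (sandwich μ ν f Φ g).domain :=
      mem_sandwich_domain.2 ⟨hgφ2, hf.memLp_two_apply hp (Lp.memLp _)
        (ae_norm_adjoint_le hΦ₁ ((memLp_congr_ae hgφ2.coeFn_toLp).2 hgφ1))⟩
    have h0 : inner ℂ φ ψ = inner ℂ φ φ := by
      rw [L2.inner_def, L2.inner_def]
      refine integral_congr_ae ?_
      filter_upwards [hφae] with y h1
      by_cases hy : y ∈ Z k
      · rw [h1, Set.indicator_of_mem hy]
      · rw [h1, Set.indicator_of_notMem hy, inner_zero_left, inner_zero_left]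
    rw [(Submodule.mem_orthogonal _ _).1 hψ φ hdom] at h0
    have h1 : φ = 0 := inner_self_eq_zero.1 h0.symm
    have h2 : φ =ᵐ[ν] 0 := by
      rw [h1]
      exact Lp.coeFn_zero G 2 ν
    filter_upwards [hφae, h2] with y h3 h4 hy
    rwa [h3, Set.indicator_of_mem hy] at h4
  refine Lp.ext ?_
  filter_upwards [ae_all_iff.2 hzero, Lp.coeFn_zero G 2 ν] with y h1 h2
  rw [h2]
  obtain ⟨m, hm⟩ := exists_nat_ge (γ y)
  obtain ⟨l, hl⟩ := Set.mem_iUnion.1 ((iUnion_spanningSets ν).symm ▸ Set.mem_univ y :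
    y ∈ ⋃ i, spanningSets ν i)
  refine h1 (max m l) ⟨monotone_spanningSets ν (le_max_right m l) hl, hm.trans ?_⟩
  exact_mod_cast le_max_left m l

end DenseDomain

end Cwikel

namespace Cwikel

theorem exists_bounded_extension {E F : Type*} [NormedAddCommGroup E] [NormedSpace ℂ E]
    [NormedAddCommGroup F] [NormedSpace ℂ F] [CompleteSpace F] {S : E →ₗ.[ℂ] F}
    (hS : Dense (S.domain : Set E)) {κ : ℝ} (hκ : ∀ ψ : S.domain, ‖S ψ‖ ≤ κ * ‖(ψ : E)‖) :
    ∃ A : E →L[ℂ] F, S ≤ (A : E →ₗ[ℂ] F).toPMap ⊤ ∧ ∀ ψ : S.domain, A ψ = S ψ := by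
  have h : ∀ ψ : S.domain, S.toFun.extendOfNorm S.domain.subtype ψ = S ψ :=
    LinearMap.extendOfNorm_eq (by simpa [DenseRange] using hS) ⟨κ, hκ⟩
  refine ⟨S.toFun.extendOfNorm S.domain.subtype, ⟨le_top, ?_⟩, h⟩
  rintro x y hxy
  rw [← h x, hxy]
  rfl

end Cwikel

end

/-! ### Assembly of the theorem -/

theorem theorem6p1
    {X Y : Type*} [MeasurableSpace X] [MeasurableSpace Y]
    (μ : Measure X) (ν : Measure Y) [SigmaFinite μ] [SigmaFinite ν]
    {H : Type*} [NormedAddCommGroup H] [InnerProductSpace ℂ H] [CompleteSpace H]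
    [TopologicalSpace.SeparableSpace H]
    {G : Type*} [NormedAddCommGroup G] [InnerProductSpace ℂ G] [CompleteSpace G]
    [TopologicalSpace.SeparableSpace G]
    -- `Φ` is unitary from `L²(X, H)` to `L²(Y, G)`
    (Φ : Lp H 2 μ ≃ₗᵢ[ℂ] Lp G 2 ν)
    -- and it is also bounded from `L¹(X, H)` to `L^∞(Y, G)`
    (Φ₁ : Lp H 1 μ →L[ℂ] Lp G ∞ ν)
    (hΦ₁ : ∀ (φ : Lp H 2 μ) (φ₁ : Lp H 1 μ), φ =ᵐ[μ] φ₁ → Φ φ =ᵐ[ν] Φ₁ φ₁)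
    (p : ℝ) (hp : 2 < p)
    (f : X → H →L[ℂ] H) (hf : Cwikel.MemLpSchatten p f μ)
    (g : Y → G →L[ℂ] G) (hg : Cwikel.MemWeakLp p g ν) :
    -- `f Φ* g` is densely defined and its bounded extension `A` to `L²(Y, G)` is in `S_{p,w}`
    Dense ((Cwikel.sandwich μ ν f (Φ.toContinuousLinearEquiv : Lp H 2 μ →L[ℂ] Lp G 2 ν) g).domain :
        Set (Lp G 2 ν)) ∧
    ∃ A : Lp G 2 ν →L[ℂ] Lp H 2 μ,
      Cwikel.sandwich μ ν f (Φ.toContinuousLinearEquiv : Lp H 2 μ →L[ℂ] Lp G 2 ν) g ≤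
        (A : Lp G 2 ν →ₗ[ℂ] Lp H 2 μ).toPMap ⊤ ∧
      Cwikel.MemWeakSchatten p A ∧
      Cwikel.eWeakSchattenNorm p A ^ p ≤
        ENNReal.ofReal (2 * (p - 2) / (p + 2) * (p / (p - 2)) ^ p) *
          ENNReal.ofReal ‖Φ₁‖ ^ 2 * Cwikel.eLpSchattenNorm p f μ ^ p *
            Cwikel.eWeakLpNorm p g ν ^ p := by
  have hp0 : 0 < p := by linarith
  have hp2 : 0 < p - 2 := by linarith
  set S := Cwikel.sandwich μ ν f (Φ.toContinuousLinearEquiv : Lp H 2 μ →L[ℂ] Lp G 2 ν) g with hS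
  set F := (Cwikel.eLpSchattenNorm p f μ ^ p).toReal with hFdef
  set W := (Cwikel.eWeakLpNorm p g ν ^ p).toReal with hWdef
  have hFof : ENNReal.ofReal F = Cwikel.eLpSchattenNorm p f μ ^ p :=
    ENNReal.ofReal_toReal (ENNReal.rpow_ne_top_of_nonneg hp0.le hf.norm_lt_top.ne)
  have hWof : ENNReal.ofReal W = Cwikel.eWeakLpNorm p g ν ^ p :=
    ENNReal.ofReal_toReal (ENNReal.rpow_ne_top_of_nonneg hp0.le hg.norm_lt_top.ne)
  have hF0 : 0 ≤ F := ENNReal.toReal_nonneg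
  have hW0 : 0 ≤ W := ENNReal.toReal_nonneg
  have hF : ∫⁻ x, Cwikel.eSchattenNorm p (f x) ^ p ∂μ ≤ ENNReal.ofReal F := by
    rw [hFof, Cwikel.eLpSchattenNorm, ← ENNReal.rpow_mul, one_div_mul_cancel hp0.ne',
      ENNReal.rpow_one]
  have hW : ∀ t : ℝ, 0 < t →
      ENNReal.ofReal t ^ p * ν {y | t < ‖g y‖} ≤ ENNReal.ofReal W := by
    intro t ht
    rw [hWof, Cwikel.eWeakLpNorm, ← ENNReal.rpow_mul, one_div_mul_cancel hp0.ne',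
      ENNReal.rpow_one]
    exact le_iSup₂_of_le t ht le_rfl
  have hdense : Dense (S.domain : Set (Lp G 2 ν)) :=
    Cwikel.dense_sandwich_domain (Φ := (Φ.toContinuousLinearEquiv : Lp H 2 μ →L[ℂ] Lp G 2 ν))
      hΦ₁ hg.measurable hp hf
  obtain ⟨κ, hκ⟩ := Cwikel.norm_sandwich_le hΦ₁ hg.measurable hp hW0 hW hf hF0 hF
  obtain ⟨A, hle, hAS⟩ := Cwikel.exists_bounded_extension hdense hκ
  -- On simple functions the abstract adjoint of the extension is the concrete `g* Φ f*`; inner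
  -- products with the dense domain decide this.
  have hadj : ∀ η τ, Cwikel.IsDualImage f Φ g η τ → ContinuousLinearMap.adjoint A η = τ := by
    intro η τ h
    refine hdense.eq_of_inner_right ℂ fun ψ hψ => ?_
    rw [ContinuousLinearMap.adjoint_inner_right]
    refine (congrArg (fun v => inner ℂ v η) (hAS ⟨ψ, hψ⟩)).trans ?_
    exact Cwikel.inner_sandwich_apply ⟨ψ, hψ⟩ h
  set C := 2 * (p - 2) / (p + 2) * (p / (p - 2)) ^ p * (‖Φ₁‖ ^ 2 * F * W) with hC
  have hcount : ∀ (V : Submodule ℂ (Lp H 2 μ)) [FiniteDimensional ℂ V] (r : ℝ), 0 < r →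
      (∀ w ∈ V, r * ‖w‖ ≤ ‖ContinuousLinearMap.adjoint A w‖) →
        Module.finrank ℂ V * r ^ p ≤ C := by
    intro V _ r hr hV
    refine Cwikel.finrank_mul_rpow_le_of_orthonormal (B := ContinuousLinearMap.adjoint A)
      (fun n w hw r hr hlow => ?_) V hr hV
    refine Cwikel.count_orthonormal_of_dense (B := ContinuousLinearMap.adjoint A) hp0
      Cwikel.dense_simpleVectors (fun c η hη => Cwikel.smul_mem_simpleVectors c hη)
      (fun n η hη hcontr r hr hlow => ?_) hw hr hlow
    refine Cwikel.cwikel_of_simpleVectors hΦ₁ hg.measurable hp hW0 hW hf hF0 hF hη hcontr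
      (τ := fun i => ContinuousLinearMap.adjoint A (η i)) (fun i => ?_) hr hlow
    obtain ⟨τ, hτ⟩ := Cwikel.exists_isDualImage hΦ₁ hg.measurable hp hW hf (hη i)
    rwa [hadj _ _ hτ]
  have hnorm : Cwikel.eWeakSchattenNorm p A ^ p ≤ ENNReal.ofReal C := by
    rw [Cwikel.eWeakSchattenNorm, ← ENNReal.rpow_mul, one_div_mul_cancel hp0.ne',
      ENNReal.rpow_one]
    refine iSup_le fun n => ?_
    rw [ENNReal.ofReal_rpow_of_nonneg (Cwikel.singularValue_nonneg A n) hp0.le,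
      ← ENNReal.ofReal_natCast, ← ENNReal.ofReal_mul (Nat.cast_nonneg _)]
    exact ENNReal.ofReal_le_ofReal (Cwikel.mul_singularValue_rpow_le hp0 hcount n)
  refine ⟨hdense, A, hle,
    ⟨Cwikel.isCompactOperator_of_finrank_mul_rpow_le hcount, ?_⟩, ?_⟩
  · exact (ENNReal.rpow_lt_top_iff_of_pos hp0).1 (hnorm.trans_lt ENNReal.ofReal_lt_top)
  · refine hnorm.trans (le_of_eq ?_)
    rw [hC, ENNReal.ofReal_mul (by positivity), ENNReal.ofReal_mul (by positivity),
      ENNReal.ofReal_mul (by positivity), ENNReal.ofReal_mul (by positivity),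
      ENNReal.ofReal_pow (norm_nonneg Φ₁), hFof, hWof]
    ring
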